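/- Let $\mu\ge 2$ be an integer and $\lambda\in\mathbb C$ with $\Re\lambda>0$. Let $\mathscr P$ be a contour (a continuous, piecewise continuously differentiable path with non-zero one-sided derivative at its starting point) from a finite point $a\in\mathbb C$ to a finite or infinite point $b$, let $(a,b)_{\mathscr P}$ denote $\mathscr P$ without its end points, and let $\varpi$ be the angle of slope of $\mathscr P$ at $a$, i.e. the limit of $\arg(t-a)$ as $t\to a$ along $\mathscr P$ (not necessarily a principal value). Let $\theta_1\le\theta_2$ with $\theta_2-\theta_1<\pi$, let $Z>0$, and consider $$I(z)=\int_a^b \exp\left(-zp(t)+z^{1/\mu}r(t)\right)q(t)\,dt\quad\text{along }\mathscr P,\qquad z=|z|e^{i\theta},\ \theta_1\le\theta\le\theta_2,$$ where every power of $z$ is $z^{s}=\exp(s(\log|z|+i\theta))$. Assume: (i) $p,q,r$ are independent of $z$, single-valued and analytic in a domain $\mathbf T\subseteq\mathbb C$. (ii) $\mathscr P$ is independent of $z$ and $(a,b)_{\mathscr P}\subset\mathbf T$. (iii) Near $a$ there are convergent expansions $p(t)=p(a)+\sum_{n\ge0}p_n(t-a)^{n+\mu}$, $q(t)=\sum_{n\ge0}q_n(t-a)^{n+\lambda-1}$,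 $r(t)=\sum_{n\ge0}r_n(t-a)^{n+1}$ with $p_0\neq0$, where the branch of the powers $(t-a)^{n+\lambda-1}$ on $\mathscr P$ is the one for which $\arg(t-a)\to\varpi$ as $t\to a$ along $\mathscr P$. (iv) $I(Ze^{i\theta})$ converges at $b$ absolutely, and uniformly with respect to $\theta\in[\theta_1,\theta_2]$. (v) There is $\delta>0$ such that, for $t\in(a,b)_{\mathscr P}$ and $\theta\in[\theta_1,\theta_2]$, $p(t)\ne p(a)$ and $|\arg(e^{i\theta}p(t)-e^{i\theta}p(a))|\le\frac{\pi}{2}-\delta$; and $\Re(e^{i\theta}p(t)-e^{i\theta}p(a))$ is bounded away from zero, uniformly in $\theta$, as $t\to b$ along $\mathscr P$. (vi) $r(t)=\mathcal O(|p(t)-p(a)|)$ as $t\to b$ along $\mathscr P$. Then there is a value $\varpi_0$ of $\arg p_0$ with $|\varpi_0+\theta+\mu\varpi|\le\frac\pi2$ for all $\theta\in[\theta_1,\theta_2]$; put $p_0^{s}=\exp(s(\log|p_0|+i\varpi_0))$ and $x_0=r_0/p_0^{1/\mu}$. The integral $I(z)$ converges absolutely for all sufficiently large $|z|$, and, as $|z|\to+\infty$,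 uniformly in the sector $\theta_1\le\arg z\le\theta_2$, $$\begin{aligned}I(z)&\sim e^{-zp(a)}\sum_{n=0}^{\mu-1}\frac{1}{z^{(\lceil n/2\rceil+\lambda)/\mu}}\operatorname{Fi}^{(n)}\left(\frac1\mu,\frac\lambda\mu;x_0\right)\sum_{m=0}^\infty\frac{\widetilde f_{n,m}}{z^{m/\mu}}\\&=e^{-zp(a)}\sum_{n=0}^{\mu-1}\frac{1}{z^{(\lceil n/2\rceil+\lambda)/\mu}}\operatorname{Fi}\left(\frac1\mu,\frac{\lambda+n}\mu;x_0\right)\sum_{m=0}^\infty\frac{\widetilde f_{n,m}}{z^{m/\mu}},\end{aligned}$$ where the two forms agree term by term. Here $\operatorname{Fi}(\alpha,\beta;x)=\int_0^{+\infty}\exp(-t+xt^\alpha)\,t^{\beta-1}dt$ is Faxén's integral and $\operatorname{Fi}^{(n)}$ is its $n$-th derivative with respect to $x$. The meaning of $\sim$ is: for every integer $N\ge0$, if for each $n$ the series over $m$ is cut off after $M_n$ terms with $\lceil n/2\rceil+M_n\ge N$, then the error is $e^{-zp(a)}\,\mathcal O(|z|^{-(N+\Re\lambda)/\mu})$, uniformly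 in $\theta$. The coefficients are $$\widetilde f_{n,m}=\sum_{j=m}^{\lceil n/2\rceil+2m}g_{\lceil n/2\rceil+j,n}(x_0)\,f_{\lceil n/2\rceil+m,\,j-m},\qquad f_{n,m}=\frac1{m!}\sum_{j=m}^n b_{n-j}B_{j,m},$$ where $B_{j,m}$ is the coefficient of $X^j$ in $(\sum_{k\ge1}c_kX^k)^m$, $$b_n=\frac1\mu\operatorname*{Res}_{t=a}\frac{q(t)}{(p(t)-p(a))^{(n+\lambda)/\mu}}\ (n\ge0),\qquad c_n=\frac1\mu\operatorname*{Res}_{t=a}\frac{p'(t)\,r(t)}{(p(t)-p(a))^{(n+1)/\mu+1}}\ (n\ge1),$$ with the branch $(p(t)-p(a))^{s}=p_0^{s}(t-a)^{\mu s}\left(1+\frac{p_1}{p_0}(t-a)+\cdots\right)^{s}$, the last factor being $1$ at $t=a$ and $(t-a)^{\mu s}$ being taken with the same $\arg(t-a)$ as in (iii); and the polynomials $g_{j,n}$ ($j\ge 0$, $0\le n\le\mu-1$) are given by $g_{0,n}=\delta_{0,n}$ and $$g_{j+1,n}(x)=g_{j,n-1}(x)+g_{j,n}'(x)+\delta_{n,0}\tfrac{\lambda}{\mu}\,g_{j,\mu-1}(x)+\delta_{n,1}\tfrac{x}{\mu}\,g_{j,\mu-1}(x),\qquad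 g_{j,-1}:=0.$$ -/

import Mathlib

open Complex Filter Topology Set MeasureTheory

noncomputable section

namespace FaxenExpansion

/-- The power `(ρ e^{iφ})^s := exp (s (log ρ + i φ))` of a nonzero complex number given in polar
form. The angle `φ` is not reduced modulo `2π`: it selects the branch. -/
def polarPow (ρ φ : ℝ) (s : ℂ) : ℂ :=
  exp (s * ((Real.log ρ : ℂ) + (φ : ℂ) * I))

/-- The value of `arg u` in `(ϖ - π, ϖ + π]`. Along a contour on which `u → 0` with limiting
direction `ϖ`, this is, near the end `u = 0`, the continuous branch of `arg u` that tends to `ϖ`. -/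
def argNear (ϖ : ℝ) (u : ℂ) : ℝ :=
  ϖ + arg (u * exp (-(ϖ : ℂ) * I))

/-- Faxén's integral `Fi(α, β; x) = ∫₀^∞ exp (-t + x t^α) t^(β-1) dt`. -/
def Fi (α : ℝ) (β x : ℂ) : ℂ :=
  ∫ t in Ioi (0 : ℝ), exp (-(t : ℂ) + x * ((t ^ α : ℝ) : ℂ)) * (t : ℂ) ^ (β - 1)

/-- `γ`, restricted to `[0, 1)`, parametrizes a contour from the finite point `a` to the finite or
infinite point `b`: it is continuous and piecewise continuously differentiable (the break points
may accumulate only at the end `b`), with a nonzero one-sided derivative at the start `a`. -/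
structure IsContour (γ : ℝ → ℂ) (a : ℂ) (b : OnePoint ℂ) : Prop where
  start : γ 0 = a
  finish : Tendsto (fun s => (γ s : OnePoint ℂ)) (𝓝[<] 1) (𝓝 b)
  piecewise : ∃ τ : ℕ → ℝ, StrictMono τ ∧ τ 0 = 0 ∧ Tendsto τ atTop (𝓝 1) ∧
    ∀ k, ContDiffOn ℝ 1 γ (Icc (τ k) (τ (k + 1)))
  regular_start : derivWithin γ (Ici 0) 0 ≠ 0

/-- The integrand of `I(z) = ∫_a^b exp (-z p(t) + z^(1/μ) r(t)) q(t) dt`, `z = x e^{iθ}`, pulled back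
to the parameter interval of the contour `t = γ s`; the branch of `z^(1/μ)` has phase `θ/μ`. -/
def integrand (p q r : ℂ → ℂ) (γ : ℝ → ℂ) (μ : ℕ) (x θ s : ℝ) : ℂ :=
  exp (-((x : ℂ) * exp ((θ : ℂ) * I)) * p (γ s) + polarPow x θ (1 / (μ : ℂ)) * r (γ s))
    * q (γ s) * deriv γ s

/-- The contour integral `I(z)`, `z = x e^{iθ}`. -/
def contourI (p q r : ℂ → ℂ) (γ : ℝ → ℂ) (μ : ℕ) (x θ : ℝ) : ℂ :=
  ∫ s in Ioo (0 : ℝ) 1, integrand p q r γ μ x θ s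

/-- The standing conditions on `I(z)`, for an integer `μ` and `ν = 1`. The sequences `pc`, `qc`, `rc`
are the coefficients of the expansions of `p`, `q`, `r` at `a`, and `ϖ` is the angle of slope of the
contour at `a`. -/
structure Conditions (p q r : ℂ → ℂ) (T : Set ℂ) (a : ℂ) (b : OnePoint ℂ) (γ : ℝ → ℂ)
    (pc qc rc : ℕ → ℂ) (μ : ℕ) (lam : ℂ) (ϖ θ₁ θ₂ Z : ℝ) : Prop where
  /- (i) analyticity in a domain -/
  isOpen_T : IsOpen T
  isConnected_T : IsConnected T
  analytic_p : DifferentiableOn ℂ p T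
  analytic_q : DifferentiableOn ℂ q T
  analytic_r : DifferentiableOn ℂ r T
  /- (ii) the contour, and its angle of slope at `a` -/
  contour : IsContour γ a b
  mem_T : ∀ s ∈ Ioo (0 : ℝ) 1, γ s ∈ T
  slope : Tendsto (fun s => (γ s - a) / (‖γ s - a‖ : ℂ)) (𝓝[>] 0) (𝓝 (exp ((ϖ : ℂ) * I)))
  /- (iii) convergent expansions at points `t = γ s` of the contour near `a` -/
  expand_p : ∀ᶠ s in 𝓝[>] (0 : ℝ),
    HasSum (fun n : ℕ => pc n * (γ s - a) ^ (n + μ)) (p (γ s) - p a)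
  expand_q : ∀ᶠ s in 𝓝[>] (0 : ℝ),
    HasSum (fun n : ℕ => qc n * polarPow ‖γ s - a‖ (argNear ϖ (γ s - a)) (n + lam - 1)) (q (γ s))
  expand_r : ∀ᶠ s in 𝓝[>] (0 : ℝ),
    HasSum (fun n : ℕ => rc n * (γ s - a) ^ (n + 1)) (r (γ s))
  p_zero_ne : pc 0 ≠ 0
  lam_re_pos : 0 < lam.re
  /- (iv) the sector; absolute and uniform convergence of `I(Z e^{iθ})` at `b` -/
  sector_nonempty : θ₁ ≤ θ₂
  sector_lt : θ₂ - θ₁ < Real.pi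
  Z_pos : 0 < Z
  abs_conv : ∀ θ ∈ Icc θ₁ θ₂, ∃ c ∈ Ioo (0 : ℝ) 1, IntegrableOn (integrand p q r γ μ Z θ) (Ioo c 1)
  unif_conv : ∀ ε > 0, ∃ c ∈ Ioo (0 : ℝ) 1, ∀ θ ∈ Icc θ₁ θ₂, ∀ c' ∈ Ico c 1,
    ‖∫ s in Ioo c' 1, integrand p q r γ μ Z θ s‖ ≤ ε
  /- (v) -/
  arg_le : ∃ δ > 0, ∀ θ ∈ Icc θ₁ θ₂, ∀ s ∈ Ioo (0 : ℝ) 1,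
    p (γ s) - p a ≠ 0 ∧ |arg (exp ((θ : ℂ) * I) * (p (γ s) - p a))| ≤ Real.pi / 2 - δ
  re_ge : ∃ η > 0, ∀ᶠ s in 𝓝[<] (1 : ℝ), ∀ θ ∈ Icc θ₁ θ₂,
    η ≤ (exp ((θ : ℂ) * I) * (p (γ s) - p a)).re
  /- (vi) -/
  r_isBigO : (fun s => r (γ s)) =O[𝓝[<] (1 : ℝ)] (fun s => p (γ s) - p a)

/-- The binomial power `V^s = ∑ₖ (s choose k) (V - 1)^k` of a formal power series `V` with constant
coefficient `1`. -/
def seriesPow (V : PowerSeries ℂ) (s : ℂ) : PowerSeries ℂ :=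
  PowerSeries.mk fun n =>
    ∑ k ∈ Finset.range (n + 1), Ring.choose s k * PowerSeries.coeff n ((V - 1) ^ k)

/-- The power series `p₀⁻¹ ∑ p_n u^n`, where `p(t) - p(a) = p₀ u^μ (1 + ⋯)`, `u = t - a`. -/
def normalizedP (pc : ℕ → ℂ) : PowerSeries ℂ :=
  PowerSeries.mk fun n => pc n / pc 0

/-- `b_n = μ⁻¹ Res_{t=a} [q(t) / (p(t) - p(a))^((n+λ)/μ)]`. The function in brackets is
`p₀^(-(n+λ)/μ) u^(-n-1) (∑ q_k u^k) (p₀⁻¹ ∑ p_k u^k)^(-(n+λ)/μ)` with `u = t - a`. Here and below,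
`ϖ₀` is the value of `arg p₀` used in the powers of `p₀`. -/
def bCoeff (pc qc : ℕ → ℂ) (μ : ℕ) (lam : ℂ) (ϖ₀ : ℝ) (n : ℕ) : ℂ :=
  1 / (μ : ℂ) * polarPow ‖pc 0‖ ϖ₀ (-((n + lam) / μ)) *
    PowerSeries.coeff n (PowerSeries.mk qc * seriesPow (normalizedP pc) (-((n + lam) / μ)))

/-- `c_n = μ⁻¹ Res_{t=a} [p'(t) r(t) / (p(t) - p(a))^((n+1)/μ+1)]` for `n ≥ 1`, and `c_0 = 0`. The
function in brackets is, with `u = t - a` and `s = (n+1)/μ + 1`,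
`p₀^(-s) u^(-n-1) (∑ (k+μ) p_k u^k) (∑ r_k u^k) (p₀⁻¹ ∑ p_k u^k)^(-s)`. -/
def cCoeff (pc rc : ℕ → ℂ) (μ : ℕ) (ϖ₀ : ℝ) (n : ℕ) : ℂ :=
  if n = 0 then 0 else
    1 / (μ : ℂ) * polarPow ‖pc 0‖ ϖ₀ (-((n + 1) / μ + 1)) *
      PowerSeries.coeff n (PowerSeries.mk (fun k => ((k : ℂ) + μ) * pc k) * PowerSeries.mk rc *
        seriesPow (normalizedP pc) (-((n + 1) / μ + 1)))

/-- The partial ordinary Bell polynomial `B_{n,m}(c_1, c_2, …)`: the coefficient of `X^n` in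
`(∑_{k ≥ 1} c_k X^k)^m`. -/
def bell (c : ℕ → ℂ) (n m : ℕ) : ℂ :=
  PowerSeries.coeff n ((PowerSeries.mk fun k => if k = 0 then 0 else c k) ^ m)

/-- `f_{n,m} = (1/m!) ∑_{j=m}^n b_{n-j} B_{j,m}(c_1, c_2, …)`. -/
def fCoeff (pc qc rc : ℕ → ℂ) (μ : ℕ) (lam : ℂ) (ϖ₀ : ℝ) (n m : ℕ) : ℂ :=
  1 / (m.factorial : ℂ) * ∑ j ∈ Finset.Icc m n,
    bCoeff pc qc μ lam ϖ₀ (n - j) * bell (cCoeff pc rc μ ϖ₀) j m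

/-- The polynomials `g_{j,n}`, `0 ≤ n < μ`, which reduce the derivatives of a solution of
`μ w^(μ) = x w' + λ w` through `w^(j) = ∑_{n<μ} g_{j,n}(x) w^(n)`: `g_{0,n} = δ_{0,n}`, and
`g_{j+1,n} = g_{j,n-1} + g_{j,n}' + [n = 0] (λ/μ) g_{j,μ-1} + [n = 1] (x/μ) g_{j,μ-1}`. -/
def gPoly (μ : ℕ) (lam : ℂ) : ℕ → ℕ → Polynomial ℂ
  | 0, n => if n = 0 then 1 else 0
  | j + 1, n =>
    if μ ≤ n then 0
    else if n = 0 then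
      Polynomial.derivative (gPoly μ lam j 0) + Polynomial.C (lam / μ) * gPoly μ lam j (μ - 1)
    else if n = 1 then
      gPoly μ lam j 0 + Polynomial.derivative (gPoly μ lam j 1) +
        Polynomial.C (1 / (μ : ℂ)) * Polynomial.X * gPoly μ lam j (μ - 1)
    else gPoly μ lam j (n - 1) + Polynomial.derivative (gPoly μ lam j n)

/-- The argument `r₀ / p₀^(1/μ)` of Faxén's integral. -/
def faxenArg (pc rc : ℕ → ℂ) (μ : ℕ) (ϖ₀ : ℝ) : ℂ :=
  rc 0 / polarPow ‖pc 0‖ ϖ₀ (1 / (μ : ℂ))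

/-- `⌈n/2⌉`. -/
def halfCeil (n : ℕ) : ℕ := (n + 1) / 2

/-- The coefficients of the regrouped expansion,
`f̃_{n,m} = ∑_{j=m}^{⌈n/2⌉+2m} g_{⌈n/2⌉+j,n}(r₀/p₀^(1/μ)) f_{⌈n/2⌉+m,j-m}`. -/
def ftilde (pc qc rc : ℕ → ℂ) (μ : ℕ) (lam : ℂ) (ϖ₀ : ℝ) (n m : ℕ) : ℂ :=
  ∑ j ∈ Finset.Icc m (halfCeil n + 2 * m),
    (gPoly μ lam (halfCeil n + j) n).eval (faxenArg pc rc μ ϖ₀) *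
      fCoeff pc qc rc μ lam ϖ₀ (halfCeil n + m) (j - m)

/-- `I(z) ~ e^{-z p(a)} ∑_{n<μ} z^(-(⌈n/2⌉+λ)/μ) F_n ∑_{m≥0} f̃_{n,m} z^(-m/μ)` as `|z| → ∞`, uniformly in
`θ₁ ≤ arg z ≤ θ₂`, where `z = x e^{iθ}`: whenever the `n`-th series is cut off after `M n` terms in such
a way that every omitted term has order at least `z^(-(N+λ)/μ)`, the error, relative to
`e^{-z p(a)}`, is `O(|z|^(-(N + Re λ)/μ))` uniformly in `θ`. -/
def HasExpansion (J : ℝ → ℝ → ℂ) (pa : ℂ) (μ : ℕ) (lam : ℂ) (θ₁ θ₂ : ℝ)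
    (F : ℕ → ℂ) (f : ℕ → ℕ → ℂ) : Prop :=
  ∀ (N : ℕ) (M : ℕ → ℕ), (∀ n < μ, N ≤ halfCeil n + M n) →
    ∃ C R : ℝ, ∀ x ≥ R, ∀ θ ∈ Icc θ₁ θ₂,
      ‖J x θ - exp (-((x : ℂ) * exp ((θ : ℂ) * I)) * pa) *
          ∑ n ∈ Finset.range μ, polarPow x θ (-((halfCeil n + lam) / μ)) * F n *
            ∑ m ∈ Finset.range (M n), f n m * polarPow x θ (-(m / μ))‖
        ≤ C * ‖exp (-((x : ℂ) * exp ((θ : ℂ) * I)) * pa)‖ * x ^ (-((N + lam.re) / μ))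

end FaxenExpansion

end

/-! The local coordinate at `a` is `v = (p(t) - p(a))^(1/μ)`, in the branch fixed by `ϖ₀`. Near `a`
one has `r(t) = v (x₀ + ρ)` with `ρ = ∑_{n≥1} c_n v^n`, and `q(t) dt = v^(λ-1) A dv` with `A = ∑ μ
b_n v^n`; the coefficients are residues because `v` is a reparametrization of `u = t - a`
(`residueCoeff_amplitude`, `residueCoeff_phase`). With `w = z^(1/μ) v` the integral near `a` becomes
`e^{-z p(a)} z^(-λ/μ) ∫ exp(-w^μ + x₀ w) w^(λ-1) exp(w ρ) A dw`
(`Conditions.eventually_integrand_eq`). Expanding `exp(w ρ) A` in powers of `w` and of `v = w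
z^(-1/μ)` and integrating term by term gives, at order `z^(-k/μ)`, Faxén integrals whose parameter
`λ` is shifted by `k + m` with `m ≤ k` (`IsLogPath.exists_expansion`).

An integration by parts expresses the shift by `μ` through the shifts by `0` and `1`. Hence every
shift by `j` reduces to the shifts by `n < μ`, with coefficients `g_{j,n}(x₀)`
(`kernelInt_add_natCast`). Since `g_{j,n} = 0` for `j < n`, and `j = k + m ≤ 2k`, the `n`-th Faxén
integral enters only at orders `k ≥ ⌈n/2⌉`; this explains the powers of `z` in the statement.

Away from `a`, condition (v) makes `Re(z (p(t) - p(a)))` at least a multiple of `|z| |p(t) - p(a)|`,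
while by (vi) the term `z^(1/μ) r(t)` is only `O(|z|^(1/2) |p(t) - p(a)|)`. Comparison with the
absolutely convergent integral at `|z| = Z` shows that this part is exponentially small relative to
`e^{-z p(a)}` (`Conditions.exists_far_bound`).

The analysis near `a` is done in the logarithmic variable `ω = log w`: powers become exponentials,
branches become additive constants, and the admissible directions form the strip `|μ Im ω| < π/2`.
There the integral over a horizontal half-line is an explicit antiderivative of minus the kernel
(`hasDerivAt_kernelTail`), which takes the place of a deformation of the contour. -/

namespace FaxenExpansion

open Asymptotics

/-! ### Asymptotic Taylor series along a filter -/

section Taylor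

variable {α : Type*} {l : Filter α} {σ f g : α → ℂ} {S T : PowerSeries ℂ}

/-- `f` has the asymptotic expansion `∑ Sₖ σᵏ` along `l`. -/
def HasTaylor (l : Filter α) (σ f : α → ℂ) (S : PowerSeries ℂ) : Prop :=
  ∀ N : ℕ, (fun t => f t - (PowerSeries.trunc N S).eval (σ t)) =O[l] fun t => σ t ^ N

theorem eval_trunc (S : PowerSeries ℂ) (N : ℕ) (x : ℂ) : (PowerSeries.trunc N S).eval x =
    ∑ k ∈ Finset.range N, PowerSeries.coeff k S * x ^ k :=
  PowerSeries.eval₂_trunc_eq_sum_range x (RingHom.id ℂ) N S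

theorem isBigO_eval_sub_eval (hσ : Tendsto σ l (𝓝 0)) {N : ℕ} {P Q : Polynomial ℂ}
    (h : ∀ k < N, P.coeff k = Q.coeff k) :
    (fun t => P.eval (σ t) - Q.eval (σ t)) =O[l] fun t => σ t ^ N := by
  have hd : (Polynomial.X : Polynomial ℂ) ^ N ∣ P - Q := by
    rw [Polynomial.X_pow_dvd_iff]
    intro d hd
    simp [h d hd]
  obtain ⟨R, hR⟩ := hd
  have hev : ∀ t, P.eval (σ t) - Q.eval (σ t) = σ t ^ N * R.eval (σ t) := fun t => by
    rw [← Polynomial.eval_sub, hR]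
    simp
  have hb : (fun t => R.eval (σ t)) =O[l] fun _ => (1 : ℂ) :=
    ((R.continuous.tendsto 0).comp hσ).isBigO_one ℂ
  simp_rw [hev]
  simpa using (isBigO_refl (fun t => σ t ^ N) l).mul hb

theorem HasTaylor.isBigO_sub_eval (hσ : Tendsto σ l (𝓝 0)) (hf : HasTaylor l σ f S) {N : ℕ}
    {P : Polynomial ℂ} (h : ∀ k < N, P.coeff k = PowerSeries.coeff k S) :
    (fun t => f t - P.eval (σ t)) =O[l] fun t => σ t ^ N := by
  have h1 := isBigO_eval_sub_eval (l := l) hσ (N := N) (P := PowerSeries.trunc N S) (Q := P)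
    fun k hk => by rw [h k hk, PowerSeries.coeff_trunc, if_pos hk]
  simpa using (hf N).add h1

/-- Coefficients of degree at least `N` change a polynomial in `σ` only by `O(σ^N)`, so any
polynomial with the right lower coefficients may stand in for the truncation. Products and
substitutions can then be checked without truncating again. -/
theorem hasTaylor_of_poly (hσ : Tendsto σ l (𝓝 0))
    (h : ∀ N : ℕ, ∃ P : Polynomial ℂ, (∀ k < N, P.coeff k = PowerSeries.coeff k S) ∧
      (fun t => f t - P.eval (σ t)) =O[l] fun t => σ t ^ N) : HasTaylor l σ f S := by
  intro N
  obtain ⟨P, hP, hO⟩ := h N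
  have h1 := isBigO_eval_sub_eval (l := l) hσ (N := N) (P := P) (Q := PowerSeries.trunc N S)
    fun k hk => by rw [hP k hk, PowerSeries.coeff_trunc, if_pos hk]
  simpa using hO.add h1

theorem HasTaylor.isBigO_one (hf : HasTaylor l σ f S) :
    f =O[l] fun _ => (1 : ℂ) := by
  simpa using hf 0

theorem HasTaylor.isBigO_pow (hσ : Tendsto σ l (𝓝 0)) (hf : HasTaylor l σ f S) {N : ℕ}
    (h : ∀ k < N, PowerSeries.coeff k S = 0) : f =O[l] fun t => σ t ^ N := by
  simpa using hf.isBigO_sub_eval hσ (N := N) (P := 0) fun k hk => by simp [h k hk]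

theorem HasTaylor.congr (hf : HasTaylor l σ f S) (h : f =ᶠ[l] g) : HasTaylor l σ g S :=
  fun N => (hf N).congr' (h.mono fun t ht => by simp [ht]) EventuallyEq.rfl

theorem HasTaylor.comp {β : Type*} {l' : Filter β} {φ : β → α} (hf : HasTaylor l σ f S)
    (h : Tendsto φ l' l) : HasTaylor l' (σ ∘ φ) (f ∘ φ) S :=
  fun N => (hf N).comp_tendsto h

theorem hasTaylor_poly (hσ : Tendsto σ l (𝓝 0)) (P : Polynomial ℂ) :
    HasTaylor l σ (fun t => P.eval (σ t)) (P : PowerSeries ℂ) :=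
  hasTaylor_of_poly hσ fun N => ⟨P, fun k _ => by simp, by simpa using isBigO_zero _ _⟩

theorem hasTaylor_const (hσ : Tendsto σ l (𝓝 0)) (c : ℂ) :
    HasTaylor l σ (fun _ => c) (PowerSeries.C c) := by
  simpa using hasTaylor_poly (l := l) hσ (Polynomial.C c)

theorem hasTaylor_self (hσ : Tendsto σ l (𝓝 0)) : HasTaylor l σ σ PowerSeries.X := by
  simpa using hasTaylor_poly (l := l) hσ Polynomial.X

theorem HasTaylor.add (hf : HasTaylor l σ f S) (hg : HasTaylor l σ g T) :
    HasTaylor l σ (fun t => f t + g t) (S + T) := fun N => by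
  refine ((hf N).add (hg N)).congr_left fun t => ?_
  simp only [map_add, Polynomial.eval_add]
  ring

theorem HasTaylor.sub (hf : HasTaylor l σ f S) (hg : HasTaylor l σ g T) :
    HasTaylor l σ (fun t => f t - g t) (S - T) := fun N => by
  refine ((hf N).sub (hg N)).congr_left fun t => ?_
  have : PowerSeries.trunc N (S - T) = PowerSeries.trunc N S - PowerSeries.trunc N T := by
    ext k
    simp only [PowerSeries.coeff_trunc, Polynomial.coeff_sub, map_sub]
  rw [this, Polynomial.eval_sub]
  ring

theorem HasTaylor.mul (hσ : Tendsto σ l (𝓝 0)) (hf : HasTaylor l σ f S) (hg : HasTaylor l σ g T) :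
    HasTaylor l σ (fun t => f t * g t) (S * T) := by
  refine hasTaylor_of_poly hσ fun N =>
    ⟨PowerSeries.trunc N S * PowerSeries.trunc N T, fun k hk => ?_, ?_⟩
  · rw [PowerSeries.coeff_mul_eq_coeff_trunc_mul_trunc S T hk, ← Polynomial.coe_mul,
      Polynomial.coeff_coe]
  · have hT : (fun t => (PowerSeries.trunc N T).eval (σ t)) =O[l] fun _ => (1 : ℂ) :=
      (((PowerSeries.trunc N T).continuous.tendsto 0).comp hσ).isBigO_one ℂ
    have h1 := (hf.isBigO_one).mul (hg N)
    have h2 := (hf N).mul hT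
    refine (h1.congr_right (fun t => one_mul _)).add (h2.congr_right fun t => mul_one _)
      |>.congr_left fun t => ?_
    rw [Polynomial.eval_mul]
    ring

theorem HasTaylor.pow (hσ : Tendsto σ l (𝓝 0)) (hf : HasTaylor l σ f S) (n : ℕ) :
    HasTaylor l σ (fun t => f t ^ n) (S ^ n) := by
  induction n with
  | zero => simpa using hasTaylor_const (l := l) hσ 1
  | succ n ih => simpa only [pow_succ] using ih.mul hσ hf

theorem HasTaylor.sum {ι : Type*} {s : Finset ι} {F : ι → α → ℂ} {G : ι → PowerSeries ℂ}
    (hσ : Tendsto σ l (𝓝 0)) (h : ∀ i ∈ s, HasTaylor l σ (F i) (G i)) :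
    HasTaylor l σ (fun t => ∑ i ∈ s, F i t) (∑ i ∈ s, G i) := by
  classical
  induction s using Finset.induction_on with
  | empty => simpa using hasTaylor_const (l := l) hσ 0
  | insert i s hi ih =>
    simp only [Finset.sum_insert hi]
    exact (h i (Finset.mem_insert_self i s)).add
      (ih fun j hj => h j (Finset.mem_insert_of_mem hj))

theorem HasTaylor.tendsto (hσ : Tendsto σ l (𝓝 0)) (hf : HasTaylor l σ f S) :
    Tendsto f l (𝓝 (PowerSeries.constantCoeff S)) := by
  have h := (hf 1).trans_tendsto (by simpa using hσ)
  have := h.add_const (PowerSeries.constantCoeff S)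
  simpa [PowerSeries.trunc_succ] using this

/-- The first coefficient in which two expansions differ would have a difference that is `O(σ)`,
hence zero. Through this lemma, formal identities between power series are read off from identities
between functions. -/
theorem HasTaylor.unique [l.NeBot] (hσ : Tendsto σ l (𝓝 0)) (hσ0 : ∀ᶠ t in l, σ t ≠ 0)
    (hf : HasTaylor l σ f S) (hg : HasTaylor l σ f T) : S = T := by
  have h0 : HasTaylor l σ (fun _ => 0) (S - T) := (hf.sub hg).congr (by simp)
  suffices h : ∀ n, ∀ k < n, PowerSeries.coeff k (S - T) = 0 by
    rw [← sub_eq_zero]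
    ext k
    exact h (k + 1) k (Nat.lt_succ_self k)
  intro n
  induction n with
  | zero => simp
  | succ n ih =>
    intro k hk
    rcases Nat.lt_succ_iff_lt_or_eq.1 hk with hk | rfl
    · exact ih k hk
    set c := PowerSeries.coeff k (S - T) with hc
    have h1 := h0.isBigO_sub_eval hσ (N := k + 1) (P := Polynomial.C c * Polynomial.X ^ k)
      fun j hj => by
        rw [Polynomial.coeff_C_mul_X_pow]
        split_ifs with hjk
        · rw [hjk]
        · exact (ih j (by omega)).symm
    simp only [Polynomial.eval_mul, Polynomial.eval_C, Polynomial.eval_pow, Polynomial.eval_X,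
      zero_sub] at h1
    have h2 : (fun _ : α => c) =O[l] σ := by
      have := h1.neg_left.mul (isBigO_refl (fun t => (σ t ^ k)⁻¹) l)
      refine this.congr' ?_ ?_
      · filter_upwards [hσ0] with t ht
        field_simp
      · filter_upwards [hσ0] with t ht
        rw [pow_succ]
        field_simp
    exact tendsto_nhds_unique tendsto_const_nhds (h2.trans_tendsto hσ)

theorem HasTaylor.inv (hσ : Tendsto σ l (𝓝 0)) (hf : HasTaylor l σ f S)
    (h0 : PowerSeries.constantCoeff S ≠ 0) : HasTaylor l σ (fun t => (f t)⁻¹) S⁻¹ := by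
  intro N
  set P := PowerSeries.trunc N S⁻¹ with hP
  -- `S * P` agrees with `S * S⁻¹ = 1` below degree `N`, so `P` inverts `f` up to `O(σ^N)`;
  -- multiplying by the bounded function `f⁻¹` finishes the proof.
  have hfP : (fun t => f t * P.eval (σ t) - 1) =O[l] fun t => σ t ^ N := by
    have h1 := (hf.mul hσ (hasTaylor_poly hσ P)).isBigO_sub_eval hσ (N := N) (P := 1)
      fun k hk => by
        have : PowerSeries.coeff k (S * (P : PowerSeries ℂ)) = PowerSeries.coeff k (S * S⁻¹) := by
          rw [PowerSeries.coeff_mul, PowerSeries.coeff_mul]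
          refine Finset.sum_congr rfl fun x hx => ?_
          have := Finset.HasAntidiagonal.mem_antidiagonal.1 hx
          rw [Polynomial.coeff_coe, hP, PowerSeries.coeff_trunc, if_pos (by omega)]
        rw [this, PowerSeries.mul_inv_cancel _ h0, Polynomial.coeff_one, PowerSeries.coeff_one]
    simpa using h1
  have hfl := hf.tendsto hσ
  have hinv : (fun t => (f t)⁻¹) =O[l] fun _ => (1 : ℂ) := (hfl.inv₀ h0).isBigO_one ℂ
  refine ((hinv.mul hfP).neg_left).congr' ?_ (by simp)
  filter_upwards [hfl.eventually_ne h0] with t ht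
  field_simp
  ring

theorem HasTaylor.const_mul (hσ : Tendsto σ l (𝓝 0)) (hf : HasTaylor l σ f S) (c : ℂ) :
    HasTaylor l σ (fun t => c * f t) (PowerSeries.C c * S) :=
  (hasTaylor_const hσ c).mul hσ hf

theorem HasTaylor.scale (hσ : Tendsto σ l (𝓝 0)) (hf : HasTaylor l σ f S) {c : ℂ} (hc : c ≠ 0) :
    HasTaylor l (fun t => c * σ t) f (PowerSeries.mk fun n => PowerSeries.coeff n S * (c⁻¹) ^ n) := by
  have hcσ : Tendsto (fun t => c * σ t) l (𝓝 0) := by simpa using hσ.const_mul c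
  intro N
  have hev : ∀ t, (PowerSeries.trunc N (PowerSeries.mk fun n =>
      PowerSeries.coeff n S * (c⁻¹) ^ n)).eval (c * σ t) = (PowerSeries.trunc N S).eval (σ t) := by
    intro t
    simp only [eval_trunc, PowerSeries.coeff_mk]
    refine Finset.sum_congr rfl fun k _ => ?_
    rw [mul_pow, inv_pow]
    field_simp
  simp_rw [hev]
  refine (hf N).trans ?_
  have : (fun t => σ t ^ N) = fun t => (c⁻¹) ^ N * (c * σ t) ^ N := by
    funext t
    rw [mul_pow, inv_pow]
    field_simp
  rw [this]
  exact isBigO_const_mul_self _ _ _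

/-- Substitution of a function without constant term into an expansion. -/
theorem HasTaylor.subst {w : α → ℂ} {D : PowerSeries ℂ} (hσ : Tendsto σ l (𝓝 0))
    (hw : HasTaylor l σ w D) (hD : PowerSeries.constantCoeff D = 0) (hf : HasTaylor l w f S) :
    HasTaylor l σ f (PowerSeries.mk fun n => ∑ k ∈ Finset.range (n + 1),
      PowerSeries.coeff k S * PowerSeries.coeff n (D ^ k)) := by
  have hwO : w =O[l] σ := by
    simpa using hw.isBigO_pow hσ (N := 1) (by simpa using hD)
  refine hasTaylor_of_poly hσ fun N => ?_
  set E : PowerSeries ℂ := ∑ k ∈ Finset.range N,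
    PowerSeries.C (PowerSeries.coeff k S) * D ^ k with hE
  have hsum : HasTaylor l σ (fun t => (PowerSeries.trunc N S).eval (w t)) E := by
    have h1 : HasTaylor l σ (fun t => ∑ k ∈ Finset.range N, PowerSeries.coeff k S * w t ^ k) E :=
      HasTaylor.sum hσ fun k _ => (hw.pow hσ k).const_mul hσ _
    refine h1.congr (Eventually.of_forall fun t => ?_)
    simp only [eval_trunc]
  refine ⟨PowerSeries.trunc N E, fun n hn => ?_, ?_⟩
  · rw [PowerSeries.coeff_trunc, if_pos hn, PowerSeries.coeff_mk, hE, map_sum]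
    simp only [PowerSeries.coeff_C_mul]
    -- `D ^ k` has order at least `k`, so the terms with `n < k < N` do not reach the coefficient of
    -- `X^n`.
    refine (Finset.sum_subset (Finset.range_subset_range.2 (by omega)) fun k _ hk => ?_).symm
    have hXD : (PowerSeries.X : PowerSeries ℂ) ^ k ∣ D ^ k :=
      pow_dvd_pow_of_dvd (PowerSeries.X_dvd_iff.2 hD) k
    rw [PowerSeries.X_pow_dvd_iff.1 hXD n (by simpa using hk), mul_zero]
  · simpa using ((hf N).trans (hwO.pow N)).add (hsum N)

end Taylor

/-! ### The formal change of variable -/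

section Formal

open PowerSeries

variable {W : PowerSeries ℂ}

theorem inv_mul_of_constantCoeff_one (hW : constantCoeff W = 1) : W⁻¹ * W = 1 :=
  PowerSeries.inv_mul_cancel _ (by simp [hW])

/-- The residue of `φ^(k-n-1) φ'` for `φ = X W`. -/
theorem coeff_mul_derivative_mul_inv_pow (hW : constantCoeff W = 1) (n k : ℕ) :
    coeff n ((X * W) ^ k * d⁄dX ℂ (X * W) * W⁻¹ ^ (n + 1)) = if k = n then 1 else 0 := by
  have hi := inv_mul_of_constantCoeff_one hW
  rcases lt_or_ge n k with h | h
  · rw [if_neg (by omega)]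
    have : (X * W) ^ k * d⁄dX ℂ (X * W) * W⁻¹ ^ (n + 1) =
        X ^ k * (W ^ k * d⁄dX ℂ (X * W) * W⁻¹ ^ (n + 1)) := by ring
    rw [this, coeff_X_pow_mul', if_neg (by omega)]
  · obtain ⟨d, rfl⟩ := Nat.exists_eq_add_of_le h
    have hk : W ^ k * W⁻¹ ^ k = 1 := by rw [← mul_pow, mul_comm, hi, one_pow]
    have : (X * W) ^ k * d⁄dX ℂ (X * W) * W⁻¹ ^ (k + d + 1) =
        X ^ k * (W⁻¹ ^ d * (W⁻¹ * W) + X * (W⁻¹ ^ (d + 1) * d⁄dX ℂ W)) := by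
      rw [Derivation.leibniz, PowerSeries.derivative_X, smul_eq_mul, smul_eq_mul]
      calc (X * W) ^ k * (X * d⁄dX ℂ W + W * 1) * W⁻¹ ^ (k + d + 1)
          = (W ^ k * W⁻¹ ^ k) *
            (X ^ k * (W⁻¹ ^ d * (W⁻¹ * W) + X * (W⁻¹ ^ (d + 1) * d⁄dX ℂ W))) := by ring
        _ = _ := by rw [hk, one_mul]
    rw [this, hi, add_comm k d, coeff_X_pow_mul, mul_one, map_add]
    rcases d with _ | d
    · simp [hW]
    · rw [if_neg (by omega), coeff_succ_X_mul]
      -- A derivative has no residue. In coefficients: differentiating `W⁻¹ ^ (d + 1)` shows that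
      -- the two remaining summands cancel after multiplication by `d + 1`.
      have h1 : d⁄dX ℂ (W⁻¹ ^ (d + 1)) = -((d + 1 : ℕ) : PowerSeries ℂ) *
          (W⁻¹ ^ (d + 2) * d⁄dX ℂ W) := by
        rw [Derivation.leibniz_pow, PowerSeries.derivative_inv', nsmul_eq_mul, smul_eq_mul]
        simp only [Nat.add_sub_cancel]
        ring
      have h2 := congrArg (coeff d) h1
      rw [coeff_derivative, ← map_natCast (C (R := ℂ)), ← map_neg, coeff_C_mul] at h2
      have h3 : ((d + 1 : ℕ) : ℂ) ≠ 0 := Nat.cast_ne_zero.2 (by omega)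
      apply mul_left_cancel₀ h3
      push_cast at h2 ⊢
      linear_combination h2

/-- `(X * W) ^ k` begins with `X^k`, with coefficient `1`, so the coefficients can be removed one
after the other. -/
theorem exists_X_pow_dvd_sub_sum (hW : constantCoeff W = 1) (A : PowerSeries ℂ) (N : ℕ) :
    ∃ c : ℕ → ℂ, X ^ N ∣ A - ∑ k ∈ Finset.range N, C (c k) * (X * W) ^ k := by
  induction N with
  | zero => exact ⟨0, by simp⟩
  | succ N ih =>
    obtain ⟨c, B, hB⟩ := ih
    refine ⟨Function.update c N (constantCoeff B), ?_⟩
    rw [Finset.sum_range_succ, Function.update_self]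
    have : ∑ k ∈ Finset.range N, C (Function.update c N (constantCoeff B) k) * (X * W) ^ k =
        ∑ k ∈ Finset.range N, C (c k) * (X * W) ^ k :=
      Finset.sum_congr rfl fun k hk => by
        rw [Function.update_of_ne (Finset.mem_range.1 hk).ne]
    rw [this, ← sub_sub, hB, mul_pow, ← mul_left_comm, ← mul_sub, pow_succ]
    refine mul_dvd_mul_left _ (X_dvd_iff.2 ?_)
    simp [hW]

/-- The coefficients of a power series in powers of `φ = X W`, as residues. -/
noncomputable def residueCoeff (W A : PowerSeries ℂ) (n : ℕ) : ℂ :=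
  coeff n (A * d⁄dX ℂ (X * W) * W⁻¹ ^ (n + 1))

/-- For `n < N` the `n`-th residue functional annihilates multiples of `X^N` and all powers of `X *
W` except the `n`-th, so it recovers the coefficients whose existence is already known. This is
Lagrange inversion without an inverse series. -/
theorem X_pow_dvd_sub_sum_residueCoeff (hW : constantCoeff W = 1) (A : PowerSeries ℂ) (N : ℕ) :
    X ^ N ∣ A - ∑ k ∈ Finset.range N, C (residueCoeff W A k) * (X * W) ^ k := by
  obtain ⟨c, B, hB⟩ := exists_X_pow_dvd_sub_sum hW A N
  have hc : ∀ n < N, residueCoeff W A n = c n := by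
    intro n hn
    have hA : A = X ^ N * B + ∑ k ∈ Finset.range N, C (c k) * (X * W) ^ k := by
      rw [← hB]; ring
    unfold residueCoeff
    have h1 : A * d⁄dX ℂ (X * W) * W⁻¹ ^ (n + 1) =
        X ^ N * (B * d⁄dX ℂ (X * W) * W⁻¹ ^ (n + 1)) +
        ∑ k ∈ Finset.range N, C (c k) * ((X * W) ^ k * d⁄dX ℂ (X * W) * W⁻¹ ^ (n + 1)) := by
      conv_lhs => rw [hA]
      rw [add_mul, add_mul, Finset.sum_mul, Finset.sum_mul]
      congr 1
      · ring
      · exact Finset.sum_congr rfl fun k _ => by ring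
    rw [h1, map_add, coeff_X_pow_mul', if_neg (by omega), zero_add, map_sum]
    simp only [coeff_C_mul, coeff_mul_derivative_mul_inv_pow hW]
    simp [hn]
  rw [Finset.sum_congr rfl fun k hk => by rw [hc k (Finset.mem_range.1 hk)]]
  exact ⟨B, hB⟩

/-- Passing from powers of `σ` to powers of `φ` is formal, except that an error `O(σ^N)` has to be
`O(φ^N)`; this is the role of `σ = O(φ)`. -/
theorem HasTaylor.change {α : Type*} {l : Filter α} {σ f φ : α → ℂ} {A : PowerSeries ℂ}
    (hW : constantCoeff W = 1) (hσ : Tendsto σ l (𝓝 0)) (hf : HasTaylor l σ f A)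
    (hφ : HasTaylor l σ φ (X * W)) (hσφ : σ =O[l] φ) :
    HasTaylor l φ f (mk (residueCoeff W A)) := by
  intro N
  have h1 : HasTaylor l σ (fun t => f t - ∑ k ∈ Finset.range N, residueCoeff W A k * φ t ^ k)
      (A - ∑ k ∈ Finset.range N, C (residueCoeff W A k) * (X * W) ^ k) :=
    hf.sub (HasTaylor.sum hσ fun k _ => (hφ.pow hσ k).const_mul hσ _)
  have h2 := h1.isBigO_pow hσ (N := N)
    (X_pow_dvd_iff.1 (X_pow_dvd_sub_sum_residueCoeff hW A N))
  refine (h2.trans (hσφ.pow N)).congr_left fun t => ?_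
  simp only [eval_trunc, coeff_mk]

end Formal

/-! ### Complex powers of a power series -/

section SeriesPow

variable {α : Type*} {l : Filter α} {σ f : α → ℂ} {V : PowerSeries ℂ}

theorem hasTaylor_of_hasFPowerSeriesAt {F : ℂ → ℂ} {p : FormalMultilinearSeries ℂ ℂ ℂ}
    (h : HasFPowerSeriesAt F p 0) :
    HasTaylor (𝓝 0) id F (PowerSeries.mk p.coeff) := by
  intro N
  have h1 := h.isBigO_sub_partialSum_pow N
  simp only [zero_add] at h1
  refine (h1.trans ?_).congr_left fun t => ?_
  · refine IsBigO.of_norm_norm ?_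
    simpa using isBigO_refl (fun t : ℂ => ‖t‖ ^ N) (𝓝 0)
  · simp only [eval_trunc, PowerSeries.coeff_mk, FormalMultilinearSeries.partialSum,
      FormalMultilinearSeries.apply_eq_pow_smul_coeff, smul_eq_mul, id]
    congr 1
    exact Finset.sum_congr rfl fun k _ => mul_comm _ _

/-- Since `f - 1` tends to `0`, it can be substituted into the binomial series of `(1 + w)^s`, and
`seriesPow` is the formal result of that substitution. -/
theorem hasTaylor_cpow (hσ : Tendsto σ l (𝓝 0)) (hf : HasTaylor l σ f V)
    (hV : PowerSeries.constantCoeff V = 1) (s : ℂ) :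
    HasTaylor l σ (fun t => f t ^ s) (seriesPow V s) := by
  have hw : HasTaylor l σ (fun t => f t - 1) (V - 1) := by
    simpa using hf.sub (hasTaylor_const hσ 1)
  have hw0 : Tendsto (fun t => f t - 1) l (𝓝 0) := by
    simpa [hV] using hw.tendsto hσ
  have hb := (hasTaylor_of_hasFPowerSeriesAt
    (Complex.one_add_cpow_hasFPowerSeriesOnBall_zero (a := s)).hasFPowerSeriesAt).comp hw0
  have h2 := HasTaylor.subst hσ hw (by simp [hV]) (f := fun t => f t ^ s)
    (S := PowerSeries.mk (binomialSeries ℂ s).coeff)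
    (hb.congr (Eventually.of_forall fun t => by simp))
  convert h2 using 1
  unfold seriesPow
  ext n
  simp only [PowerSeries.coeff_mk]
  refine Finset.sum_congr rfl fun k _ => ?_
  simp [binomialSeries]

end SeriesPow

end FaxenExpansion

namespace FaxenExpansion

/-! ### Faxén's integral in exponential form -/

/-- The integrand of Faxén's integral after the substitution `t = e^{μω}`. -/
noncomputable def faxenKernel (μ : ℕ) (x β ω : ℂ) : ℂ :=
  exp (-exp (μ * ω) + x * exp ω + β * ω)

/-- The integral of `faxenKernel` over the real line. -/
noncomputable def kernelInt (μ : ℕ) (x β : ℂ) : ℂ :=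
  ∫ y : ℝ, faxenKernel μ x β y

/-- For `μ ≥ 2` one has `t^μ ≥ t² - 1`, and completing the square absorbs any linear term while
leaving a linear decay of any prescribed rate `L`. Hence the terms linear in `w` in the exponent,
from `x₀ w` and from bounding `exp(w ρ)`, do no harm. -/
theorem exists_neg_mul_pow_add_le {μ : ℕ} (hμ : 2 ≤ μ) {d : ℝ} (hd : 0 < d) (C L : ℝ) :
    ∃ K : ℝ, ∀ t : ℝ, 0 ≤ t → -d * t ^ μ + C * t ≤ K - L * t := by
  refine ⟨d + (C + L) ^ 2 / (4 * d), fun t ht => ?_⟩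
  have h1 : t ^ 2 - 1 ≤ t ^ μ := by
    rcases le_total t 1 with h | h
    · have := pow_nonneg ht μ
      nlinarith
    · linarith [pow_le_pow_right₀ h hμ]
  have h2 : (C + L) * t - d * t ^ 2 ≤ (C + L) ^ 2 / (4 * d) := by
    rw [le_div_iff₀ (by positivity)]
    nlinarith [sq_nonneg (2 * d * t - (C + L))]
  nlinarith

theorem integrable_exp_neg_exp_add_mul {b : ℝ} (hb : 0 < b) :
    Integrable fun y : ℝ => Real.exp (-Real.exp y + b * y) := by
  have h := (integrableOn_image_iff_integrableOn_abs_deriv_smul (s := univ) (f := Real.exp)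
    (f' := Real.exp) MeasurableSet.univ (fun x _ => (Real.hasDerivAt_exp x).hasDerivWithinAt)
    Real.exp_injective.injOn (fun t : ℝ => Real.exp (-t) * t ^ (b - 1))).1
    (by simpa [image_univ, Real.range_exp] using Real.GammaIntegral_convergent hb)
  rw [integrableOn_univ] at h
  refine h.congr (Eventually.of_forall fun y => ?_)
  simp only [abs_of_pos (Real.exp_pos y), smul_eq_mul]
  rw [Real.rpow_def_of_pos (Real.exp_pos y), Real.log_exp, ← Real.exp_add, ← Real.exp_add]
  ring_nf

theorem integrable_exp_neg_mul_exp {μ : ℕ} (hμ : 2 ≤ μ) {d : ℝ} (hd : 0 < d) (C : ℝ) {b : ℝ}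
    (hb : 0 < b) :
    Integrable fun y : ℝ => Real.exp (-d * Real.exp (μ * y) + C * Real.exp y + b * y) := by
  obtain ⟨K, hK⟩ := exists_neg_mul_pow_add_le hμ hd C 1
  refine ((integrable_exp_neg_exp_add_mul hb).const_mul (Real.exp K)).mono'
    (by fun_prop) (Eventually.of_forall fun y => ?_)
  rw [Real.norm_eq_abs, abs_of_pos (Real.exp_pos _), ← Real.exp_add]
  have := hK _ (Real.exp_pos y).le
  rw [← Real.exp_nat_mul] at this
  exact Real.exp_le_exp.2 (by linarith)

theorem continuous_faxenKernel (μ : ℕ) (x β : ℂ) : Continuous (faxenKernel μ x β) := by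
  unfold faxenKernel
  fun_prop

theorem faxenKernel_add (μ : ℕ) (x β c ω : ℂ) :
    faxenKernel μ x (β + c) ω = faxenKernel μ x β ω * exp (c * ω) := by
  unfold faxenKernel
  rw [← exp_add]
  ring_nf

theorem hasDerivAt_faxenKernel (μ : ℕ) (x β ω : ℂ) :
    HasDerivAt (faxenKernel μ x β)
      (-μ * faxenKernel μ x (β + μ) ω + x * faxenKernel μ x (β + 1) ω
        + β * faxenKernel μ x β ω) ω := by
  have h : HasDerivAt (fun ω : ℂ => -exp (μ * ω) + x * exp ω + β * ω)
      (-(exp (μ * ω) * (μ * 1)) + x * exp ω + β * 1) ω := by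
    exact ((((hasDerivAt_id ω).const_mul (μ : ℂ)).cexp.neg).add
      ((hasDerivAt_exp ω).const_mul x)).add ((hasDerivAt_id ω).const_mul β)
  refine h.cexp.congr_deriv ?_
  rw [faxenKernel_add, faxenKernel_add]
  unfold faxenKernel
  rw [one_mul]
  ring

theorem norm_faxenKernel (μ : ℕ) (x β ω : ℂ) : ‖faxenKernel μ x β ω‖ =
    Real.exp (-(exp (μ * ω)).re + (x * exp ω).re + (β * ω).re) := by
  rw [faxenKernel, norm_exp]
  simp

theorem cos_mul_exp_le_re_exp {μ : ℕ} {ω : ℂ} {ϑ : ℝ} (hϑ : ϑ < Real.pi / 2)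
    (h : |μ * ω.im| ≤ ϑ) : Real.cos ϑ * Real.exp (μ * ω.re) ≤ (exp (μ * ω)).re := by
  rw [exp_re]
  have h1 : ((μ : ℂ) * ω).re = μ * ω.re := by simp
  have h2 : ((μ : ℂ) * ω).im = μ * ω.im := by simp
  rw [h1, h2, mul_comm, ← Real.cos_abs (μ * ω.im)]
  refine mul_le_mul_of_nonneg_left ?_ (Real.exp_pos _).le
  exact Real.cos_le_cos_of_nonneg_of_le_pi (abs_nonneg _) (by linarith [Real.pi_pos]) h

theorem norm_faxenKernel_le {μ : ℕ} (hμ : 2 ≤ μ) (x β : ℂ) {ω : ℂ} {ϑ : ℝ}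
    (hϑ : ϑ < Real.pi / 2) (h : |μ * ω.im| ≤ ϑ) :
    ‖faxenKernel μ x β ω‖ ≤ Real.exp (|β.im| * Real.pi) *
      Real.exp (-Real.cos ϑ * Real.exp (μ * ω.re) + ‖x‖ * Real.exp ω.re + β.re * ω.re) := by
  rw [norm_faxenKernel, ← Real.exp_add]
  have h1 := cos_mul_exp_le_re_exp hϑ h
  have h2 : (x * exp ω).re ≤ ‖x‖ * Real.exp ω.re := by
    rw [← norm_exp, ← norm_mul]
    exact re_le_norm _
  have h3 : |ω.im| ≤ Real.pi := by
    rw [abs_mul, Nat.abs_cast] at h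
    have : (1 : ℝ) ≤ μ := by exact_mod_cast (by omega : 1 ≤ μ)
    nlinarith [abs_nonneg ω.im, Real.pi_pos]
  have h4 : (β * ω).re ≤ β.re * ω.re + |β.im| * Real.pi := by
    rw [mul_re]
    have : -(β.im * ω.im) ≤ |β.im| * Real.pi := by
      calc -(β.im * ω.im) ≤ |β.im * ω.im| := neg_le_abs _
        _ = |β.im| * |ω.im| := abs_mul _ _
        _ ≤ _ := mul_le_mul_of_nonneg_left h3 (abs_nonneg _)
    linarith
  exact Real.exp_le_exp.2 (by linarith)

theorem norm_faxenKernel_ofReal_le {μ : ℕ} (hμ : 2 ≤ μ) (x β : ℂ) (y : ℝ) :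
    ‖faxenKernel μ x β y‖ ≤ Real.exp (|β.im| * Real.pi) *
      Real.exp (-1 * Real.exp (μ * y) + ‖x‖ * Real.exp y + β.re * y) := by
  simpa using norm_faxenKernel_le hμ x β (ω := (y : ℂ)) (ϑ := 0) (by positivity) (by simp)

theorem integrable_faxenKernel {μ : ℕ} (hμ : 2 ≤ μ) (x : ℂ) {β : ℂ} (hβ : 0 < β.re) :
    Integrable fun y : ℝ => faxenKernel μ x β y := by
  refine ((integrable_exp_neg_mul_exp hμ one_pos ‖x‖ hβ).const_mul
    (Real.exp (|β.im| * Real.pi))).mono' ?_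
    (Eventually.of_forall fun y => norm_faxenKernel_ofReal_le hμ x β y)
  exact ((continuous_faxenKernel μ x β).comp continuous_ofReal).aestronglyMeasurable

/-- Substitute `t = e^{μ y}`: the Jacobian `μ e^{μ y}` combines with `t^(β/μ - 1)` to `μ e^{β y}`.
The factor `μ` later cancels against the `1/μ` in `b_n`. -/
theorem Fi_eq_kernelInt {μ : ℕ} (hμ : 2 ≤ μ) (x β : ℂ) :
    Fi (1 / (μ : ℝ)) (β / μ) x = μ * kernelInt μ x β := by
  have hμ0 : (μ : ℝ) ≠ 0 := by positivity
  have hμ0' : (μ : ℂ) ≠ 0 := by exact_mod_cast hμ0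
  have hd : ∀ y : ℝ, HasDerivAt (fun y : ℝ => Real.exp (μ * y)) (Real.exp (μ * y) * μ) y := by
    intro y
    simpa using ((hasDerivAt_id y).const_mul (μ : ℝ)).exp
  have hinj : Function.Injective fun y : ℝ => Real.exp (μ * y) := by
    intro a b hab
    exact mul_left_cancel₀ hμ0 (Real.exp_injective hab)
  have himg : (fun y : ℝ => Real.exp (μ * y)) '' univ = Ioi 0 := by
    rw [image_univ]
    ext t
    constructor
    · rintro ⟨y, rfl⟩
      exact Real.exp_pos _
    · intro ht
      refine ⟨Real.log t / μ, ?_⟩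
      simp only
      rw [mul_div_cancel₀ _ hμ0, Real.exp_log ht]
  unfold Fi kernelInt
  rw [← himg, integral_image_eq_integral_abs_deriv_smul MeasurableSet.univ
    (fun y _ => (hd y).hasDerivWithinAt) hinj.injOn, Measure.restrict_univ,
    ← integral_const_mul]
  congr 1
  funext y
  have h1 : (Real.exp (μ * y)) ^ (1 / (μ : ℝ)) = Real.exp y := by
    rw [← Real.exp_mul]
    congr 1
    field_simp
  have h2 : ((Real.exp (μ * y) : ℝ) : ℂ) ^ (β / μ - 1) = exp (μ * y * (β / μ - 1)) := by
    rw [cpow_def_of_ne_zero (by exact_mod_cast (Real.exp_pos _).ne'), ← ofReal_log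
      (Real.exp_pos _).le, Real.log_exp]
    push_cast
    rfl
  rw [h1, h2, abs_of_pos (by positivity), real_smul, faxenKernel]
  push_cast
  have h3 : exp (-exp (μ * y) + x * exp y + β * y) =
      exp (μ * y) * (exp (-exp (μ * y) + x * exp y) * exp (μ * y * (β / μ - 1))) := by
    rw [← exp_add, ← exp_add]
    congr 1
    field_simp
    ring
  rw [h3]
  ring

/-- Differentiating in `x` brings down `e^y`, which is a shift of `β` by one; the domination uses
`‖x'‖ ≤ ‖x‖ + 1` on the unit ball about `x`. -/
theorem hasDerivAt_kernelInt {μ : ℕ} (hμ : 2 ≤ μ) (x : ℂ) {β : ℂ} (hβ : 0 < β.re) :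
    HasDerivAt (fun x => kernelInt μ x β) (kernelInt μ x (β + 1)) x := by
  have hβ1 : 0 < (β + 1).re := by simp; linarith
  refine (hasDerivAt_integral_of_dominated_loc_of_deriv_le (𝕜 := ℂ)
    (F := fun x (y : ℝ) => faxenKernel μ x β y) (F' := fun x (y : ℝ) => faxenKernel μ x (β + 1) y)
    (x₀ := x) (s := Metric.ball x 1) (Metric.ball_mem_nhds x one_pos)
    (bound := fun y => Real.exp (|(β + 1).im| * Real.pi) *
      Real.exp (-1 * Real.exp (μ * y) + (‖x‖ + 1) * Real.exp y + (β + 1).re * y))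
    (Eventually.of_forall fun x =>
      ((continuous_faxenKernel μ x β).comp continuous_ofReal).aestronglyMeasurable)
    (integrable_faxenKernel hμ x hβ)
    ((continuous_faxenKernel μ x (β + 1)).comp continuous_ofReal).aestronglyMeasurable
    ?_ ((integrable_exp_neg_mul_exp hμ one_pos _ hβ1).const_mul _) ?_).2
  · refine Eventually.of_forall fun y x' hx' => ?_
    refine (norm_faxenKernel_ofReal_le hμ x' (β + 1) y).trans ?_
    have : ‖x'‖ ≤ ‖x‖ + 1 := by
      have h1 : ‖x' - x‖ < 1 := by simpa [dist_eq_norm] using hx'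
      have h2 := norm_le_norm_add_norm_sub' x' x
      linarith
    gcongr
  · refine Eventually.of_forall fun y x' _ => ?_
    have h : HasDerivAt (fun x' : ℂ => -exp (μ * y) + x' * exp y + β * y) (1 * exp y) x' :=
      (((hasDerivAt_id x').mul_const (exp (y : ℂ))).const_add _).add_const _
    have h2 := h.cexp
    rw [faxenKernel_add]
    simpa [faxenKernel] using h2

/-- The `ω`-derivative of the kernel integrates to zero over the real line. As shifts of `β` are
derivatives in `x`, this is the differential equation `μ w^(μ) = x w' + β w`. -/
theorem natCast_mul_kernelInt {μ : ℕ} (hμ : 2 ≤ μ) (x : ℂ) {β : ℂ} (hβ : 0 < β.re) :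
    μ * kernelInt μ x (β + μ) = x * kernelInt μ x (β + 1) + β * kernelInt μ x β := by
  have hi0 := integrable_faxenKernel hμ x hβ
  have hi1 := integrable_faxenKernel hμ x (β := β + 1) (by simp; linarith)
  have hiμ := integrable_faxenKernel hμ x (β := β + μ) (by simp; positivity)
  have hint := ((hiμ.const_mul (-(μ : ℂ))).add (hi1.const_mul x)).add (hi0.const_mul β)
  have h := integral_eq_zero_of_hasDerivAt_of_integrable
    (fun y : ℝ => (hasDerivAt_faxenKernel μ x β y).comp_ofReal) hint hi0
  have h1 := integral_add ((hiμ.const_mul (-(μ : ℂ))).add (hi1.const_mul x)) (hi0.const_mul β)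
  have h2 := integral_add (hiμ.const_mul (-(μ : ℂ))) (hi1.const_mul x)
  simp only [Pi.add_apply, integral_const_mul] at h1 h2
  rw [h1, h2] at h
  unfold kernelInt
  linear_combination -h

theorem iteratedDeriv_Fi {μ : ℕ} (hμ : 2 ≤ μ) {β : ℂ} (hβ : 0 < β.re) (n : ℕ) (x : ℂ) :
    iteratedDeriv n (Fi (1 / (μ : ℝ)) (β / μ)) x = Fi (1 / (μ : ℝ)) ((β + n) / μ) x := by
  induction n generalizing x with
  | zero => simp
  | succ n ih =>
    rw [iteratedDeriv_succ, funext ih, funext fun x => Fi_eq_kernelInt hμ x (β + n),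
      Fi_eq_kernelInt hμ, ((hasDerivAt_kernelInt hμ x (β := β + n) (by simp; positivity)).const_mul _).deriv]
    push_cast
    rw [add_assoc]

/-- Differentiate the identity for `j` with respect to `x`. Only the last summand, `n = μ - 1`,
leaves the range of admissible shifts; the differential equation sends it back to the shifts `0` and
`1`, which produces the two exceptional terms in the recursion for `gPoly`. -/
theorem kernelInt_add_natCast {μ : ℕ} (hμ : 2 ≤ μ) {lam : ℂ} (hlam : 0 < lam.re) (j : ℕ) (x : ℂ) :
    kernelInt μ x (lam + j) =
      ∑ n ∈ Finset.range μ, (gPoly μ lam j n).eval x * kernelInt μ x (lam + n) := by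
  have hμ0 : (μ : ℂ) ≠ 0 := by exact_mod_cast (by omega : μ ≠ 0)
  induction j generalizing x with
  | zero =>
    rw [Finset.sum_eq_single_of_mem 0 (by simp; omega) fun n _ hn => by simp [gPoly, hn]]
    simp [gPoly]
  | succ j ih =>
    have hpos : ∀ n : ℕ, 0 < (lam + n).re := fun n => by simp; positivity
    have h1 : HasDerivAt (fun x => kernelInt μ x (lam + j)) (kernelInt μ x (lam + j + 1)) x :=
      hasDerivAt_kernelInt hμ x (hpos j)
    have h2 : HasDerivAt (fun x => kernelInt μ x (lam + j))
        (∑ n ∈ Finset.range μ, ((gPoly μ lam j n).derivative.eval x * kernelInt μ x (lam + n) +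
          (gPoly μ lam j n).eval x * kernelInt μ x (lam + n + 1))) x := by
      rw [funext ih]
      exact HasDerivAt.fun_sum fun n _ =>
        ((gPoly μ lam j n).hasDerivAt x).mul (hasDerivAt_kernelInt hμ x (hpos n))
    have h3 := h1.unique h2
    obtain ⟨k, rfl⟩ := Nat.exists_eq_add_of_le' hμ
    have hode := natCast_mul_kernelInt hμ x hlam
    have hode' : kernelInt (k + 2) x (lam + (k + 1 : ℕ) + 1) =
        (x * kernelInt (k + 2) x (lam + 1) + lam * kernelInt (k + 2) x lam) / ((k + 2 : ℕ) : ℂ) := by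
      rw [← hode, mul_div_cancel_left₀ _ hμ0]
      push_cast
      ring_nf
    have hcast : (lam + ((j + 1 : ℕ) : ℂ)) = lam + j + 1 := by push_cast; ring
    rw [hcast, h3, Finset.sum_add_distrib, Finset.sum_range_succ
      (fun n => (gPoly (k + 2) lam j n).eval x * kernelInt (k + 2) x (lam + n + 1)) (k + 1), hode']
    -- With `μ = k + 2`, the indices `0` and `1`, where the recursion has its extra terms, are split
    -- off.
    simp only [Finset.sum_range_succ' _ (k + 1), Finset.sum_range_succ' _ k]
    have hg0 : gPoly (k + 2) lam (j + 1) 0 = Polynomial.derivative (gPoly (k + 2) lam j 0) +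
        Polynomial.C (lam / ((k + 2 : ℕ) : ℂ)) * gPoly (k + 2) lam j (k + 1) := by
      simp [gPoly]
    have hg1 : gPoly (k + 2) lam (j + 1) 1 = gPoly (k + 2) lam j 0 +
        Polynomial.derivative (gPoly (k + 2) lam j 1) +
        Polynomial.C (1 / ((k + 2 : ℕ) : ℂ)) * Polynomial.X * gPoly (k + 2) lam j (k + 1) := by
      simp [gPoly]
    have hg : ∀ n < k, gPoly (k + 2) lam (j + 1) (n + 1 + 1) = gPoly (k + 2) lam j (n + 1) +
        Polynomial.derivative (gPoly (k + 2) lam j (n + 1 + 1)) := by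
      intro n hn
      rw [gPoly, if_neg (by omega), if_neg (by omega), if_neg (by omega)]
      rfl
    have hsum : ∑ n ∈ Finset.range k, (gPoly (k + 2) lam (j + 1) (n + 1 + 1)).eval x *
          kernelInt (k + 2) x (lam + (n + 1 + 1 : ℕ)) =
        ∑ n ∈ Finset.range k, (gPoly (k + 2) lam j (n + 1)).eval x *
          kernelInt (k + 2) x (lam + (n + 1 : ℕ) + 1) +
        ∑ n ∈ Finset.range k, (gPoly (k + 2) lam j (n + 1 + 1)).derivative.eval x *
          kernelInt (k + 2) x (lam + (n + 1 + 1 : ℕ)) := by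
      rw [← Finset.sum_add_distrib]
      refine Finset.sum_congr rfl fun n hn => ?_
      rw [hg n (Finset.mem_range.1 hn), Polynomial.eval_add]
      push_cast
      ring_nf
    rw [hsum, zero_add, hg0, hg1]
    simp only [Polynomial.eval_add, Polynomial.eval_mul, Polynomial.eval_C, Polynomial.eval_X]
    push_cast
    ring_nf

/-- The recursion moves the index `n` up by at most one per step. This vanishing is the source of
the `⌈n/2⌉` in the expansion. -/
theorem gPoly_eq_zero_of_lt {μ : ℕ} (lam : ℂ) {j n : ℕ} (h : j < n) (hn : n < μ) :
    gPoly μ lam j n = 0 := by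
  induction j generalizing n with
  | zero => simp [gPoly, h.ne']
  | succ j ih =>
    rw [gPoly, if_neg (by omega), if_neg (by omega), if_neg (by omega),
      ih (by omega) (by omega), ih (by omega) hn]
    simp

end FaxenExpansion

namespace FaxenExpansion

/-! ### Incomplete Faxén integrals in the strip -/

/-- The integral of `faxenKernel` over the horizontal half-line that starts at `ω`. -/
noncomputable def kernelTail (μ : ℕ) (x β ω : ℂ) : ℂ :=
  ∫ y in Ioi (0 : ℝ), faxenKernel μ x β (ω + y)

theorem norm_faxenKernel_add_ofReal_le {μ : ℕ} (hμ : 2 ≤ μ) (x β : ℂ) {ω : ℂ} {ϑ : ℝ}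
    (hϑ : ϑ < Real.pi / 2) (h : |μ * ω.im| ≤ ϑ) (y : ℝ) :
    ‖faxenKernel μ x β (ω + y)‖ ≤ Real.exp (|β.im| * Real.pi) *
      Real.exp (-Real.cos ϑ * Real.exp (μ * (ω.re + y)) + ‖x‖ * Real.exp (ω.re + y)
        + β.re * (ω.re + y)) := by
  simpa using norm_faxenKernel_le hμ x β (ω := ω + y) hϑ (by simpa using h)

/-- To the right of `ω` the factor `e^{K y}` is at least `1`. Hence the integrand is bounded by
`e^{-K Re ω}` times a translate of an integrable function with exponent `Re β + K`, and translation
invariance makes the constant independent of `ω`. -/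
theorem exists_norm_kernelTail_le {μ : ℕ} (hμ : 2 ≤ μ) (x : ℂ) {β : ℂ} (hβ : 0 < β.re) {ϑ : ℝ}
    (hϑ0 : 0 ≤ ϑ) (hϑ : ϑ < Real.pi / 2) {K : ℝ} (hK : 0 ≤ K) :
    ∃ C : ℝ, ∀ ω : ℂ, |μ * ω.im| ≤ ϑ → ‖kernelTail μ x β ω‖ ≤ C * Real.exp (-(K * ω.re)) := by
  have hcos : 0 < Real.cos ϑ := Real.cos_pos_of_mem_Ioo ⟨by linarith [Real.pi_pos], hϑ⟩
  set g : ℝ → ℝ := fun y => Real.exp (|β.im| * Real.pi) * Real.exp (-Real.cos ϑ *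
    Real.exp (μ * y) + ‖x‖ * Real.exp y + (β.re + K) * y) with hg
  have hgi : Integrable g :=
    (integrable_exp_neg_mul_exp hμ hcos ‖x‖ (by linarith : 0 < β.re + K)).const_mul _
  refine ⟨∫ y, g y, fun ω hω => ?_⟩
  have hgi' : Integrable fun y => Real.exp (-(K * ω.re)) * g (ω.re + y) :=
    (hgi.comp_add_left ω.re).const_mul _
  calc ‖kernelTail μ x β ω‖
      ≤ ∫ y in Ioi (0 : ℝ), Real.exp (-(K * ω.re)) * g (ω.re + y) := by
        refine norm_integral_le_of_norm_le hgi'.integrableOn ?_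
        refine (ae_restrict_iff' measurableSet_Ioi).2 (Eventually.of_forall fun y hy => ?_)
        refine (norm_faxenKernel_add_ofReal_le hμ x β hϑ hω y).trans ?_
        have hy' : (0 : ℝ) < y := hy
        simp only [hg]
        rw [mul_left_comm, ← Real.exp_add (-(K * ω.re))]
        refine mul_le_mul_of_nonneg_left (Real.exp_le_exp.2 ?_) (Real.exp_pos _).le
        nlinarith [mul_nonneg hK hy'.le]
    _ ≤ ∫ y, Real.exp (-(K * ω.re)) * g (ω.re + y) :=
        setIntegral_le_integral hgi' (Eventually.of_forall fun y => by positivity)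
    _ = (∫ y, g y) * Real.exp (-(K * ω.re)) := by
        rw [integral_const_mul, integral_add_left_eq_self g ω.re, mul_comm]

/-- Differentiation under the integral is allowed because the kernel and its derivative are
dominated uniformly near `ω`, inside a slightly narrower strip. Thus the tail is a holomorphic
antiderivative of minus the kernel, and integrals along curved paths in the strip can be evaluated
from their end points. -/
theorem hasDerivAt_kernelTail {μ : ℕ} (hμ : 2 ≤ μ) (x : ℂ) {β : ℂ} (hβ : 0 < β.re) {ω : ℂ}
    (hω : |μ * ω.im| < Real.pi / 2) :
    HasDerivAt (kernelTail μ x β) (-faxenKernel μ x β ω) ω := by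
  obtain ⟨ϑ, hϑ1, hϑ2⟩ := exists_between hω
  have hϑ0 : 0 ≤ ϑ := (abs_nonneg _).trans hϑ1.le
  have hcos : 0 < Real.cos ϑ := Real.cos_pos_of_mem_Ioo ⟨by linarith [Real.pi_pos], hϑ2⟩
  set S : Set ℂ := {z | |μ * z.im| < ϑ ∧ |z.re - ω.re| < 1} with hS
  have hSo : S ∈ 𝓝 ω := by
    refine IsOpen.mem_nhds ?_ ⟨hϑ1, by simp⟩
    have h1 : IsOpen {z : ℂ | |μ * z.im| < ϑ} := isOpen_lt (by fun_prop) continuous_const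
    have h2 : IsOpen {z : ℂ | |z.re - ω.re| < 1} := isOpen_lt (by fun_prop) continuous_const
    exact h1.inter h2
  set G : ℂ → ℝ → ℝ := fun b y => Real.exp (|b.im| * Real.pi + b.re * (ω.re + 1)) *
    Real.exp (-(Real.cos ϑ * Real.exp (μ * (ω.re - 1))) * Real.exp (μ * y) +
      (‖x‖ * Real.exp (ω.re + 1)) * Real.exp y + b.re * y) with hG
  have hGi : ∀ b : ℂ, 0 < b.re → Integrable (G b) := fun b hb =>
    (integrable_exp_neg_mul_exp hμ (by positivity) _ hb).const_mul _
  have hGb : ∀ b : ℂ, 0 < b.re → ∀ z ∈ S, ∀ y : ℝ, ‖faxenKernel μ x b (z + y)‖ ≤ G b y := by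
    intro b hb z hz y
    refine (norm_faxenKernel_add_ofReal_le hμ x b hϑ2 hz.1.le y).trans ?_
    have h1 := abs_lt.1 hz.2
    rw [hG]
    simp only
    rw [← Real.exp_add, ← Real.exp_add]
    refine Real.exp_le_exp.2 ?_
    have e1 : Real.cos ϑ * (Real.exp (μ * (ω.re - 1)) * Real.exp (μ * y)) ≤
        Real.cos ϑ * Real.exp (μ * (z.re + y)) := by
      rw [← Real.exp_add, ← mul_add]
      gcongr
      linarith
    have e2 : ‖x‖ * Real.exp (z.re + y) ≤ ‖x‖ * (Real.exp (ω.re + 1) * Real.exp y) := by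
      rw [← Real.exp_add]
      gcongr
      linarith
    have e3 : b.re * (z.re + y) ≤ b.re * (ω.re + 1) + b.re * y := by
      rw [← mul_add]
      gcongr
      linarith
    linarith
  have hβμ : 0 < (β + μ).re := by simp; positivity
  have hβ1 : 0 < (β + 1).re := by simp; linarith
  set F' : ℂ → ℂ := fun z => -μ * faxenKernel μ x (β + μ) z + x * faxenKernel μ x (β + 1) z
    + β * faxenKernel μ x β z with hF'
  have hF'c : Continuous F' := by
    have h1 := continuous_faxenKernel μ x (β + μ)
    have h2 := continuous_faxenKernel μ x (β + 1)
    have h3 := continuous_faxenKernel μ x β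
    fun_prop
  set B : ℝ → ℝ := fun y => μ * G (β + μ) y + ‖x‖ * G (β + 1) y + ‖β‖ * G β y with hB
  have hBi : Integrable B := (((hGi _ hβμ).const_mul _).add ((hGi _ hβ1).const_mul _)).add
    ((hGi _ hβ).const_mul _)
  have hFB : ∀ z ∈ S, ∀ y : ℝ, ‖F' (z + y)‖ ≤ B y := by
    intro z hz y
    refine (norm_add₃_le).trans ?_
    simp only [norm_mul, norm_neg, Complex.norm_natCast]
    refine add_le_add (add_le_add ?_ ?_) ?_
    · exact mul_le_mul_of_nonneg_left (hGb _ hβμ z hz y) (by positivity)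
    · exact mul_le_mul_of_nonneg_left (hGb _ hβ1 z hz y) (by positivity)
    · exact mul_le_mul_of_nonneg_left (hGb _ hβ z hz y) (by positivity)
  have hmeas : ∀ (F : ℂ → ℂ), Continuous F → ∀ z : ℂ, AEStronglyMeasurable
      (fun y : ℝ => F (z + y)) (volume.restrict (Ioi 0)) := fun F hF z => by
    have : Continuous fun y : ℝ => F (z + y) := by fun_prop
    exact this.aestronglyMeasurable
  have hωS : ω ∈ S := mem_of_mem_nhds hSo
  have hint : Integrable (fun y : ℝ => faxenKernel μ x β (ω + y)) := by
    refine (hGi β hβ).mono' ?_ (Eventually.of_forall fun y => hGb β hβ ω hωS y)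
    exact ((continuous_faxenKernel μ x β).comp (by fun_prop)).aestronglyMeasurable
  have hint' : Integrable (fun y : ℝ => F' (ω + y)) := by
    refine hBi.mono' ?_ (Eventually.of_forall fun y => hFB ω hωS y)
    exact (hF'c.comp (by fun_prop)).aestronglyMeasurable
  have hderiv : ∀ (y : ℝ) (z : ℂ), HasDerivAt (fun z => faxenKernel μ x β (z + y)) (F' (z + y)) z :=
    fun y z => (hasDerivAt_faxenKernel μ x β (z + y)).comp_add_const z y
  have hmain := (hasDerivAt_integral_of_dominated_loc_of_deriv_le (𝕜 := ℂ)
    (μ := volume.restrict (Ioi (0 : ℝ)))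
    (F := fun z (y : ℝ) => faxenKernel μ x β (z + y)) (F' := fun z (y : ℝ) => F' (z + y))
    hSo (Eventually.of_forall fun z => hmeas _ (continuous_faxenKernel μ x β) z)
    hint.integrableOn (hmeas _ hF'c ω)
    (Eventually.of_forall fun y z hz => hFB z hz y) hBi.integrableOn
    (Eventually.of_forall fun y z _ => hderiv y z)).2
  -- Along the half-line, `F'` is also the derivative in `y`, so its integral is a boundary value.
  have hval : ∫ y in Ioi (0 : ℝ), F' (ω + y) = -faxenKernel μ x β ω := by
    have hd : ∀ y : ℝ, HasDerivAt (fun y : ℝ => faxenKernel μ x β (ω + y)) (F' (ω + y)) y :=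
      fun y => ((hasDerivAt_faxenKernel μ x β (ω + y)).comp_const_add ω (y : ℂ)).comp_ofReal
    have := integral_Ioi_of_hasDerivAt_of_tendsto' (a := 0) (fun y _ => hd y) hint'.integrableOn
      (tendsto_zero_of_hasDerivAt_of_integrableOn_Ioi (a := 0) (fun y _ => hd y)
        hint'.integrableOn hint.integrableOn)
    simpa using this
  rw [← hval]
  exact hmain

theorem tendsto_kernelTail_ofReal {μ : ℕ} (hμ : 2 ≤ μ) (x : ℂ) {β : ℂ} (hβ : 0 < β.re) :
    Tendsto (fun a : ℝ => kernelTail μ x β a) atBot (𝓝 (kernelInt μ x β)) := by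
  have h := (aecover_Ioi (μ := (volume : Measure ℝ)) (l := atBot)
    tendsto_id).integral_tendsto_of_countably_generated (integrable_faxenKernel hμ x hβ)
  refine h.congr fun a => ?_
  have h1 := (measurePreserving_add_left (volume : Measure ℝ) a).setIntegral_preimage_emb
    (measurableEmbedding_addLeft a) (fun y : ℝ => faxenKernel μ x β y) (Ioi a)
  have h2 : (fun y => a + y) ⁻¹' Ioi a = Ioi (0 : ℝ) := by
    ext y
    simp
  rw [h2] at h1
  simp only [id]
  rw [← h1]
  simp [kernelTail]

/-- Moving `ω` vertically to the real axis changes the tail by at most a constant times `e^{Re β ·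
Re ω}`, because the kernel is that small on the vertical segment and the segment has length at most
`π`. On the real axis the limit is the complete integral. -/
theorem tendsto_kernelTail {ι : Type*} {l : Filter ι} {μ : ℕ} (hμ : 2 ≤ μ) (x : ℂ) {β : ℂ}
    (hβ : 0 < β.re) {ϑ : ℝ} (hϑ : ϑ < Real.pi / 2) {ω : ι → ℂ}
    (hω : ∀ᶠ i in l, |μ * (ω i).im| ≤ ϑ) (hre : Tendsto (fun i => (ω i).re) l atBot) :
    Tendsto (fun i => kernelTail μ x β (ω i)) l (𝓝 (kernelInt μ x β)) := by
  have h1 := (tendsto_kernelTail_ofReal hμ x hβ).comp hre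
  set M : ℝ := Real.exp (|β.im| * Real.pi) * Real.exp ‖x‖ * Real.pi with hM
  have h2 : Tendsto (fun i => M * Real.exp (β.re * (ω i).re)) l (𝓝 0) := by
    have := (Real.tendsto_exp_atBot.comp (hre.const_mul_atBot hβ)).const_mul M
    simpa using this
  have h3 : Tendsto (fun i => kernelTail μ x β (ω i) - kernelTail μ x β ((ω i).re : ℝ)) l
      (𝓝 0) := by
    refine squeeze_zero_norm' ?_ h2
    filter_upwards [hω, hre.eventually (eventually_le_atBot 0)] with i hi hi0
    have hseg : ∀ z ∈ segment ℝ ((ω i).re : ℂ) (ω i), z.re = (ω i).re ∧ |μ * z.im| ≤ ϑ := by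
      rintro z ⟨s, t, hs, ht, hst, rfl⟩
      constructor
      · simp [← add_mul, hst]
      · have : |t| ≤ 1 := by rw [abs_of_nonneg ht]; linarith
        have e : μ * (s • ((ω i).re : ℂ) + t • ω i).im = t * (μ * (ω i).im) := by
          simp
          ring
        rw [e, abs_mul]
        calc |t| * |μ * (ω i).im| ≤ 1 * |μ * (ω i).im| := by gcongr
          _ ≤ ϑ := by rw [one_mul]; exact hi
    have hb := (convex_segment ((ω i).re : ℂ) (ω i)).norm_image_sub_le_of_norm_hasDerivWithin_le
      (f := kernelTail μ x β) (f' := fun z => -faxenKernel μ x β z)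
      (C := Real.exp (|β.im| * Real.pi) * Real.exp (‖x‖ + β.re * (ω i).re))
      (fun z hz => (hasDerivAt_kernelTail hμ x hβ
        ((hseg z hz).2.trans_lt hϑ)).hasDerivWithinAt) (fun z hz => by
        rw [norm_neg]
        refine (norm_faxenKernel_le hμ x β hϑ (hseg z hz).2).trans ?_
        rw [(hseg z hz).1]
        refine mul_le_mul_of_nonneg_left (Real.exp_le_exp.2 ?_) (Real.exp_pos _).le
        have e1 : Real.exp (ω i).re ≤ 1 := Real.exp_le_one_iff.2 hi0
        have e2 : 0 ≤ Real.cos ϑ := Real.cos_nonneg_of_mem_Icc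
          ⟨by linarith [Real.pi_pos, (abs_nonneg _).trans hi], hϑ.le⟩
        nlinarith [norm_nonneg x, mul_nonneg e2 (Real.exp_pos (μ * (ω i).re)).le])
      (left_mem_segment ℝ _ _) (right_mem_segment ℝ _ _)
    refine hb.trans ?_
    have him : ‖ω i - ((ω i).re : ℂ)‖ ≤ Real.pi := by
      have e : ω i - ((ω i).re : ℂ) = (ω i).im * I := by
        apply Complex.ext <;> simp
      rw [e, norm_mul, norm_I, mul_one, norm_real, Real.norm_eq_abs]
      rw [abs_mul, Nat.abs_cast] at hi
      have : (1 : ℝ) ≤ μ := by exact_mod_cast (by omega : 1 ≤ μ)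
      nlinarith [abs_nonneg (ω i).im, Real.pi_pos]
    calc _ ≤ Real.exp (|β.im| * Real.pi) * Real.exp (‖x‖ + β.re * (ω i).re) * Real.pi := by gcongr
      _ = _ := by rw [hM, Real.exp_add]; ring
  simpa using h3.add h1

/-! ### Integrals along a path that comes from `Re ω = -∞` -/

/-- `ξ` is a logarithm of a path that leaves the origin, with angles in a given sector. -/
structure IsLogPath (μ : ℕ) (c₀ c₁ c₂ c₃ : ℝ) (ξ : ℝ → ℂ) : Prop where
  c₀_pos : 0 < c₀
  c₁_pos : 0 < c₁
  differentiableAt : ∀ s ∈ Ioc 0 c₀, DifferentiableAt ℝ ξ s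
  lower : ∀ s ∈ Ioc 0 c₀, c₁ * s ≤ Real.exp (ξ s).re
  upper : ∀ s ∈ Ioc 0 c₀, Real.exp (ξ s).re ≤ c₂ * s
  deriv_le : ∀ s ∈ Ioc 0 c₀, ‖deriv ξ s‖ ≤ c₃ / s

variable {μ : ℕ} {c₀ c₁ c₂ c₃ : ℝ} {ξ : ℝ → ℂ}

theorem IsLogPath.c₂_pos (hξ : IsLogPath μ c₀ c₁ c₂ c₃ ξ) : 0 < c₂ := by
  have h := hξ.upper c₀ ⟨hξ.c₀_pos, le_rfl⟩
  exact pos_of_mul_pos_left ((Real.exp_pos _).trans_le h) hξ.c₀_pos.le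

theorem IsLogPath.tendsto_re (hξ : IsLogPath μ c₀ c₁ c₂ c₃ ξ) (τ : ℂ) :
    Tendsto (fun s => (ξ s + τ).re) (𝓝[>] 0) atBot := by
  have h1 : Tendsto (fun s => Real.exp (ξ s).re) (𝓝[>] 0) (𝓝 0) := by
    have h2 : Tendsto (fun s : ℝ => c₂ * s) (𝓝[>] 0) (𝓝 0) := by
      have : Tendsto (fun s : ℝ => c₂ * s) (𝓝 0) (𝓝 (c₂ * 0)) := tendsto_id.const_mul c₂
      rw [mul_zero] at this
      exact this.mono_left nhdsWithin_le_nhds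
    refine squeeze_zero' (Eventually.of_forall fun s => (Real.exp_pos _).le) ?_ h2
    filter_upwards [Ioc_mem_nhdsGT hξ.c₀_pos] with s hs using hξ.upper s hs
  simpa using tendsto_atBot_add_const_right _ τ.re (Real.tendsto_exp_comp_nhds_zero.1 h1)

theorem IsLogPath.continuousOn (hξ : IsLogPath μ c₀ c₁ c₂ c₃ ξ) : ContinuousOn ξ (Ioc 0 c₀) :=
  fun s hs => (hξ.differentiableAt s hs).continuousAt.continuousWithinAt

/-- `C` does not depend on the shift `a`. With `r = e^a`, the integrand is at most a constant times
`r^b s^(b-1) e^{-r s}`, whose integral over the half-line is `Γ(b)` for every `r`. This scale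
invariance gives uniformity in `|z|`. -/
theorem IsLogPath.exists_integral_bound (hμ : 2 ≤ μ) (hξ : IsLogPath μ c₀ c₁ c₂ c₃ ξ) {d : ℝ}
    (hd : 0 < d) (K : ℝ) {b : ℝ} (hb : 0 < b) :
    ∃ C : ℝ, 0 ≤ C ∧ ∀ (a M : ℝ) (f : ℝ → ℂ), 0 ≤ M →
      AEStronglyMeasurable f (volume.restrict (Ioc 0 c₀)) →
      (∀ s ∈ Ioc 0 c₀, ‖f s‖ ≤ M * Real.exp (-d * Real.exp (μ * ((ξ s).re + a)) +
        K * Real.exp ((ξ s).re + a) + b * ((ξ s).re + a)) * (1 / s)) →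
      IntegrableOn f (Ioc 0 c₀) ∧ ‖∫ s in Ioc 0 c₀, f s‖ ≤ M * C := by
  obtain ⟨K', hK'⟩ := exists_neg_mul_pow_add_le hμ hd K (1 / c₁)
  have hc₁ := hξ.c₁_pos
  have hc₂ := hξ.c₂_pos
  refine ⟨Real.exp K' * c₂ ^ b * Real.Gamma b, by have := Real.Gamma_pos_of_pos hb; positivity,
    fun a M f hM hf hfb => ?_⟩
  set r : ℝ := Real.exp a with hr
  have hr0 : 0 < r := Real.exp_pos a
  set g : ℝ → ℝ := fun s => M * (Real.exp K' * c₂ ^ b * r ^ b) *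
    (s ^ (b - 1) * Real.exp (-(r * s))) with hg
  have hgi : IntegrableOn g (Ioi 0) := by
    have h0 := integrableOn_rpow_mul_exp_neg_mul_rpow (p := 1) (s := b - 1) (b := r)
      (by linarith) one_pos hr0
    refine IntegrableOn.congr_fun (h0.const_mul (M * (Real.exp K' * c₂ ^ b * r ^ b)))
      (fun s _ => ?_) measurableSet_Ioi
    simp [hg]
  have hfg : ∀ s ∈ Ioc 0 c₀, ‖f s‖ ≤ g s := by
    intro s hs
    have hs0 : 0 < s := hs.1
    refine (hfb s hs).trans ?_
    set t : ℝ := (ξ s).re + a with ht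
    have het : Real.exp t = Real.exp (ξ s).re * r := by rw [ht, Real.exp_add]
    have hlow : r * s ≤ 1 / c₁ * Real.exp t := by
      rw [het, one_div, ← div_eq_inv_mul, le_div_iff₀ hc₁]
      have := mul_le_mul_of_nonneg_right (hξ.lower s hs) hr0.le
      linarith
    have hup : Real.exp t ≤ c₂ * r * s := by
      rw [het]
      have := mul_le_mul_of_nonneg_right (hξ.upper s hs) hr0.le
      linarith
    have e1 := hK' _ (Real.exp_pos t).le
    rw [← Real.exp_nat_mul] at e1
    have e2 : Real.exp (b * t) ≤ c₂ ^ b * r ^ b * s ^ b := by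
      rw [← Real.mul_rpow hc₂.le hr0.le, ← Real.mul_rpow (by positivity) hs0.le, mul_comm b,
        Real.exp_mul]
      exact Real.rpow_le_rpow (Real.exp_pos _).le hup hb.le
    have e3 : s ^ (b - 1) = s ^ b * (1 / s) := by
      rw [Real.rpow_sub_one hs0.ne']
      ring
    have e4 : Real.exp (-d * Real.exp (μ * t) + K * Real.exp t + b * t) ≤
        Real.exp K' * Real.exp (-(r * s)) * (c₂ ^ b * r ^ b * s ^ b) := by
      rw [Real.exp_add, ← Real.exp_add K']
      refine mul_le_mul (Real.exp_le_exp.2 ?_) e2 (Real.exp_pos _).le (Real.exp_pos _).le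
      linarith
    calc M * Real.exp (-d * Real.exp (μ * t) + K * Real.exp t + b * t) * (1 / s)
        ≤ M * (Real.exp K' * Real.exp (-(r * s)) * (c₂ ^ b * r ^ b * s ^ b)) * (1 / s) := by gcongr
      _ = g s := by
        rw [hg]
        simp only [e3]
        ring
  have hsub : Ioc 0 c₀ ⊆ Ioi (0 : ℝ) := fun s hs => hs.1
  have hae : ∀ᵐ s ∂(volume.restrict (Ioc 0 c₀)), ‖f s‖ ≤ g s :=
    (ae_restrict_iff' measurableSet_Ioc).2 (Eventually.of_forall hfg)
  refine ⟨(hgi.mono_set hsub).mono' hf hae, ?_⟩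
  calc ‖∫ s in Ioc 0 c₀, f s‖ ≤ ∫ s in Ioc 0 c₀, g s :=
        norm_integral_le_of_norm_le (hgi.mono_set hsub) hae
    _ ≤ ∫ s in Ioi 0, g s := by
        refine setIntegral_mono_set hgi ?_ hsub.eventuallyLE
        refine (ae_restrict_iff' measurableSet_Ioi).2 (Eventually.of_forall fun s hs => ?_)
        have hs0 : (0 : ℝ) < s := hs
        simp only [hg, Pi.zero_apply]
        positivity
    _ = M * (Real.exp K' * c₂ ^ b * Real.Gamma b) := by
        rw [hg, integral_const_mul, Real.integral_rpow_mul_exp_neg_mul_Ioi hb hr0, one_div,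
          Real.inv_rpow hr0.le]
        have : r ^ b ≠ 0 := (Real.rpow_pos_of_pos hr0 b).ne'
        field_simp

/-- The fundamental theorem of calculus for the antiderivative `-kernelTail` along the path: the end
`s → 0` lies at `Re ω = -∞` and yields the complete integral, the other end yields the tail. -/
theorem IsLogPath.integral_faxenKernel (hμ : 2 ≤ μ) (hξ : IsLogPath μ c₀ c₁ c₂ c₃ ξ) (x : ℂ)
    {β : ℂ} (hβ : 0 < β.re) {ϑ : ℝ} (hϑ : ϑ < Real.pi / 2) (τ : ℂ)
    (hstrip : ∀ s ∈ Ioc 0 c₀, |μ * (ξ s + τ).im| ≤ ϑ) :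
    IntegrableOn (fun s => faxenKernel μ x β (ξ s + τ) * deriv ξ s) (Ioc 0 c₀) ∧
    ∫ s in Ioc 0 c₀, faxenKernel μ x β (ξ s + τ) * deriv ξ s =
      kernelInt μ x β - kernelTail μ x β (ξ c₀ + τ) := by
  have hc₀ := hξ.c₀_pos
  have hc₀m : c₀ ∈ Ioc 0 c₀ := ⟨hc₀, le_rfl⟩
  have hcos : 0 < Real.cos ϑ := Real.cos_pos_of_mem_Ioo
    ⟨by linarith [Real.pi_pos, (abs_nonneg _).trans (hstrip c₀ hc₀m)], hϑ⟩
  have hint : IntegrableOn (fun s => faxenKernel μ x β (ξ s + τ) * deriv ξ s) (Ioc 0 c₀) := by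
    obtain ⟨C, -, hC⟩ := hξ.exists_integral_bound hμ hcos ‖x‖ hβ
    have hc₃ : 0 ≤ c₃ := by
      have := (norm_nonneg _).trans (hξ.deriv_le c₀ hc₀m)
      rwa [le_div_iff₀ hc₀, zero_mul] at this
    refine (hC τ.re (Real.exp (|β.im| * Real.pi) * c₃) _ (by positivity) ?_ fun s hs => ?_).1
    · refine AEStronglyMeasurable.mul ?_ (stronglyMeasurable_deriv ξ).aestronglyMeasurable
      refine ContinuousOn.aestronglyMeasurable ?_ measurableSet_Ioc
      exact (continuous_faxenKernel μ x β).comp_continuousOn (hξ.continuousOn.add_const τ)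
    · rw [norm_mul]
      have h1 := norm_faxenKernel_le hμ x β hϑ (hstrip s hs)
      calc _ ≤ _ := mul_le_mul h1 (hξ.deriv_le s hs) (norm_nonneg _) (by positivity)
        _ = _ := by
          rw [add_re]
          ring
  refine ⟨hint, ?_⟩
  have hd : ∀ s ∈ Ioc 0 c₀, HasDerivAt (fun s => -kernelTail μ x β (ξ s + τ))
      (faxenKernel μ x β (ξ s + τ) * deriv ξ s) s := by
    intro s hs
    have h1 := ((hξ.differentiableAt s hs).hasDerivAt.add_const τ)
    have h2 := (hasDerivAt_kernelTail hμ x hβ ((hstrip s hs).trans_lt hϑ)).comp s h1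
    refine h2.neg.congr_deriv ?_
    ring
  have h0 : Tendsto (fun s => -kernelTail μ x β (ξ s + τ)) (𝓝[>] 0) (𝓝 (-kernelInt μ x β)) := by
    refine (tendsto_kernelTail hμ x hβ hϑ ?_ (hξ.tendsto_re τ)).neg
    filter_upwards [Ioc_mem_nhdsGT hc₀] with s hs using hstrip s hs
  have h1 : Tendsto (fun s => -kernelTail μ x β (ξ s + τ)) (𝓝[<] c₀)
      (𝓝 (-kernelTail μ x β (ξ c₀ + τ))) :=
    (hd c₀ hc₀m).continuousAt.tendsto.mono_left nhdsWithin_le_nhds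
  rw [← intervalIntegral.integral_of_le hc₀.le,
    intervalIntegral.integral_eq_sub_of_hasDerivAt_of_tendsto hc₀
      (fun s hs => hd s ⟨hs.1, hs.2.le⟩)
      ((intervalIntegrable_iff_integrableOn_Ioc_of_le hc₀.le).2 hint) h0 h1]
  ring

end FaxenExpansion

/-! ### Termwise integration of the perturbed Faxén kernel -/

namespace FaxenExpansion

variable {μ : ℕ} {c₀ c₁ c₂ c₃ : ℝ} {ξ : ℝ → ℂ}

/-- Expand `exp(w ρ)` to order `N` in `w ρ`, then each `ρ^m A` to order `N` in `σ`. Both errors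
carry `‖σ‖^N`; the powers of `‖w‖` are absorbed in `e^{‖w‖}`. The resulting exponent is linear in
`‖w‖`, hence dominated by the decay of the kernel. -/
theorem norm_exp_mul_mul_sub_sum_le {w ρ A σ : ℂ} {N : ℕ} {a : ℕ → ℕ → ℂ} {K₁ K₂ K₃ S : ℝ}
    (hK₁ : 0 ≤ K₁) (hS : ‖σ‖ ≤ S) (hρ : ‖ρ‖ ≤ K₁ * ‖σ‖) (hA : ‖A‖ ≤ K₂)
    (h : ∀ m < N, ‖ρ ^ m * A - ∑ k ∈ Finset.range N, a m k * σ ^ k‖ ≤ K₃ * ‖σ‖ ^ N) :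
    ‖exp (w * ρ) * A - ∑ k ∈ Finset.range N, ∑ m ∈ Finset.range N,
        a m k / (m.factorial : ℂ) * (w ^ m * σ ^ k)‖ ≤
      (K₁ ^ N * N.factorial * K₂ + N * K₃) * ‖σ‖ ^ N * Real.exp ((1 + K₁ * S) * ‖w‖) := by
  have hK₂ : 0 ≤ K₂ := (norm_nonneg _).trans hA
  have hS0 : 0 ≤ S := (norm_nonneg _).trans hS
  have hfac : ∀ m : ℕ, ‖w‖ ^ m ≤ m.factorial * Real.exp ‖w‖ := fun m => by
    have := Real.pow_div_factorial_le_exp ‖w‖ (norm_nonneg w) m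
    rwa [div_le_iff₀ (by positivity), mul_comm] at this
  have hexp1 : Real.exp ‖w‖ ≤ Real.exp ((1 + K₁ * S) * ‖w‖) := by
    refine Real.exp_le_exp.2 ?_
    nlinarith [mul_nonneg (mul_nonneg hK₁ hS0) (norm_nonneg w)]
  have hsplit : exp (w * ρ) * A - ∑ k ∈ Finset.range N, ∑ m ∈ Finset.range N,
        a m k / (m.factorial : ℂ) * (w ^ m * σ ^ k) =
      (exp (w * ρ) - ∑ m ∈ Finset.range N, (w * ρ) ^ m / (m.factorial : ℂ)) * A +
      ∑ m ∈ Finset.range N, w ^ m / (m.factorial : ℂ) *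
        (ρ ^ m * A - ∑ k ∈ Finset.range N, a m k * σ ^ k) := by
    rw [Finset.sum_comm, sub_mul, Finset.sum_mul]
    simp only [mul_sub, Finset.sum_sub_distrib, Finset.mul_sum]
    have e1 : ∀ m, (w * ρ) ^ m / (m.factorial : ℂ) * A =
        w ^ m / (m.factorial : ℂ) * (ρ ^ m * A) := fun m => by ring
    have e2 : ∀ m k, a m k / (m.factorial : ℂ) * (w ^ m * σ ^ k) =
        w ^ m / (m.factorial : ℂ) * (a m k * σ ^ k) := fun m k => by ring
    simp only [e1, e2]
    ring
  rw [hsplit]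
  have h1 : ‖(exp (w * ρ) - ∑ m ∈ Finset.range N, (w * ρ) ^ m / (m.factorial : ℂ)) * A‖ ≤
      K₁ ^ N * N.factorial * K₂ * ‖σ‖ ^ N * Real.exp ((1 + K₁ * S) * ‖w‖) := by
    rw [norm_mul]
    have e1 := Complex.norm_exp_sub_sum_le_norm_mul_exp (w * ρ) N
    have e2 : ‖w * ρ‖ ≤ ‖w‖ * (K₁ * ‖σ‖) := by rw [norm_mul]; gcongr
    have e3 : ‖w * ρ‖ ≤ K₁ * S * ‖w‖ := by
      refine e2.trans ?_
      rw [mul_comm]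
      gcongr
    calc _ ≤ ‖w * ρ‖ ^ N * Real.exp ‖w * ρ‖ * K₂ := by gcongr
      _ ≤ (‖w‖ * (K₁ * ‖σ‖)) ^ N * Real.exp (K₁ * S * ‖w‖) * K₂ := by gcongr
      _ = ‖w‖ ^ N * (K₁ ^ N * ‖σ‖ ^ N * Real.exp (K₁ * S * ‖w‖) * K₂) := by ring
      _ ≤ (N.factorial * Real.exp ‖w‖) * (K₁ ^ N * ‖σ‖ ^ N * Real.exp (K₁ * S * ‖w‖) * K₂) := by
        gcongr
        exact hfac N
      _ = _ := by
        rw [add_mul, one_mul, Real.exp_add]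
        ring
  have h2 : ‖∑ m ∈ Finset.range N, w ^ m / (m.factorial : ℂ) *
      (ρ ^ m * A - ∑ k ∈ Finset.range N, a m k * σ ^ k)‖ ≤
      N * K₃ * ‖σ‖ ^ N * Real.exp ((1 + K₁ * S) * ‖w‖) := by
    refine (norm_sum_le _ _).trans ?_
    have e : ∀ m ∈ Finset.range N, ‖w ^ m / (m.factorial : ℂ) *
        (ρ ^ m * A - ∑ k ∈ Finset.range N, a m k * σ ^ k)‖ ≤
        Real.exp ((1 + K₁ * S) * ‖w‖) * (K₃ * ‖σ‖ ^ N) := by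
      intro m hm
      rw [norm_mul, norm_div, norm_pow, Complex.norm_natCast]
      refine mul_le_mul ?_ (h m (Finset.mem_range.1 hm)) (norm_nonneg _) (Real.exp_pos _).le
      exact (Real.pow_div_factorial_le_exp _ (norm_nonneg w) m).trans hexp1
    refine (Finset.sum_le_sum e).trans_eq ?_
    rw [Finset.sum_const, Finset.card_range, nsmul_eq_mul]
    ring
  refine (norm_add_le_of_le h1 h2).trans_eq ?_
  ring

/-- The expansion of an integral along a path that leaves the origin, in powers of the scale
`e^{-τ}`. -/
theorem IsLogPath.exists_expansion (hμ : 2 ≤ μ) (hξ : IsLogPath μ c₀ c₁ c₂ c₃ ξ) (x₀ : ℂ) {lam : ℂ}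
    (hlam : 0 < lam.re) {ϑ : ℝ} (hϑ0 : 0 ≤ ϑ) (hϑ : ϑ < Real.pi / 2) {ρ A : ℝ → ℂ}
    (hρc : ContinuousOn ρ (Ioc 0 c₀)) (hAc : ContinuousOn A (Ioc 0 c₀)) {K₁ K₂ K₃ : ℝ}
    (hK₁ : 0 ≤ K₁) (hρ : ∀ s ∈ Ioc 0 c₀, ‖ρ s‖ ≤ K₁ * ‖exp (ξ s)‖)
    (hA : ∀ s ∈ Ioc 0 c₀, ‖A s‖ ≤ K₂) (hK₃ : 0 ≤ K₃) (N : ℕ) (a : ℕ → ℕ → ℂ)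
    (h : ∀ m < N, ∀ s ∈ Ioc 0 c₀, ‖ρ s ^ m * A s -
      ∑ k ∈ Finset.range N, a m k * exp (ξ s) ^ k‖ ≤ K₃ * ‖exp (ξ s)‖ ^ N) :
    ∃ K : ℝ, ∀ τ : ℂ, 0 ≤ τ.re → (∀ s ∈ Ioc 0 c₀, |μ * (ξ s + τ).im| ≤ ϑ) →
      IntegrableOn (fun s => faxenKernel μ x₀ lam (ξ s + τ) * exp (exp (ξ s + τ) * ρ s) * A s *
        deriv ξ s) (Ioc 0 c₀) ∧
      ‖(∫ s in Ioc 0 c₀, faxenKernel μ x₀ lam (ξ s + τ) * exp (exp (ξ s + τ) * ρ s) * A s *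
        deriv ξ s) - ∑ k ∈ Finset.range N, exp (-(k * τ)) * ∑ m ∈ Finset.range N,
          a m k / (m.factorial : ℂ) * kernelInt μ x₀ (lam + (k + m : ℕ))‖
        ≤ K * Real.exp (-(N * τ.re)) := by
  have hc₀ := hξ.c₀_pos
  have hc₂ := hξ.c₂_pos
  have hc₀m : c₀ ∈ Ioc 0 c₀ := ⟨hc₀, le_rfl⟩
  have hc₃ : 0 ≤ c₃ := by
    have := (norm_nonneg _).trans (hξ.deriv_le c₀ hc₀m)
    rwa [le_div_iff₀ hc₀, zero_mul] at this
  have hK₂ : 0 ≤ K₂ := (norm_nonneg _).trans (hA c₀ hc₀m)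
  have hcos : 0 < Real.cos ϑ := Real.cos_pos_of_mem_Ioo ⟨by linarith [Real.pi_pos], hϑ⟩
  set K₄ : ℝ := K₁ ^ N * N.factorial * K₂ + N * K₃ with hK₄
  have hK₄0 : 0 ≤ K₄ := by positivity
  set K₅ : ℝ := 1 + K₁ * (c₂ * c₀) with hK₅
  -- The factor `‖e^ξ‖^N` of the remainder equals `e^{N Re(ξ+τ)} e^{-N Re τ}`: the first factor
  -- raises the exponent `Re λ` to `Re λ + N`, the second is the order claimed. `K₅` is the growth
  -- rate in `‖w‖` of the pointwise remainder.
  obtain ⟨C, hC0, hC⟩ := hξ.exists_integral_bound hμ hcos (‖x₀‖ + K₅)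
    (b := lam.re + N) (by positivity)
  have hpos : ∀ k m : ℕ, 0 < (lam + (k + m : ℕ)).re := fun k m => by simp; positivity
  -- Decay rate `N` for the tails makes the end-point terms at `c₀` as small as the remainder.
  choose T hT using fun k m : ℕ =>
    exists_norm_kernelTail_le hμ x₀ (hpos k m) hϑ0 hϑ (Nat.cast_nonneg (α := ℝ) N)
  set M₀ : ℝ := Real.exp (|lam.im| * Real.pi) * c₃ * K₄ with hM₀
  set L : ℝ := ∑ k ∈ Finset.range N, ∑ m ∈ Finset.range N,
    ‖a m k / (m.factorial : ℂ)‖ * (T k m * Real.exp (-(N * (ξ c₀).re))) with hL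
  refine ⟨M₀ * C + L, fun τ hτ hstrip => ?_⟩
  set f : ℝ → ℂ := fun s => faxenKernel μ x₀ lam (ξ s + τ) * exp (exp (ξ s + τ) * ρ s) * A s *
        deriv ξ s with hf
  set e : ℕ → ℕ → ℝ → ℂ := fun k m s =>
    faxenKernel μ x₀ (lam + (k + m : ℕ)) (ξ s + τ) * deriv ξ s with he
  have hei := fun k m : ℕ => hξ.integral_faxenKernel hμ x₀ (hpos k m) hϑ τ hstrip
  set g : ℝ → ℂ := fun s => ∑ k ∈ Finset.range N, ∑ m ∈ Finset.range N,
    (exp (-(k * τ)) * (a m k / (m.factorial : ℂ))) * e k m s with hg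
  have hgi : IntegrableOn g (Ioc 0 c₀) :=
    integrable_finsetSum _ fun k _ => integrable_finsetSum _ fun m _ => (hei k m).1.const_mul _
  have hfm : AEStronglyMeasurable f (volume.restrict (Ioc 0 c₀)) := by
    refine AEStronglyMeasurable.mul ?_ (stronglyMeasurable_deriv ξ).aestronglyMeasurable
    refine ContinuousOn.aestronglyMeasurable ?_ measurableSet_Ioc
    have h1 := hξ.continuousOn.add_const τ
    refine (((continuous_faxenKernel μ x₀ lam).comp_continuousOn h1).mul ?_).mul hAc
    exact (h1.cexp.mul hρc).cexp
  have hfactor : ∀ s, f s - g s = faxenKernel μ x₀ lam (ξ s + τ) * deriv ξ s *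
      (exp (exp (ξ s + τ) * ρ s) * A s - ∑ k ∈ Finset.range N, ∑ m ∈ Finset.range N,
        a m k / (m.factorial : ℂ) * (exp (ξ s + τ) ^ m * exp (ξ s) ^ k)) := by
    intro s
    rw [mul_sub, Finset.mul_sum]
    congr 1
    · rw [hf]
      ring
    · rw [hg]
      refine Finset.sum_congr rfl fun k _ => ?_
      rw [Finset.mul_sum]
      refine Finset.sum_congr rfl fun m _ => ?_
      simp only [he]
      have : exp (((k + m : ℕ) : ℂ) * (ξ s + τ)) * exp (-(k * τ)) =
          exp (ξ s + τ) ^ m * exp (ξ s) ^ k := by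
        rw [← exp_nat_mul, ← exp_nat_mul, ← exp_add, ← exp_add]
        push_cast
        ring_nf
      rw [faxenKernel_add, ← this]
      ring
  have hrem := hC τ.re (M₀ * Real.exp (-(N * τ.re))) (fun s => f s - g s) (by positivity)
    (hfm.sub hgi.aestronglyMeasurable) (by
      intro s hs
      rw [hfactor, norm_mul, norm_mul]
      have hσS : ‖exp (ξ s)‖ ≤ c₂ * c₀ := by
        rw [norm_exp]
        exact (hξ.upper s hs).trans (mul_le_mul_of_nonneg_left hs.2 hc₂.le)
      have b1 := norm_faxenKernel_le hμ x₀ lam hϑ (hstrip s hs)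
      have b2 := hξ.deriv_le s hs
      have b3 := norm_exp_mul_mul_sub_sum_le (w := exp (ξ s + τ)) hK₁ hσS (hρ s hs) (hA s hs)
        fun m hm => h m hm s hs
      have hσ : ‖exp (ξ s)‖ ^ N = Real.exp (N * (ξ s + τ).re) * Real.exp (-(N * τ.re)) := by
        rw [norm_exp, ← Real.exp_nat_mul, ← Real.exp_add, add_re]
        ring_nf
      have hw : ‖exp (ξ s + τ)‖ = Real.exp (ξ s + τ).re := norm_exp _
      rw [hσ, hw] at b3
      have hs0 : 0 < s := hs.1
      calc _ ≤ _ := mul_le_mul (mul_le_mul b1 b2 (norm_nonneg _) (by positivity)) b3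
              (norm_nonneg _) (by positivity)
        _ = Real.exp (|lam.im| * Real.pi) * c₃ * K₄ * Real.exp (-(N * τ.re)) *
            (Real.exp (-Real.cos ϑ * Real.exp (μ * (ξ s + τ).re) + ‖x₀‖ * Real.exp (ξ s + τ).re +
              lam.re * (ξ s + τ).re) * Real.exp (N * (ξ s + τ).re) *
              Real.exp (K₅ * Real.exp (ξ s + τ).re)) * (1 / s) := by
            rw [← hK₄]
            ring
        _ = _ := by
            rw [← Real.exp_add, ← Real.exp_add, add_re, hM₀]
            ring_nf)
  have hfi : IntegrableOn f (Ioc 0 c₀) := by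
    exact (hrem.1.add hgi).congr (Eventually.of_forall fun s => by simp)
  refine ⟨hfi, ?_⟩
  have hgint : ∫ s in Ioc 0 c₀, g s = ∑ k ∈ Finset.range N, ∑ m ∈ Finset.range N,
      (exp (-(k * τ)) * (a m k / (m.factorial : ℂ))) *
        (kernelInt μ x₀ (lam + (k + m : ℕ)) - kernelTail μ x₀ (lam + (k + m : ℕ)) (ξ c₀ + τ)) := by
    rw [integral_finsetSum _ fun k _ => integrable_finsetSum _ fun m _ =>
      (hei k m).1.const_mul _]
    refine Finset.sum_congr rfl fun k _ => ?_
    rw [integral_finsetSum _ fun m _ => (hei k m).1.const_mul _]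
    refine Finset.sum_congr rfl fun m _ => ?_
    rw [integral_const_mul, (hei k m).2]
  have hsplit : (∫ s in Ioc 0 c₀, f s) - ∑ k ∈ Finset.range N, exp (-(k * τ)) *
      ∑ m ∈ Finset.range N, a m k / (m.factorial : ℂ) * kernelInt μ x₀ (lam + (k + m : ℕ)) =
      (∫ s in Ioc 0 c₀, (f s - g s)) - ∑ k ∈ Finset.range N, ∑ m ∈ Finset.range N,
      (exp (-(k * τ)) * (a m k / (m.factorial : ℂ))) *
        kernelTail μ x₀ (lam + (k + m : ℕ)) (ξ c₀ + τ) := by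
    rw [integral_sub hfi hgi, hgint]
    simp only [mul_sub, Finset.sum_sub_distrib, Finset.mul_sum, mul_assoc]
    ring
  rw [hsplit, add_mul]
  refine norm_sub_le_of_le (hrem.2.trans_eq (by ring)) ?_
  rw [hL, Finset.sum_mul]
  refine norm_sum_le_of_le _ fun k _ => ?_
  rw [Finset.sum_mul]
  refine norm_sum_le_of_le _ fun m _ => ?_
  rw [norm_mul, norm_mul]
  have t1 : ‖exp (-(k * τ))‖ ≤ 1 := by
    rw [norm_exp, Real.exp_le_one_iff]
    have : (-((k : ℂ) * τ)).re = -(k * τ.re) := by simp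
    rw [this]
    have : 0 ≤ (k : ℝ) * τ.re := by positivity
    linarith
  have t2 := hT k m (ξ c₀ + τ) (hstrip c₀ hc₀m)
  calc _ ≤ 1 * ‖a m k / (m.factorial : ℂ)‖ *
        (T k m * Real.exp (-(N * (ξ c₀ + τ).re))) := by gcongr
    _ = _ := by
      rw [add_re, mul_add, neg_add, Real.exp_add]
      ring

end FaxenExpansion

namespace FaxenExpansion

/-! ### Sums of power series -/

/-- Convergence at a single nonzero point gives a positive radius; one point of the contour
therefore suffices to make the three expansions at `a` analytic. -/
theorem hasFPowerSeriesAt_tsum {c : ℕ → ℂ} {u₁ : ℂ} (hu : u₁ ≠ 0)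
    (hs : Summable fun n => c n * u₁ ^ n) :
    HasFPowerSeriesAt (fun u => ∑' n, c n * u ^ n) (FormalMultilinearSeries.ofScalars ℂ c) 0 := by
  have hr : (‖u₁‖₊ : ENNReal) ≤ (FormalMultilinearSeries.ofScalars ℂ c).radius := by
    refine FormalMultilinearSeries.le_radius_of_tendsto _ (l := 0) ?_
    have h0 := hs.tendsto_atTop_zero.norm
    rw [norm_zero] at h0
    refine h0.congr fun n => ?_
    rw [FormalMultilinearSeries.ofScalars_norm, norm_mul, norm_pow, coe_nnnorm]
  have hpos : 0 < (FormalMultilinearSeries.ofScalars ℂ c).radius :=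
    lt_of_lt_of_le (by simpa using hu) hr
  have h := (FormalMultilinearSeries.hasFPowerSeriesOnBall _ hpos).hasFPowerSeriesAt
  convert h using 1
  funext u
  have := congrFun (FormalMultilinearSeries.ofScalarsSum_eq_tsum (𝕜 := ℂ) (E := ℂ) (c := c)) u
  simpa [FormalMultilinearSeries.ofScalarsSum] using this.symm

theorem hasTaylor_tsum {c : ℕ → ℂ} {u₁ : ℂ} (hu : u₁ ≠ 0) (hs : Summable fun n => c n * u₁ ^ n) :
    HasTaylor (𝓝 0) id (fun u => ∑' n, c n * u ^ n) (PowerSeries.mk c) := by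
  have h := hasTaylor_of_hasFPowerSeriesAt (hasFPowerSeriesAt_tsum hu hs)
  have e : (FormalMultilinearSeries.ofScalars ℂ c).coeff = c := by
    funext n
    simp
  rwa [e] at h

theorem hasTaylor_deriv_tsum {c : ℕ → ℂ} {u₁ : ℂ} (hu : u₁ ≠ 0)
    (hs : Summable fun n => c n * u₁ ^ n) :
    HasTaylor (𝓝 0) id (deriv fun u => ∑' n, c n * u ^ n)
      (PowerSeries.derivative ℂ (PowerSeries.mk c)) := by
  have hF := hasFPowerSeriesAt_tsum hu hs
  have h1 := hF.eq_formalMultilinearSeries hF.analyticAt.hasFPowerSeriesAt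
  have h2 := hasTaylor_of_hasFPowerSeriesAt hF.analyticAt.deriv.hasFPowerSeriesAt
  convert h2 using 1
  ext n
  have h3 := congrArg (fun p => FormalMultilinearSeries.coeff p (n + 1)) h1
  simp only [FormalMultilinearSeries.coeff_ofScalars] at h3
  rw [PowerSeries.coeff_derivative, PowerSeries.coeff_mk, PowerSeries.coeff_mk,
    FormalMultilinearSeries.coeff_ofScalars, h3, iteratedDeriv_succ', Nat.factorial_succ]
  have : ((n : ℂ) + 1) ≠ 0 := Nat.cast_add_one_ne_zero n
  push_cast
  field_simp

/-! ### Powers of a convergent power series -/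

section

open PowerSeries

variable {V : PowerSeries ℂ} {fV : ℂ → ℂ}

theorem constantCoeff_seriesPow (V : PowerSeries ℂ) (s : ℂ) : constantCoeff (seriesPow V s) = 1 := by
  rw [← coeff_zero_eq_constantCoeff_apply, seriesPow, coeff_mk]
  simp

theorem hasTaylor_id_unique {f : ℂ → ℂ} {S T : PowerSeries ℂ} (hS : HasTaylor (𝓝 0) id f S)
    (hT : HasTaylor (𝓝 0) id f T) : S = T := by
  have hle : Tendsto (id : ℂ → ℂ) (𝓝[≠] 0) (𝓝 0) := tendsto_id.mono_left nhdsWithin_le_nhds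
  exact HasTaylor.unique (l := 𝓝[≠] (0 : ℂ)) hle self_mem_nhdsWithin (hS.comp hle) (hT.comp hle)

/-- Both sides expand the same function near `0`, by the addition law of complex powers. The same
transfer gives the exponents `0` and `1`. -/
theorem seriesPow_mul_seriesPow (hV : constantCoeff V = 1) (hf : HasTaylor (𝓝 0) id fV V) (s t : ℂ) :
    seriesPow V s * seriesPow V t = seriesPow V (s + t) := by
  refine hasTaylor_id_unique ((hasTaylor_cpow tendsto_id hf hV s).mul tendsto_id
    (hasTaylor_cpow tendsto_id hf hV t)) ((hasTaylor_cpow tendsto_id hf hV (s + t)).congr ?_)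
  have h1 := hf.tendsto tendsto_id
  rw [hV] at h1
  filter_upwards [h1.eventually_ne one_ne_zero] with u hu using cpow_add _ _ hu

theorem seriesPow_zero (hV : constantCoeff V = 1) (hf : HasTaylor (𝓝 0) id fV V) :
    seriesPow V 0 = 1 := by
  refine hasTaylor_id_unique (hasTaylor_cpow tendsto_id hf hV 0) ?_
  simpa using hasTaylor_const (l := 𝓝 (0 : ℂ)) tendsto_id 1

theorem seriesPow_one (hV : constantCoeff V = 1) (hf : HasTaylor (𝓝 0) id fV V) :
    seriesPow V 1 = V := by
  refine hasTaylor_id_unique (hasTaylor_cpow tendsto_id hf hV 1) ?_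
  simpa using hf

theorem seriesPow_pow (hV : constantCoeff V = 1) (hf : HasTaylor (𝓝 0) id fV V) (s : ℂ) (n : ℕ) :
    seriesPow V s ^ n = seriesPow V (n * s) := by
  induction n with
  | zero => simp [seriesPow_zero hV hf]
  | succ n ih =>
    rw [pow_succ, ih, seriesPow_mul_seriesPow hV hf]
    push_cast
    ring_nf

theorem seriesPow_inv (hV : constantCoeff V = 1) (hf : HasTaylor (𝓝 0) id fV V) (s : ℂ) :
    (seriesPow V s)⁻¹ = seriesPow V (-s) := by
  rw [PowerSeries.inv_eq_iff_mul_eq_one (by rw [constantCoeff_seriesPow]; exact one_ne_zero),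
    seriesPow_mul_seriesPow hV hf, neg_add_cancel, seriesPow_zero hV hf]

/-- The series of `μ V + u V'`, that is, of `u^(1-μ)` times the derivative of `u^μ V`. -/
noncomputable def eulerSeries (μ : ℕ) (V : PowerSeries ℂ) : PowerSeries ℂ :=
  C (μ : ℂ) * V + X * d⁄dX ℂ V

theorem constantCoeff_eulerSeries (μ : ℕ) (hV : constantCoeff V = 1) :
    constantCoeff (eulerSeries μ V) = μ := by
  simp [eulerSeries, hV]

/-- With `W = V^(1/μ)`, differentiating `W^μ = V` gives `V' W = μ V W'`. This computes `dv/du` for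
the coordinate `v = u W` in terms of the derivative of `u^μ V`. -/
theorem C_mul_derivative_X_mul_seriesPow {μ : ℕ} (hμ : μ ≠ 0) (hV : constantCoeff V = 1)
    (hf : HasTaylor (𝓝 0) id fV V) :
    C (μ : ℂ) * V * d⁄dX ℂ (X * seriesPow V (1 / μ)) =
      seriesPow V (1 / μ) * eulerSeries μ V := by
  set W := seriesPow V (1 / μ) with hW
  have hμ' : (μ : ℂ) ≠ 0 := Nat.cast_ne_zero.2 hμ
  have hWV : W ^ μ = V := by
    rw [hW, seriesPow_pow hV hf, mul_one_div_cancel hμ', seriesPow_one hV hf]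
  have hd : d⁄dX ℂ V * W = C (μ : ℂ) * V * d⁄dX ℂ W := by
    obtain ⟨k, rfl⟩ := Nat.exists_eq_succ_of_ne_zero hμ
    conv_lhs => rw [← hWV]
    conv_rhs => rw [← hWV]
    rw [Derivation.leibniz_pow, nsmul_eq_mul, smul_eq_mul, Nat.succ_eq_add_one,
      Nat.add_sub_cancel, map_natCast]
    ring
  rw [Derivation.leibniz, PowerSeries.derivative_X, smul_eq_mul, smul_eq_mul, eulerSeries]
  linear_combination -(X : PowerSeries ℂ) * hd

/-- The amplitude is `q dt / (v^(λ-1) dv)`, so in its residue against `v^(-n-1) dv` the derivative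
of the coordinate cancels, and only `q` times a power of `V` is left. -/
theorem residueCoeff_amplitude {μ : ℕ} (hμ : μ ≠ 0) (hV : constantCoeff V = 1)
    (hf : HasTaylor (𝓝 0) id fV V) (Q : PowerSeries ℂ) (lam : ℂ) (n : ℕ) :
    residueCoeff (seriesPow V (1 / μ))
      (C (μ : ℂ) * (Q * seriesPow V (1 - lam / μ) * (eulerSeries μ V)⁻¹)) n =
      coeff n (Q * seriesPow V (-((n + lam) / μ))) := by
  have hE : constantCoeff (eulerSeries μ V) ≠ 0 := by
    rw [constantCoeff_eulerSeries μ hV]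
    exact Nat.cast_ne_zero.2 hμ
  have hW : constantCoeff (seriesPow V (1 / μ)) = 1 := constantCoeff_seriesPow _ _
  unfold residueCoeff
  congr 1
  have h1 := C_mul_derivative_X_mul_seriesPow hμ hV hf
  have h2 : seriesPow V (1 - lam / μ) = V * seriesPow V (-(lam / μ)) := by
    conv_rhs => rw [← seriesPow_one hV hf]
    rw [seriesPow_one hV hf]
    nth_rewrite 2 [← seriesPow_one hV hf]
    rw [seriesPow_mul_seriesPow hV hf, sub_eq_add_neg]
  set W := seriesPow V (1 / μ) with hWdef
  calc C (μ : ℂ) * (Q * seriesPow V (1 - lam / μ) * (eulerSeries μ V)⁻¹) * d⁄dX ℂ (X * W) *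
        W⁻¹ ^ (n + 1)
      = Q * seriesPow V (-(lam / μ)) * (eulerSeries μ V)⁻¹ * (C (μ : ℂ) * V * d⁄dX ℂ (X * W)) *
        W⁻¹ ^ (n + 1) := by rw [h2]; ring
    _ = Q * seriesPow V (-(lam / μ)) * (eulerSeries μ V * (eulerSeries μ V)⁻¹) * (W⁻¹ * W) *
        W⁻¹ ^ n := by rw [h1]; ring
    _ = Q * (seriesPow V (-(lam / μ)) * seriesPow V (n * -(1 / μ))) := by
        rw [PowerSeries.mul_inv_cancel _ hE, inv_mul_of_constantCoeff_one hW,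
          hWdef, seriesPow_inv hV hf, seriesPow_pow hV hf]
        ring
    _ = _ := by
        rw [seriesPow_mul_seriesPow hV hf]
        ring_nf

/-- In the phase nothing cancels `dv`; it contributes `v^(1-μ) p' dt / μ`, which is where `p'` and
the extra `1` in the exponent of `c_n` come from. -/
theorem residueCoeff_phase {μ : ℕ} (hμ : μ ≠ 0) (hV : constantCoeff V = 1)
    (hf : HasTaylor (𝓝 0) id fV V) (R : PowerSeries ℂ) (n : ℕ) :
    residueCoeff (seriesPow V (1 / μ)) (R * seriesPow V (-(1 / μ))) n =
      1 / (μ : ℂ) * coeff n (eulerSeries μ V * R * seriesPow V (-((n + 1) / μ + 1))) := by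
  have hμ' : (μ : ℂ) ≠ 0 := Nat.cast_ne_zero.2 hμ
  have hW : constantCoeff (seriesPow V (1 / μ)) = 1 := constantCoeff_seriesPow _ _
  have h1 := C_mul_derivative_X_mul_seriesPow hμ hV hf
  have hV1 : V * seriesPow V (-1) = 1 := by
    nth_rewrite 1 [← seriesPow_one hV hf]
    rw [seriesPow_mul_seriesPow hV hf, add_neg_cancel, seriesPow_zero hV hf]
  unfold residueCoeff
  rw [← mul_right_inj' hμ', ← mul_assoc, mul_one_div_cancel hμ', one_mul, ← coeff_C_mul]
  congr 1
  set W := seriesPow V (1 / μ) with hWdef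
  calc C (μ : ℂ) * (R * seriesPow V (-(1 / μ)) * d⁄dX ℂ (X * W) * W⁻¹ ^ (n + 1))
      = C (μ : ℂ) * (V * seriesPow V (-1)) * (R * seriesPow V (-(1 / μ)) * d⁄dX ℂ (X * W) *
        W⁻¹ ^ (n + 1)) := by rw [hV1, mul_one]
    _ = seriesPow V (-1) * R * seriesPow V (-(1 / μ)) * (C (μ : ℂ) * V * d⁄dX ℂ (X * W)) *
        W⁻¹ ^ (n + 1) := by ring
    _ = eulerSeries μ V * R * (seriesPow V (-1) * seriesPow V (-(1 / μ)) * W⁻¹ ^ n) *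
        (W⁻¹ * W) := by rw [h1]; ring
    _ = _ := by
        rw [inv_mul_of_constantCoeff_one hW, mul_one, hWdef, seriesPow_inv hV hf,
          seriesPow_pow hV hf, seriesPow_mul_seriesPow hV hf, seriesPow_mul_seriesPow hV hf]
        ring_nf

end

/-! ### Expansions in the local coordinate -/

section Coordinate

variable {pc qc rc : ℕ → ℂ} {fV fQ fR : ℂ → ℂ} {μ : ℕ} {ϖ₀ : ℝ} {lam : ℂ}

/-- `μ⁻¹` times the logarithm of `p₀`, in the branch given by `ϖ₀`. -/
noncomputable def logLead (pc : ℕ → ℂ) (μ : ℕ) (ϖ₀ : ℝ) : ℂ :=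
  ((Real.log ‖pc 0‖ : ℂ) + (ϖ₀ : ℂ) * I) / μ

theorem polarPow_eq_exp_logLead (hμ : μ ≠ 0) (s : ℂ) :
    polarPow ‖pc 0‖ ϖ₀ s = exp (s * μ * logLead pc μ ϖ₀) := by
  have hμ' : (μ : ℂ) ≠ 0 := Nat.cast_ne_zero.2 hμ
  unfold polarPow logLead
  congr 1
  field_simp

theorem exp_mul_logLead (hμ : μ ≠ 0) (hp : pc 0 ≠ 0) (h₀ : pc 0 = ‖pc 0‖ * exp ((ϖ₀ : ℂ) * I)) :
    exp (μ * logLead pc μ ϖ₀) = pc 0 := by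
  have hμ' : (μ : ℂ) ≠ 0 := Nat.cast_ne_zero.2 hμ
  rw [logLead, mul_div_cancel₀ _ hμ', exp_add, ← ofReal_exp, Real.exp_log (norm_pos_iff.2 hp)]
  exact h₀.symm

theorem constantCoeff_normalizedP (hp : pc 0 ≠ 0) :
    PowerSeries.constantCoeff (normalizedP pc) = 1 := by
  rw [← PowerSeries.coeff_zero_eq_constantCoeff_apply, normalizedP, PowerSeries.coeff_mk,
    div_self hp]

theorem mk_add_mul_eq_eulerSeries (hp : pc 0 ≠ 0) :
    PowerSeries.mk (fun k => ((k : ℂ) + μ) * pc k) =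
      PowerSeries.C (pc 0) * eulerSeries μ (normalizedP pc) := by
  ext n
  rw [PowerSeries.coeff_C_mul, eulerSeries, map_add, PowerSeries.coeff_C_mul, PowerSeries.coeff_mk]
  rcases n with _ | n
  · simp [normalizedP]
    field_simp
  · rw [PowerSeries.coeff_succ_X_mul, PowerSeries.coeff_derivative, normalizedP,
      PowerSeries.coeff_mk]
    push_cast
    field_simp
    ring

/-- The local coordinate `(p(t) - p(a))^(1/μ)`, as a function of `u = t - a`. -/
noncomputable def coordinate (pc : ℕ → ℂ) (fV : ℂ → ℂ) (μ : ℕ) (ϖ₀ : ℝ) (u : ℂ) : ℂ :=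
  exp (logLead pc μ ϖ₀) * (u * fV u ^ (1 / (μ : ℂ)))

/-- The formal theory is normalized to `u W` with `W(0) = 1`; the leading factor `p₀^(1/μ)` is
restored by rescaling. -/
theorem hasTaylor_coordinate_of_residueCoeff (hp : pc 0 ≠ 0)
    (hV : HasTaylor (𝓝 0) id fV (normalizedP pc)) {f : ℂ → ℂ} {A : PowerSeries ℂ}
    (hf : HasTaylor (𝓝 0) id f A) :
    HasTaylor (𝓝 0) (coordinate pc fV μ ϖ₀) f (PowerSeries.mk fun n =>
      residueCoeff (seriesPow (normalizedP pc) (1 / μ)) A n * (exp (logLead pc μ ϖ₀))⁻¹ ^ n) := by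
  have hV0 := constantCoeff_normalizedP hp
  have hW := hasTaylor_cpow tendsto_id hV hV0 (1 / (μ : ℂ))
  have hφ : HasTaylor (𝓝 0) id (fun u => u * fV u ^ (1 / (μ : ℂ)))
      (PowerSeries.X * seriesPow (normalizedP pc) (1 / μ)) :=
    (hasTaylor_self tendsto_id).mul tendsto_id hW
  have hW1 := hW.tendsto tendsto_id
  rw [constantCoeff_seriesPow] at hW1
  have hO : (id : ℂ → ℂ) =O[𝓝 0] fun u => u * fV u ^ (1 / (μ : ℂ)) := by
    have h1 : (fun u => (fV u ^ (1 / (μ : ℂ)))⁻¹) =O[𝓝 0] fun _ => (1 : ℂ) :=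
      (hW1.inv₀ one_ne_zero).isBigO_one ℂ
    have h2 := (Asymptotics.isBigO_refl (fun u => u * fV u ^ (1 / (μ : ℂ))) (𝓝 0)).mul h1
    refine h2.congr' ?_ (by simp)
    filter_upwards [hW1.eventually_ne one_ne_zero] with u hu
    simp only [id]
    rw [mul_assoc, mul_inv_cancel₀ hu, mul_one]
  have h := hf.change (constantCoeff_seriesPow _ _) tendsto_id hφ hO
  have hφ0 := hφ.tendsto tendsto_id
  have h3 := h.scale (by simpa using hφ0) (exp_ne_zero (logLead pc μ ϖ₀))
  simp only [PowerSeries.coeff_mk] at h3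
  exact h3

theorem tendsto_coordinate (hp : pc 0 ≠ 0) (hV : HasTaylor (𝓝 0) id fV (normalizedP pc)) :
    Tendsto (coordinate pc fV μ ϖ₀) (𝓝 0) (𝓝 0) := by
  have hW := hasTaylor_cpow tendsto_id hV (constantCoeff_normalizedP hp) (1 / (μ : ℂ))
  have h := (((hasTaylor_self tendsto_id).mul tendsto_id hW).const_mul
    tendsto_id (exp (logLead pc μ ϖ₀))).tendsto tendsto_id
  simp only [map_mul, PowerSeries.constantCoeff_X, zero_mul, mul_zero] at h
  exact h

theorem hasTaylor_euler (hV : HasTaylor (𝓝 0) id fV (normalizedP pc))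
    (hV' : HasTaylor (𝓝 0) id (deriv fV) (PowerSeries.derivative ℂ (normalizedP pc))) (μ : ℕ) :
    HasTaylor (𝓝 0) id (fun u => μ * fV u + u * deriv fV u) (eulerSeries μ (normalizedP pc)) :=
  (hV.const_mul tendsto_id (μ : ℂ)).add ((hasTaylor_self tendsto_id).mul tendsto_id hV')

/-- The amplitude in the local coordinate `v`: `q(t) dt = v^(λ-1) amplitude dv`. -/
noncomputable def amplitude (pc : ℕ → ℂ) (fV fQ : ℂ → ℂ) (μ : ℕ) (lam : ℂ) (ϖ₀ : ℝ) (u : ℂ) : ℂ :=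
  exp (-(lam * logLead pc μ ϖ₀)) *
    (μ * (fQ u * fV u ^ (1 - lam / μ) * (μ * fV u + u * deriv fV u)⁻¹))

theorem hasTaylor_amplitude (hμ : μ ≠ 0) (hp : pc 0 ≠ 0)
    (hV : HasTaylor (𝓝 0) id fV (normalizedP pc))
    (hV' : HasTaylor (𝓝 0) id (deriv fV) (PowerSeries.derivative ℂ (normalizedP pc)))
    (hQ : HasTaylor (𝓝 0) id fQ (PowerSeries.mk qc)) :
    HasTaylor (𝓝 0) (coordinate pc fV μ ϖ₀) (amplitude pc fV fQ μ lam ϖ₀)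
      (PowerSeries.mk fun n => μ * bCoeff pc qc μ lam ϖ₀ n) := by
  have hμ' : (μ : ℂ) ≠ 0 := Nat.cast_ne_zero.2 hμ
  have hV0 := constantCoeff_normalizedP hp
  have hE0 : PowerSeries.constantCoeff (eulerSeries μ (normalizedP pc)) ≠ 0 := by
    rwa [constantCoeff_eulerSeries μ hV0]
  have h1 := ((hQ.mul tendsto_id (hasTaylor_cpow tendsto_id hV hV0 (1 - lam / μ))).mul tendsto_id
    ((hasTaylor_euler hV hV' μ).inv tendsto_id hE0)).const_mul tendsto_id (μ : ℂ)
  have h2 := hasTaylor_coordinate_of_residueCoeff (μ := μ) (ϖ₀ := ϖ₀) hp hV h1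
  have hc : Tendsto (coordinate pc fV μ ϖ₀) (𝓝 0) (𝓝 0) :=
    tendsto_coordinate hp hV
  have h3 : HasTaylor (𝓝 0) _ (amplitude pc fV fQ μ lam ϖ₀) _ :=
    h2.const_mul hc (exp (-(lam * logLead pc μ ϖ₀)))
  convert h3 using 1
  ext n
  rw [PowerSeries.coeff_C_mul, PowerSeries.coeff_mk, PowerSeries.coeff_mk,
    residueCoeff_amplitude hμ hV0 hV, bCoeff, polarPow_eq_exp_logLead hμ, ← exp_neg, ← exp_nat_mul]
  have : exp (-((n + lam) / μ) * μ * logLead pc μ ϖ₀) =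
      exp (-(lam * logLead pc μ ϖ₀)) * exp (n * -logLead pc μ ϖ₀) := by
    rw [← exp_add]
    congr 1
    field_simp
    ring
  rw [this]
  field_simp

/-- The quotient of `r(t)` by the local coordinate, without its value at the end point. -/
noncomputable def phase (pc rc : ℕ → ℂ) (fV fR : ℂ → ℂ) (μ : ℕ) (ϖ₀ : ℝ) (u : ℂ) : ℂ :=
  (exp (logLead pc μ ϖ₀))⁻¹ * (fR u * fV u ^ (-(1 / (μ : ℂ)))) - faxenArg pc rc μ ϖ₀

theorem hasTaylor_phase (hμ : μ ≠ 0) (hp : pc 0 ≠ 0)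
    (h₀ : pc 0 = ‖pc 0‖ * exp ((ϖ₀ : ℂ) * I))
    (hV : HasTaylor (𝓝 0) id fV (normalizedP pc))
    (hR : HasTaylor (𝓝 0) id fR (PowerSeries.mk rc)) :
    HasTaylor (𝓝 0) (coordinate pc fV μ ϖ₀) (phase pc rc fV fR μ ϖ₀)
      (PowerSeries.mk fun n => if n = 0 then 0 else cCoeff pc rc μ ϖ₀ n) := by
  have hμ' : (μ : ℂ) ≠ 0 := Nat.cast_ne_zero.2 hμ
  have hV0 := constantCoeff_normalizedP hp
  have h1 := hR.mul tendsto_id (hasTaylor_cpow tendsto_id hV hV0 (-(1 / (μ : ℂ))))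
  have h2 := hasTaylor_coordinate_of_residueCoeff (μ := μ) (ϖ₀ := ϖ₀) hp hV h1
  have hc : Tendsto (coordinate pc fV μ ϖ₀) (𝓝 0) (𝓝 0) :=
    tendsto_coordinate hp hV
  have h3 : HasTaylor (𝓝 0) _ (phase pc rc fV fR μ ϖ₀) _ :=
    (h2.const_mul hc (exp (logLead pc μ ϖ₀))⁻¹).sub (hasTaylor_const hc (faxenArg pc rc μ ϖ₀))
  convert h3 using 1
  ext n
  rw [map_sub, PowerSeries.coeff_C_mul, PowerSeries.coeff_mk, PowerSeries.coeff_mk,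
    residueCoeff_phase hμ hV0 hV, PowerSeries.coeff_C]
  split_ifs with hn
  -- The constant term of `r / v` is `r₀ / p₀^(1/μ)`, exactly the value `faxenArg` subtracted in
  -- `phase`.
  · subst hn
    rw [PowerSeries.coeff_zero_eq_constantCoeff_apply, map_mul, map_mul,
      constantCoeff_eulerSeries μ hV0, constantCoeff_seriesPow, faxenArg,
      polarPow_eq_exp_logLead hμ, one_div_mul_cancel hμ']
    simp
    field_simp
    simp
  · rw [cCoeff, if_neg hn, mk_add_mul_eq_eulerSeries hp, polarPow_eq_exp_logLead hμ, ← exp_neg,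
      ← exp_nat_mul, mul_assoc (PowerSeries.C (pc 0)), mul_assoc (PowerSeries.C (pc 0)),
      PowerSeries.coeff_C_mul]
    have : exp (-((n + 1) / μ + 1) * μ * logLead pc μ ϖ₀) * pc 0 =
        exp (-logLead pc μ ϖ₀) * exp (n * -logLead pc μ ϖ₀) := by
      have hl := exp_mul_logLead hμ hp h₀
      rw [← exp_add]
      refine (congrArg (exp _ * ·) hl.symm).trans ?_
      rw [← exp_add]
      congr 1
      field_simp
      ring
    linear_combination (1 / (μ : ℂ)) * (PowerSeries.coeff n (eulerSeries μ (normalizedP pc) *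
      PowerSeries.mk rc * seriesPow (normalizedP pc) (-((n + 1) / μ + 1)))) * this

end Coordinate

end FaxenExpansion

namespace FaxenExpansion

/-! ### The contour near its starting point -/

section Contour

variable {γ : ℝ → ℂ} {a : ℂ} {b : OnePoint ℂ}

theorem IsContour.exists_breakpoints (hγ : IsContour γ a b) : ∃ τ : ℕ → ℝ, StrictMono τ ∧
    τ 0 = 0 ∧ Tendsto τ atTop (𝓝 1) ∧ (∀ k, τ k < 1) ∧
    ∀ k, ContDiffOn ℝ 1 γ (Icc (τ k) (τ (k + 1))) := by
  obtain ⟨τ, hτ, h0, h1, hc⟩ := hγ.piecewise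
  exact ⟨τ, hτ, h0, h1, fun k => (hτ (Nat.lt_succ_self k)).trans_le
    (hτ.monotone.ge_of_tendsto h1 _), hc⟩

theorem IsContour.differentiableAt (hγ : IsContour γ a b) :
    ∀ᶠ s in 𝓝[>] (0 : ℝ), DifferentiableAt ℝ γ s := by
  obtain ⟨τ, hτ, h0, -, -, hc⟩ := hγ.exists_breakpoints
  have h01 : 0 < τ 1 := h0 ▸ hτ one_pos
  filter_upwards [Ioo_mem_nhdsGT h01] with s hs
  have := (hc 0).differentiableOn one_ne_zero
  rw [h0, zero_add] at this
  exact this.differentiableAt (Icc_mem_nhds hs.1 hs.2)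

theorem IsContour.hasDerivWithinAt (hγ : IsContour γ a b) :
    HasDerivWithinAt γ (derivWithin γ (Ici 0) 0) (Ici 0) 0 :=
  (differentiableWithinAt_of_derivWithin_ne_zero hγ.regular_start).hasDerivWithinAt

theorem IsContour.tendsto_deriv (hγ : IsContour γ a b) :
    Tendsto (deriv γ) (𝓝[>] 0) (𝓝 (derivWithin γ (Ici 0) 0)) := by
  obtain ⟨τ, hτ, h0, -, -, hc⟩ := hγ.exists_breakpoints
  have h01 : 0 < τ 1 := h0 ▸ hτ one_pos
  have hc0 := hc 0
  rw [h0, zero_add] at hc0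
  have hu : UniqueDiffOn ℝ (Icc 0 (τ 1)) := uniqueDiffOn_Icc h01
  have hcont := hc0.continuousOn_derivWithin hu le_rfl
  have h0m : (0 : ℝ) ∈ Icc 0 (τ 1) := ⟨le_rfl, h01.le⟩
  have hval : derivWithin γ (Icc 0 (τ 1)) 0 = derivWithin γ (Ici 0) 0 :=
    (hγ.hasDerivWithinAt.mono fun s hs => hs.1).derivWithin (hu 0 h0m)
  have h1 := (hcont 0 h0m).tendsto
  rw [hval] at h1
  have hle : 𝓝[>] (0 : ℝ) ≤ 𝓝[Icc 0 (τ 1)] 0 := by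
    rw [← nhdsWithin_Ioo_eq_nhdsGT h01]
    exact nhdsWithin_mono _ Ioo_subset_Icc_self
  refine (h1.mono_left hle).congr' ?_
  filter_upwards [Ioo_mem_nhdsGT h01] with s hs
  exact derivWithin_of_mem_nhds (Icc_mem_nhds hs.1 hs.2)

theorem IsContour.tendsto_div (hγ : IsContour γ a b) :
    Tendsto (fun s : ℝ => (γ s - a) / s) (𝓝[>] 0) (𝓝 (derivWithin γ (Ici 0) 0)) := by
  have h := hasDerivWithinAt_iff_tendsto_slope.1 hγ.hasDerivWithinAt
  have e : Ici (0 : ℝ) \ {0} = Ioi 0 := by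
    ext s
    simp [lt_iff_le_and_ne, eq_comm]
  rw [e] at h
  refine h.congr fun s => ?_
  rw [slope, hγ.start, vsub_eq_sub, sub_zero, real_smul, ofReal_inv, div_eq_inv_mul]

theorem IsContour.tendsto_sub (hγ : IsContour γ a b) :
    Tendsto (fun s : ℝ => γ s - a) (𝓝[>] 0) (𝓝 0) := by
  have h : Tendsto γ (𝓝[>] 0) (𝓝 (γ 0)) :=
    hγ.hasDerivWithinAt.continuousWithinAt.tendsto.mono_left
      (nhdsWithin_mono _ Ioi_subset_Ici_self)
  rw [hγ.start] at h
  simpa using h.sub_const a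

theorem IsContour.eventually_ne (hγ : IsContour γ a b) : ∀ᶠ s in 𝓝[>] (0 : ℝ), γ s - a ≠ 0 := by
  filter_upwards [hγ.tendsto_div.eventually_ne hγ.regular_start] with s hs h0
  exact hs (by rw [h0, zero_div])

theorem IsContour.continuousOn (hγ : IsContour γ a b) : ContinuousOn γ (Ioo 0 1) := by
  obtain ⟨τ, hτ, h0, h1, -, hc⟩ := hγ.exists_breakpoints
  have hcov : ∀ k, ContinuousOn γ (Icc 0 (τ k)) := by
    intro k
    induction k with
    | zero => simp [h0]
    | succ k ih =>
      have hk : 0 ≤ τ k := h0 ▸ hτ.monotone (Nat.zero_le k)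
      rw [← Icc_union_Icc_eq_Icc hk (hτ (Nat.lt_succ_self k)).le]
      exact ih.union_of_isClosed (hc k).continuousOn isClosed_Icc isClosed_Icc
  intro s hs
  obtain ⟨k, hk⟩ := (h1.eventually (lt_mem_nhds hs.2)).exists
  exact ((hcov k).continuousAt (Icc_mem_nhds hs.1 hk)).continuousWithinAt

theorem IsContour.integrableOn_deriv (hγ : IsContour γ a b) {c : ℝ} (hc1 : c < 1) :
    IntegrableOn (deriv γ) (Icc 0 c) := by
  obtain ⟨τ, hτ, h0, h1, -, hc⟩ := hγ.exists_breakpoints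
  have hcov : ∀ k, IntegrableOn (deriv γ) (Icc 0 (τ k)) := by
    intro k
    induction k with
    | zero => simp [h0]
    | succ k ih =>
      have hk : 0 ≤ τ k := h0 ▸ hτ.monotone (Nat.zero_le k)
      have hlt := hτ (Nat.lt_succ_self k)
      rw [← Icc_union_Icc_eq_Icc hk hlt.le]
      refine ih.union ?_
      have h2 := ((hc k).continuousOn_derivWithin (uniqueDiffOn_Icc hlt) le_rfl).integrableOn_Icc
        (μ := volume)
      rw [integrableOn_Icc_iff_integrableOn_Ioo] at h2 ⊢
      exact h2.congr_fun (fun s hs => derivWithin_of_mem_nhds (Icc_mem_nhds hs.1 hs.2))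
        measurableSet_Ioo
  obtain ⟨k, hk⟩ := (h1.eventually (lt_mem_nhds hc1)).exists
  exact (hcov k).mono_set (Icc_subset_Icc_right hk.le)

end Contour

/-! ### The branch of the logarithm along the contour -/

/-- The logarithm with imaginary part in `(ϖ - π, ϖ + π]`. -/
noncomputable def contourLog (ϖ : ℝ) (u : ℂ) : ℂ :=
  log (u * exp (-(ϖ : ℂ) * I)) + ϖ * I

theorem exp_contourLog (ϖ : ℝ) {u : ℂ} (hu : u ≠ 0) : exp (contourLog ϖ u) = u := by
  rw [contourLog, exp_add, exp_log (mul_ne_zero hu (exp_ne_zero _)), mul_assoc, ← exp_add]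
  simp

theorem polarPow_argNear (ϖ : ℝ) (u s : ℂ) :
    polarPow ‖u‖ (argNear ϖ u) s = exp (s * contourLog ϖ u) := by
  have h : ‖u * exp (-(ϖ : ℂ) * I)‖ = ‖u‖ := by
    rw [norm_mul, ← ofReal_neg, norm_exp_ofReal_mul_I, mul_one]
  rw [polarPow, argNear, contourLog, Complex.log, h]
  push_cast
  ring_nf

theorem contourLog_im (ϖ : ℝ) (u : ℂ) :
    (contourLog ϖ u).im = arg (u * exp (-(ϖ : ℂ) * I)) + ϖ := by
  simp [contourLog, Complex.log_im]

theorem hasDerivAt_contourLog (ϖ : ℝ) {u : ℂ} (h : u * exp (-(ϖ : ℂ) * I) ∈ slitPlane) :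
    HasDerivAt (contourLog ϖ) u⁻¹ u := by
  have hu : u ≠ 0 := left_ne_zero_of_mul (slitPlane_ne_zero h)
  have h1 := (((hasDerivAt_id u).mul_const (exp (-(ϖ : ℂ) * I))).clog h).add_const (ϖ * I : ℂ)
  refine h1.congr_deriv ?_
  have := exp_ne_zero (-(ϖ : ℂ) * I)
  simp only [id]
  field_simp

section Local

variable {p q r : ℂ → ℂ} {T : Set ℂ} {a : ℂ} {b : OnePoint ℂ} {γ : ℝ → ℂ} {pc qc rc : ℕ → ℂ}
  {μ : ℕ} {lam : ℂ} {ϖ θ₁ θ₂ Z ϖ₀ : ℝ}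

/-- Rotation by `-ϖ` moves the limiting direction to `1`, where the principal argument is
continuous, whatever the real number `ϖ` is. -/
theorem Conditions.tendsto_direction
    (h : Conditions p q r T a b γ pc qc rc μ lam ϖ θ₁ θ₂ Z) :
    Tendsto (fun s => ((γ s - a) * exp (-(ϖ : ℂ) * I)) / (‖γ s - a‖ : ℂ)) (𝓝[>] 0) (𝓝 1) := by
  have h1 := h.slope.mul_const (exp (-(ϖ : ℂ) * I))
  rw [← exp_add] at h1
  simp only [neg_mul, add_neg_cancel, exp_zero] at h1
  refine h1.congr fun s => ?_
  rw [neg_mul]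
  ring

theorem arg_div_norm {u : ℂ} (hu : u ≠ 0) (v : ℂ) : arg (v / (‖u‖ : ℂ)) = arg v := by
  rw [div_eq_mul_inv, ← ofReal_inv, arg_mul_real (inv_pos.2 (norm_pos_iff.2 hu))]

theorem Conditions.eventually_mem_slitPlane
    (h : Conditions p q r T a b γ pc qc rc μ lam ϖ θ₁ θ₂ Z) :
    ∀ᶠ s in 𝓝[>] (0 : ℝ), (γ s - a) * exp (-(ϖ : ℂ) * I) ∈ slitPlane := by
  have h1 : ∀ᶠ s in 𝓝[>] (0 : ℝ), ((γ s - a) * exp (-(ϖ : ℂ) * I)) / (‖γ s - a‖ : ℂ) ∈ slitPlane :=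
    h.tendsto_direction.eventually (isOpen_slitPlane.mem_nhds one_mem_slitPlane)
  filter_upwards [h1, h.contour.eventually_ne] with s hs hne
  rw [mem_slitPlane_iff_arg] at hs ⊢
  rw [arg_div_norm hne] at hs
  exact ⟨hs.1, mul_ne_zero hne (exp_ne_zero _)⟩

theorem Conditions.tendsto_contourLog_im
    (h : Conditions p q r T a b γ pc qc rc μ lam ϖ θ₁ θ₂ Z) :
    Tendsto (fun s => (contourLog ϖ (γ s - a)).im) (𝓝[>] 0) (𝓝 ϖ) := by
  have h1 := ((continuousAt_arg one_mem_slitPlane).tendsto.comp h.tendsto_direction).add_const ϖ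
  rw [arg_one, zero_add] at h1
  refine h1.congr' ?_
  filter_upwards [h.contour.eventually_ne] with s hs
  simp only [Function.comp_apply]
  rw [arg_div_norm hs, contourLog_im]

/-! #### The functions of `u = t - a` -/

/-- The function with `p(a + u) = p(a) + p₀ u^μ pUnit(u)`. -/
noncomputable def pUnit (pc : ℕ → ℂ) (u : ℂ) : ℂ :=
  ∑' n, pc n / pc 0 * u ^ n

theorem Conditions.exists_summable (h : Conditions p q r T a b γ pc qc rc μ lam ϖ θ₁ θ₂ Z) :
    ∃ u : ℂ, u ≠ 0 ∧ (Summable fun n => pc n / pc 0 * u ^ n) ∧ (Summable fun n => qc n * u ^ n) ∧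
      Summable fun n => rc n * u ^ n := by
  obtain ⟨s, hs, hp, hq, hr⟩ := (h.contour.eventually_ne.and
    (h.expand_p.and (h.expand_q.and h.expand_r))).exists
  refine ⟨γ s - a, hs, ?_, ?_, ?_⟩
  · refine (hp.summable.mul_left ((pc 0 * (γ s - a) ^ μ)⁻¹)).congr fun n => ?_
    have := h.p_zero_ne
    rw [pow_add]
    field_simp
  · refine (hq.summable.mul_left (exp (-((lam - 1) * contourLog ϖ (γ s - a))))).congr fun n => ?_
    rw [polarPow_argNear, mul_left_comm, ← exp_add]
    nth_rewrite 3 [← exp_contourLog ϖ hs]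
    rw [← exp_nat_mul]
    ring_nf
  · refine (hr.summable.mul_left (γ s - a)⁻¹).congr fun n => ?_
    rw [pow_succ]
    field_simp

theorem Conditions.eventually_p_eq (h : Conditions p q r T a b γ pc qc rc μ lam ϖ θ₁ θ₂ Z) :
    ∀ᶠ s in 𝓝[>] (0 : ℝ), p (γ s) - p a = pc 0 * (γ s - a) ^ μ * pUnit pc (γ s - a) := by
  filter_upwards [h.expand_p] with s hs
  rw [← hs.tsum_eq, pUnit, ← tsum_mul_left]
  congr 1
  funext n
  have := h.p_zero_ne
  rw [pow_add]
  field_simp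

theorem Conditions.eventually_q_eq (h : Conditions p q r T a b γ pc qc rc μ lam ϖ θ₁ θ₂ Z) :
    ∀ᶠ s in 𝓝[>] (0 : ℝ), q (γ s) = exp ((lam - 1) * contourLog ϖ (γ s - a)) *
      ∑' n, qc n * (γ s - a) ^ n := by
  filter_upwards [h.expand_q, h.contour.eventually_ne] with s hs hne
  rw [← hs.tsum_eq, ← tsum_mul_left]
  congr 1
  funext n
  rw [polarPow_argNear, mul_left_comm]
  congr 1
  nth_rewrite 3 [← exp_contourLog ϖ hne]
  rw [← exp_nat_mul, ← exp_add]
  ring_nf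

theorem Conditions.eventually_r_eq (h : Conditions p q r T a b γ pc qc rc μ lam ϖ θ₁ θ₂ Z) :
    ∀ᶠ s in 𝓝[>] (0 : ℝ), r (γ s) = (γ s - a) * ∑' n, rc n * (γ s - a) ^ n := by
  filter_upwards [h.expand_r] with s hs
  rw [← hs.tsum_eq, ← tsum_mul_left]
  congr 1
  funext n
  rw [pow_succ]
  ring

theorem Conditions.analyticAt_pUnit (h : Conditions p q r T a b γ pc qc rc μ lam ϖ θ₁ θ₂ Z) :
    AnalyticAt ℂ (pUnit pc) 0 := by
  obtain ⟨u, hu, hp, -, -⟩ := h.exists_summable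
  exact (hasFPowerSeriesAt_tsum hu hp).analyticAt

theorem Conditions.hasTaylor_pUnit (h : Conditions p q r T a b γ pc qc rc μ lam ϖ θ₁ θ₂ Z) :
    HasTaylor (𝓝 0) id (pUnit pc) (normalizedP pc) ∧
    HasTaylor (𝓝 0) id (deriv (pUnit pc)) (PowerSeries.derivative ℂ (normalizedP pc)) := by
  obtain ⟨u, hu, hp, -, -⟩ := h.exists_summable
  exact ⟨hasTaylor_tsum hu hp, hasTaylor_deriv_tsum hu hp⟩

theorem Conditions.tendsto_pUnit (h : Conditions p q r T a b γ pc qc rc μ lam ϖ θ₁ θ₂ Z) :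
    Tendsto (pUnit pc) (𝓝 0) (𝓝 1) := by
  have := h.hasTaylor_pUnit.1.tendsto tendsto_id
  rwa [constantCoeff_normalizedP h.p_zero_ne] at this

/-- The logarithm of the local coordinate along the contour. -/
noncomputable def logPath (γ : ℝ → ℂ) (a : ℂ) (pc : ℕ → ℂ) (μ : ℕ) (ϖ ϖ₀ : ℝ) (s : ℝ) : ℂ :=
  contourLog ϖ (γ s - a) + log (pUnit pc (γ s - a)) / μ + logLead pc μ ϖ₀

theorem exp_logPath {s : ℝ} (hs : γ s - a ≠ 0) (hV : pUnit pc (γ s - a) ≠ 0) :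
    exp (logPath γ a pc μ ϖ ϖ₀ s) = coordinate pc (pUnit pc) μ ϖ₀ (γ s - a) := by
  rw [logPath, exp_add, exp_add, exp_contourLog ϖ hs, coordinate, cpow_def_of_ne_zero hV,
    mul_one_div]
  ring

theorem Conditions.tendsto_logPath_im (h : Conditions p q r T a b γ pc qc rc μ lam ϖ θ₁ θ₂ Z)
    (hμ : μ ≠ 0) :
    Tendsto (fun s => μ * (logPath γ a pc μ ϖ ϖ₀ s).im) (𝓝[>] 0) (𝓝 (μ * ϖ + ϖ₀)) := by
  have h1 : Tendsto (fun s => (log (pUnit pc (γ s - a)) / μ).im) (𝓝[>] 0) (𝓝 0) := by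
    have h2 := h.tendsto_pUnit.comp h.contour.tendsto_sub
    have h3 := ((continuousAt_clog one_mem_slitPlane).tendsto.comp h2).div_const (μ : ℂ)
    rw [log_one, zero_div] at h3
    exact (continuous_im.tendsto _).comp h3
  have h5 := ((h.tendsto_contourLog_im.add h1).add_const (ϖ₀ / μ)).const_mul (μ : ℝ)
  have hμ' : (μ : ℝ) ≠ 0 := Nat.cast_ne_zero.2 hμ
  have e : (μ : ℝ) * (ϖ + 0 + ϖ₀ / μ) = μ * ϖ + ϖ₀ := by field_simp; ring
  rw [e] at h5
  refine h5.congr fun s => ?_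
  rw [logPath, add_im, add_im]
  congr 2
  rw [logLead, div_natCast_im]
  simp

theorem Conditions.eventually_hasDerivAt_logPath
    (h : Conditions p q r T a b γ pc qc rc μ lam ϖ θ₁ θ₂ Z) (hμ : μ ≠ 0) :
    ∀ᶠ s in 𝓝[>] (0 : ℝ), HasDerivAt (logPath γ a pc μ ϖ ϖ₀)
      (deriv γ s / (γ s - a) * ((μ * pUnit pc (γ s - a) + (γ s - a) * deriv (pUnit pc) (γ s - a)) /
        (μ * pUnit pc (γ s - a)))) s := by
  have h1 := h.contour.tendsto_sub.eventually h.analyticAt_pUnit.eventually_analyticAt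
  have h2 : ∀ᶠ s in 𝓝[>] (0 : ℝ), pUnit pc (γ s - a) ∈ slitPlane :=
    (h.tendsto_pUnit.comp h.contour.tendsto_sub).eventually
      (isOpen_slitPlane.mem_nhds one_mem_slitPlane)
  filter_upwards [h1, h2, h.eventually_mem_slitPlane, h.contour.eventually_ne,
    h.contour.differentiableAt] with s hs1 hs2 hs3 hne hd
  have hu : HasDerivAt (fun s => γ s - a) (deriv γ s) s := hd.hasDerivAt.sub_const a
  have d1 : HasDerivAt (fun s => contourLog ϖ (γ s - a)) ((γ s - a)⁻¹ * deriv γ s) s :=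
    HasDerivAt.comp (h₂ := contourLog ϖ) (h := fun s => γ s - a) s (hasDerivAt_contourLog ϖ hs3) hu
  have d2 : HasDerivAt (fun s => pUnit pc (γ s - a))
      (deriv (pUnit pc) (γ s - a) * deriv γ s) s :=
    HasDerivAt.comp (h₂ := pUnit pc) (h := fun s => γ s - a) s
      hs1.differentiableAt.hasDerivAt hu
  have d3 : HasDerivAt (fun s => log (pUnit pc (γ s - a)) / μ)
      (deriv (pUnit pc) (γ s - a) * deriv γ s / pUnit pc (γ s - a) / μ) s :=
    (d2.clog_real hs2).div_const (μ : ℂ)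
  have d4 : HasDerivAt (logPath γ a pc μ ϖ ϖ₀) ((γ s - a)⁻¹ * deriv γ s +
      deriv (pUnit pc) (γ s - a) * deriv γ s / pUnit pc (γ s - a) / μ) s :=
    (d1.add d3).add_const (logLead pc μ ϖ₀)
  refine d4.congr_deriv ?_
  have hV := slitPlane_ne_zero hs2
  have hμ' : (μ : ℂ) ≠ 0 := Nat.cast_ne_zero.2 hμ
  generalize deriv (pUnit pc) (γ s - a) = x at *
  generalize pUnit pc (γ s - a) = y at *
  generalize γ s - a = u at *
  field_simp

/-- `|v| / s` tends to `L = |p₀^(1/μ) γ'(0)|`, nonzero because the contour is regular at its start,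
and `s` times the logarithmic derivative of `v` tends to `1`. Hence the constants `L / 2`, `2 L` and
`2`. -/
theorem Conditions.exists_logPath_bounds (h : Conditions p q r T a b γ pc qc rc μ lam ϖ θ₁ θ₂ Z)
    (hμ : μ ≠ 0) : ∃ c₁ c₂ : ℝ, 0 < c₁ ∧ ∀ᶠ s in 𝓝[>] (0 : ℝ),
      DifferentiableAt ℝ (logPath γ a pc μ ϖ ϖ₀) s ∧
      c₁ * s ≤ Real.exp (logPath γ a pc μ ϖ ϖ₀ s).re ∧
      Real.exp (logPath γ a pc μ ϖ ϖ₀ s).re ≤ c₂ * s ∧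
      ‖deriv (logPath γ a pc μ ϖ ϖ₀) s‖ ≤ 2 / s := by
  have hμ' : (μ : ℂ) ≠ 0 := Nat.cast_ne_zero.2 hμ
  have hu := h.contour.tendsto_sub
  have hV := h.tendsto_pUnit.comp hu
  have hg := h.contour.regular_start
  set g₀ := derivWithin γ (Ici 0) 0 with hg₀
  set L : ℝ := ‖exp (logLead pc μ ϖ₀) * g₀‖ with hL
  have hL0 : 0 < L := norm_pos_iff.2 (mul_ne_zero (exp_ne_zero _) hg)
  have hW : Tendsto (fun s => pUnit pc (γ s - a) ^ (1 / (μ : ℂ))) (𝓝[>] 0) (𝓝 1) := by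
    have h1 := (hasTaylor_cpow tendsto_id h.hasTaylor_pUnit.1
      (constantCoeff_normalizedP h.p_zero_ne) (1 / (μ : ℂ))).tendsto tendsto_id
    rw [constantCoeff_seriesPow] at h1
    exact h1.comp hu
  have h1 : Tendsto (fun s : ℝ => ‖exp (logLead pc μ ϖ₀) *
      ((γ s - a) / s * pUnit pc (γ s - a) ^ (1 / (μ : ℂ)))‖) (𝓝[>] 0) (𝓝 L) := by
    have := ((h.contour.tendsto_div.mul hW).const_mul (exp (logLead pc μ ϖ₀))).norm
    rwa [mul_one] at this
  have hE : Tendsto (fun s => (μ * pUnit pc (γ s - a) +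
      (γ s - a) * deriv (pUnit pc) (γ s - a)) / (μ * pUnit pc (γ s - a))) (𝓝[>] 0) (𝓝 1) := by
    have e1 := (hasTaylor_euler h.hasTaylor_pUnit.1 h.hasTaylor_pUnit.2 μ).tendsto tendsto_id
    rw [constantCoeff_eulerSeries μ (constantCoeff_normalizedP h.p_zero_ne)] at e1
    have e2 := (e1.comp hu).div (hV.const_mul (μ : ℂ)) (by simpa using hμ')
    rw [mul_one, div_self hμ'] at e2
    exact e2
  have h2 := ((h.contour.tendsto_deriv.div h.contour.tendsto_div hg).mul hE).norm
  rw [mul_one, ← hg₀, div_self hg, norm_one] at h2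
  refine ⟨L / 2, 2 * L, by positivity, ?_⟩
  filter_upwards [h.eventually_hasDerivAt_logPath hμ (ϖ₀ := ϖ₀), h.contour.eventually_ne,
    hV.eventually_ne one_ne_zero, self_mem_nhdsWithin,
    h1.eventually (lt_mem_nhds (by linarith : L / 2 < L)),
    h1.eventually (gt_mem_nhds (by linarith : L < 2 * L)),
    h2.eventually (gt_mem_nhds (by norm_num : (1 : ℝ) < 2))] with s hd hne hVne hs0 b1 b2 b3
  have hs : (0 : ℝ) < s := hs0
  have hs' : (s : ℂ) ≠ 0 := ofReal_ne_zero.2 hs.ne'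
  have hnorm : ∀ w : ℂ, ‖w‖ * s = ‖w * s‖ := fun w => by
    rw [norm_mul, norm_real, Real.norm_eq_abs, abs_of_pos hs]
  have en : Real.exp (logPath γ a pc μ ϖ ϖ₀ s).re = ‖exp (logLead pc μ ϖ₀) *
      ((γ s - a) / s * pUnit pc (γ s - a) ^ (1 / (μ : ℂ)))‖ * s := by
    rw [← norm_exp, exp_logPath hne hVne, coordinate, hnorm]
    congr 1
    field_simp
  refine ⟨hd.differentiableAt, ?_, ?_, ?_⟩
  · rw [en]
    gcongr
  · rw [en]
    gcongr
  · rw [hd.deriv, le_div_iff₀ hs, hnorm]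
    refine le_trans (le_of_eq ?_) b3.le
    rw [Pi.div_apply]
    congr 1
    field_simp

end Local

end FaxenExpansion

/-! ### The integrand near the starting point in Faxén form -/

namespace FaxenExpansion

variable {p q r : ℂ → ℂ} {T : Set ℂ} {a : ℂ} {b : OnePoint ℂ} {γ : ℝ → ℂ} {pc qc rc : ℕ → ℂ}
  {μ : ℕ} {lam : ℂ} {ϖ θ₁ θ₂ Z ϖ₀ : ℝ}

/-- The logarithm of `z^(1/μ)`, `z = x e^{iθ}`. -/
noncomputable def logScale (μ : ℕ) (x θ : ℝ) : ℂ :=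
  ((Real.log x : ℂ) + (θ : ℂ) * I) / μ

theorem polarPow_eq_exp_logScale (hμ : μ ≠ 0) (x θ : ℝ) (s : ℂ) :
    polarPow x θ s = exp (s * μ * logScale μ x θ) := by
  have hμ' : (μ : ℂ) ≠ 0 := Nat.cast_ne_zero.2 hμ
  unfold polarPow logScale
  congr 1
  field_simp

theorem exp_mul_logScale (hμ : μ ≠ 0) {x : ℝ} (hx : 0 < x) (θ : ℝ) :
    exp (μ * logScale μ x θ) = x * exp ((θ : ℂ) * I) := by
  have hμ' : (μ : ℂ) ≠ 0 := Nat.cast_ne_zero.2 hμ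
  rw [logScale, mul_div_cancel₀ _ hμ', exp_add, ← ofReal_exp, Real.exp_log hx]

theorem logScale_re (μ : ℕ) (x θ : ℝ) : (logScale μ x θ).re = Real.log x / μ := by
  rw [logScale, div_natCast_re]
  simp

theorem logScale_im (μ : ℕ) (x θ : ℝ) : (logScale μ x θ).im = θ / μ := by
  rw [logScale, div_natCast_im]
  simp

theorem coordinate_pow (hμ : μ ≠ 0) (hp : pc 0 ≠ 0) (h₀ : pc 0 = ‖pc 0‖ * exp ((ϖ₀ : ℂ) * I))
    (fV : ℂ → ℂ) (u : ℂ) : coordinate pc fV μ ϖ₀ u ^ μ = pc 0 * u ^ μ * fV u := by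
  rw [coordinate, mul_pow, mul_pow, ← exp_nat_mul, exp_mul_logLead hμ hp h₀, ← cpow_mul_nat,
    one_div_mul_cancel (Nat.cast_ne_zero.2 hμ), cpow_one]
  ring

/-- With `ξ = log v`, `τ = log z^(1/μ)` and `ω = ξ + τ`: `e^{μω} = z (p - p(a))`, `z^(1/μ) r = (x₀ +
ρ) e^ω` and `q dt = e^{λξ} A dξ`. The factor `e^{-λτ} = z^(-λ/μ)` compensates for `e^{λω}` in the
kernel. The range of `s` is independent of `z`. -/
theorem Conditions.eventually_integrand_eq
    (h : Conditions p q r T a b γ pc qc rc μ lam ϖ θ₁ θ₂ Z) (hμ : μ ≠ 0)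
    (h₀ : pc 0 = ‖pc 0‖ * exp ((ϖ₀ : ℂ) * I)) :
    ∀ᶠ s in 𝓝[>] (0 : ℝ), ∀ x : ℝ, 0 < x → ∀ θ : ℝ, integrand p q r γ μ x θ s =
      exp (-((x : ℂ) * exp ((θ : ℂ) * I)) * p a) * exp (-(lam * logScale μ x θ)) *
        (faxenKernel μ (faxenArg pc rc μ ϖ₀) lam (logPath γ a pc μ ϖ ϖ₀ s + logScale μ x θ) *
          exp (exp (logPath γ a pc μ ϖ ϖ₀ s + logScale μ x θ) *
            phase pc rc (pUnit pc) (fun u => ∑' n, rc n * u ^ n) μ ϖ₀ (γ s - a)) *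
          amplitude pc (pUnit pc) (fun u => ∑' n, qc n * u ^ n) μ lam ϖ₀ (γ s - a) *
          deriv (logPath γ a pc μ ϖ ϖ₀) s) := by
  have hμ' : (μ : ℂ) ≠ 0 := Nat.cast_ne_zero.2 hμ
  have hu := h.contour.tendsto_sub
  have hE := (hasTaylor_euler h.hasTaylor_pUnit.1 h.hasTaylor_pUnit.2 μ).tendsto tendsto_id
  rw [constantCoeff_eulerSeries μ (constantCoeff_normalizedP h.p_zero_ne)] at hE
  filter_upwards [h.eventually_p_eq, h.eventually_q_eq, h.eventually_r_eq,
    h.contour.eventually_ne, (h.tendsto_pUnit.comp hu).eventually_ne one_ne_zero,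
    h.eventually_hasDerivAt_logPath hμ (ϖ₀ := ϖ₀), (hE.comp hu).eventually_ne hμ']
    with s hp hq hr hne hV hd hE0 x hx θ
  simp only [Function.comp_apply] at hV hE0
  have hcoord := exp_logPath (μ := μ) (ϖ := ϖ) (ϖ₀ := ϖ₀) hne hV
  have hℓ := exp_contourLog ϖ hne
  rw [hd.deriv]
  set u := γ s - a with hu_def
  set y := pUnit pc u with hy
  set ξ := logPath γ a pc μ ϖ ϖ₀ s with hξ
  set τ := logScale μ x θ with hτ
  set Q := ∑' n, qc n * u ^ n with hQ
  set R := ∑' n, rc n * u ^ n with hR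
  set D := deriv (pUnit pc) u with hD
  set P := p (γ s) - p a with hP
  have hexpP : exp (μ * (ξ + τ)) = (x * exp ((θ : ℂ) * I)) * P := by
    rw [mul_add, exp_add, exp_mul_logScale hμ hx, exp_nat_mul, hcoord,
      coordinate_pow hμ h.p_zero_ne h₀, hp, mul_comm]
  have hphase : (faxenArg pc rc μ ϖ₀ +
      phase pc rc (pUnit pc) (fun u => ∑' n, rc n * u ^ n) μ ϖ₀ u) * exp ξ = r (γ s) := by
    have hy1 : y ^ (1 / (μ : ℂ)) ≠ 0 := by simp [cpow_eq_zero_iff, hV]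
    rw [phase, add_sub_cancel, hcoord, coordinate, ← hy, cpow_neg, hr]
    have := exp_ne_zero (logLead pc μ ϖ₀)
    field_simp
    rfl
  have hamp : exp (lam * ξ) * (amplitude pc (pUnit pc) (fun u => ∑' n, qc n * u ^ n) μ lam ϖ₀ u *
      (deriv γ s / u * ((μ * y + u * D) / (μ * y)))) = q (γ s) * deriv γ s := by
    have e1 : exp (lam * ξ) = exp (lam * contourLog ϖ u) * exp (lam * log y / μ) *
        exp (lam * logLead pc μ ϖ₀) := by
      rw [hξ, logPath, ← exp_add, ← exp_add]
      congr 1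
      ring
    have e2 : exp (lam * log y / μ) * y ^ (1 - lam / μ) = y := by
      nth_rewrite 3 [← exp_log hV]
      rw [cpow_def_of_ne_zero hV, ← exp_add]
      congr 1
      ring
    have e3 : exp (lam * logLead pc μ ϖ₀) * exp (-(lam * logLead pc μ ϖ₀)) = 1 := by
      rw [← exp_add, add_neg_cancel, exp_zero]
    have e4 : exp ((lam - 1) * contourLog ϖ u) = exp (lam * contourLog ϖ u) / u := by
      nth_rewrite 3 [← hℓ]
      rw [← exp_sub]
      congr 1
      ring
    rw [e1, amplitude, hq, e4, ← hy, ← hD]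
    calc exp (lam * contourLog ϖ u) * exp (lam * log y / μ) * exp (lam * logLead pc μ ϖ₀) *
          (exp (-(lam * logLead pc μ ϖ₀)) * (μ * (Q * y ^ (1 - lam / μ) * (μ * y + u * D)⁻¹)) *
          (deriv γ s / u * ((μ * y + u * D) / (μ * y))))
        = exp (lam * contourLog ϖ u) * (exp (lam * logLead pc μ ϖ₀) *
          exp (-(lam * logLead pc μ ϖ₀))) * (exp (lam * log y / μ) * y ^ (1 - lam / μ)) *
          (μ * Q * (μ * y + u * D)⁻¹ * (deriv γ s / u * ((μ * y + u * D) / (μ * y)))) := by ring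
      _ = exp (lam * contourLog ϖ u) / u * Q * deriv γ s := by
        rw [e3, e2]
        generalize μ * y + u * D = E at hE0 ⊢
        field_simp
  have hexp : exp (-((x : ℂ) * exp ((θ : ℂ) * I)) * p (γ s) +
      polarPow x θ (1 / (μ : ℂ)) * r (γ s)) =
      exp (-((x : ℂ) * exp ((θ : ℂ) * I)) * p a) * exp (-(lam * τ)) *
        (faxenKernel μ (faxenArg pc rc μ ϖ₀) lam (ξ + τ) * exp (exp (ξ + τ) *
          phase pc rc (pUnit pc) (fun u => ∑' n, rc n * u ^ n) μ ϖ₀ u)) * exp (-(lam * ξ)) := by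
    rw [faxenKernel, hexpP, ← exp_add, ← exp_add, ← exp_add, ← exp_add]
    congr 1
    rw [polarPow_eq_exp_logScale hμ, one_div_mul_cancel hμ', one_mul, ← hphase, exp_add, ← hτ, hP]
    ring
  have e5 : exp (-(lam * ξ)) * exp (lam * ξ) = 1 := by
    rw [← exp_add, neg_add_cancel, exp_zero]
  rw [integrand, hexp, mul_assoc _ (q (γ s)), ← hamp]
  linear_combination (exp (-((x : ℂ) * exp ((θ : ℂ) * I)) * p a) * exp (-(lam * τ)) *
        (faxenKernel μ (faxenArg pc rc μ ϖ₀) lam (ξ + τ) * exp (exp (ξ + τ) *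
          phase pc rc (pUnit pc) (fun u => ∑' n, rc n * u ^ n) μ ϖ₀ u)) *
    (amplitude pc (pUnit pc) (fun u => ∑' n, qc n * u ^ n) μ lam ϖ₀ u *
      (deriv γ s / u * ((μ * y + u * D) / (μ * y))))) * e5

theorem Conditions.eventually_continuousAt
    (h : Conditions p q r T a b γ pc qc rc μ lam ϖ θ₁ θ₂ Z) (hμ : μ ≠ 0) (ϖ₀ : ℝ) :
    ∀ᶠ u in 𝓝 (0 : ℂ),
      ContinuousAt (phase pc rc (pUnit pc) (fun u => ∑' n, rc n * u ^ n) μ ϖ₀) u ∧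
      ContinuousAt (amplitude pc (pUnit pc) (fun u => ∑' n, qc n * u ^ n) μ lam ϖ₀) u := by
  have hμ' : (μ : ℂ) ≠ 0 := Nat.cast_ne_zero.2 hμ
  obtain ⟨u₁, hu₁, -, hsq, hsr⟩ := h.exists_summable
  have hE := (hasTaylor_euler h.hasTaylor_pUnit.1 h.hasTaylor_pUnit.2 μ).tendsto tendsto_id
  rw [constantCoeff_eulerSeries μ (constantCoeff_normalizedP h.p_zero_ne)] at hE
  have hslit : ∀ᶠ u in 𝓝 (0 : ℂ), pUnit pc u ∈ slitPlane :=
    h.tendsto_pUnit.eventually (isOpen_slitPlane.mem_nhds one_mem_slitPlane)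
  filter_upwards [h.analyticAt_pUnit.eventually_analyticAt,
    (hasFPowerSeriesAt_tsum hu₁ hsq).analyticAt.eventually_analyticAt,
    (hasFPowerSeriesAt_tsum hu₁ hsr).analyticAt.eventually_analyticAt, hslit,
    hE.eventually_ne hμ'] with u hV hQ hR hs hE0
  have hcp : ∀ s : ℂ, ContinuousAt (fun u => pUnit pc u ^ s) u := fun s =>
    hV.continuousAt.cpow continuousAt_const hs
  have hEc : ContinuousAt (fun u => (μ * pUnit pc u + u * deriv (pUnit pc) u)⁻¹) u :=
    ((continuousAt_const.mul hV.continuousAt).add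
      (continuousAt_id.mul hV.deriv.continuousAt)).inv₀ hE0
  exact ⟨(continuousAt_const.mul (hR.continuousAt.mul (hcp _))).sub continuousAt_const,
    continuousAt_const.mul (continuousAt_const.mul ((hQ.continuousAt.mul (hcp _)).mul hEc))⟩

/-- The coefficients of the local expansion: the coefficient of `X^k` in the product of the `m`-th
power of the phase series with the amplitude series. -/
noncomputable def localCoeff (pc qc rc : ℕ → ℂ) (μ : ℕ) (lam : ℂ) (ϖ₀ : ℝ) (m k : ℕ) : ℂ :=
  PowerSeries.coeff k ((PowerSeries.mk fun n => if n = 0 then 0 else cCoeff pc rc μ ϖ₀ n) ^ m *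
    PowerSeries.mk fun n => μ * bCoeff pc qc μ lam ϖ₀ n)

theorem Conditions.exists_taylor_bounds
    (h : Conditions p q r T a b γ pc qc rc μ lam ϖ θ₁ θ₂ Z) (hμ : μ ≠ 0)
    (h₀ : pc 0 = ‖pc 0‖ * exp ((ϖ₀ : ℂ) * I)) (N : ℕ) :
    ∃ K₁ K₂ K₃ : ℝ, 0 ≤ K₁ ∧ 0 ≤ K₃ ∧ ∀ᶠ u in 𝓝 (0 : ℂ),
      ‖phase pc rc (pUnit pc) (fun u => ∑' n, rc n * u ^ n) μ ϖ₀ u‖ ≤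
        K₁ * ‖coordinate pc (pUnit pc) μ ϖ₀ u‖ ∧
      ‖amplitude pc (pUnit pc) (fun u => ∑' n, qc n * u ^ n) μ lam ϖ₀ u‖ ≤ K₂ ∧
      ∀ m < N, ‖phase pc rc (pUnit pc) (fun u => ∑' n, rc n * u ^ n) μ ϖ₀ u ^ m *
          amplitude pc (pUnit pc) (fun u => ∑' n, qc n * u ^ n) μ lam ϖ₀ u -
        ∑ k ∈ Finset.range N, localCoeff pc qc rc μ lam ϖ₀ m k *
          coordinate pc (pUnit pc) μ ϖ₀ u ^ k‖ ≤ K₃ * ‖coordinate pc (pUnit pc) μ ϖ₀ u‖ ^ N := by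
  obtain ⟨u₁, hu₁, -, hsq, hsr⟩ := h.exists_summable
  have hV := h.hasTaylor_pUnit
  have hρ := hasTaylor_phase hμ h.p_zero_ne h₀ hV.1 (hasTaylor_tsum hu₁ hsr)
  have hA := hasTaylor_amplitude (ϖ₀ := ϖ₀) (lam := lam) hμ h.p_zero_ne hV.1 hV.2
    (hasTaylor_tsum hu₁ hsq)
  have hc : Tendsto (coordinate pc (pUnit pc) μ ϖ₀) (𝓝 0) (𝓝 0) :=
    tendsto_coordinate h.p_zero_ne hV.1
  obtain ⟨K₁, hK₁, b₁⟩ := (hρ.isBigO_pow hc (N := 1) (by simp)).exists_nonneg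
  obtain ⟨K₂, b₂⟩ := hA.isBigO_one.bound
  have hm : ∀ m : ℕ, ∃ K : ℝ, 0 ≤ K ∧ ∀ᶠ u in 𝓝 (0 : ℂ),
      ‖phase pc rc (pUnit pc) (fun u => ∑' n, rc n * u ^ n) μ ϖ₀ u ^ m *
          amplitude pc (pUnit pc) (fun u => ∑' n, qc n * u ^ n) μ lam ϖ₀ u -
        ∑ k ∈ Finset.range N, localCoeff pc qc rc μ lam ϖ₀ m k *
          coordinate pc (pUnit pc) μ ϖ₀ u ^ k‖ ≤ K * ‖coordinate pc (pUnit pc) μ ϖ₀ u‖ ^ N := by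
    intro m
    obtain ⟨K, hK, b⟩ := (((hρ.pow hc m).mul hc hA) N).exists_nonneg
    refine ⟨K, hK, b.bound.mono fun u hu => ?_⟩
    rw [eval_trunc, norm_pow] at hu
    exact hu
  choose K hK hb using hm
  have hall : ∀ᶠ u in 𝓝 (0 : ℂ), ∀ m ∈ Finset.range N, _ :=
    (Filter.eventually_all_finset (Finset.range N)).2 fun m _ => hb m
  refine ⟨K₁, K₂, ∑ m ∈ Finset.range N, K m, hK₁, Finset.sum_nonneg fun m _ => hK m, ?_⟩
  filter_upwards [b₁.bound, b₂, hall] with u h1 h2 h3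
  refine ⟨by simpa using h1, by simpa using h2, fun m hm => ?_⟩
  refine (h3 m (Finset.mem_range.2 hm)).trans ?_
  gcongr
  exact Finset.single_le_sum (f := K) (fun i _ => hK i) (Finset.mem_range.2 hm)

/-- The contribution of a neighbourhood of the starting point. -/
theorem Conditions.exists_near_expansion
    (h : Conditions p q r T a b γ pc qc rc μ lam ϖ θ₁ θ₂ Z) (hμ : 2 ≤ μ)
    (h₀ : pc 0 = ‖pc 0‖ * exp ((ϖ₀ : ℂ) * I)) {ϑ : ℝ} (hϑ : ϑ < Real.pi / 2)
    (hdir : ∀ θ ∈ Icc θ₁ θ₂, |ϖ₀ + θ + μ * ϖ| ≤ ϑ) (N : ℕ) :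
    ∃ c₀ ∈ Ioo (0 : ℝ) 1, ∃ K : ℝ, ∀ x : ℝ, 1 ≤ x → ∀ θ ∈ Icc θ₁ θ₂,
      IntegrableOn (integrand p q r γ μ x θ) (Ioc 0 c₀) ∧
      ‖(∫ s in Ioc 0 c₀, integrand p q r γ μ x θ s) -
        exp (-((x : ℂ) * exp ((θ : ℂ) * I)) * p a) * exp (-(lam * logScale μ x θ)) *
          ∑ k ∈ Finset.range N, exp (-(k * logScale μ x θ)) * ∑ m ∈ Finset.range N,
            localCoeff pc qc rc μ lam ϖ₀ m k / (m.factorial : ℂ) *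
              kernelInt μ (faxenArg pc rc μ ϖ₀) (lam + (k + m : ℕ))‖ ≤
        ‖exp (-((x : ℂ) * exp ((θ : ℂ) * I)) * p a) * exp (-(lam * logScale μ x θ))‖ *
          (K * Real.exp (-(N * (logScale μ x θ).re))) := by
  have hμ0 : μ ≠ 0 := by omega
  have hμR : (μ : ℝ) ≠ 0 := Nat.cast_ne_zero.2 hμ0
  -- The angle of the path only tends to its limiting value, so the strip is widened from `ϑ` to `ϑ'
  -- < π/2`.
  obtain ⟨ϑ', hϑ1, hϑ2⟩ := exists_between hϑ
  have hϑ0 : 0 ≤ ϑ' := (abs_nonneg _).trans ((hdir θ₁ ⟨le_rfl, h.sector_nonempty⟩).trans hϑ1.le)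
  obtain ⟨c₁, c₂, hc₁, hpath⟩ := h.exists_logPath_bounds hμ0 (ϖ₀ := ϖ₀)
  obtain ⟨K₁, K₂, K₃, hK₁, hK₃, hbd⟩ := h.exists_taylor_bounds hμ0 h₀ N
  have hu := h.contour.tendsto_sub
  have him : ∀ᶠ s in 𝓝[>] (0 : ℝ), |μ * (logPath γ a pc μ ϖ ϖ₀ s).im - (μ * ϖ + ϖ₀)| < ϑ' - ϑ := by
    have := (h.tendsto_logPath_im hμ0 (ϖ₀ := ϖ₀)).eventually
      (Metric.ball_mem_nhds _ (sub_pos.2 hϑ1))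
    simpa [Real.dist_eq] using this
  have hsmall : ∀ᶠ s in 𝓝[>] (0 : ℝ), s < 1 :=
    mem_nhdsWithin_of_mem_nhds (Iio_mem_nhds one_pos)
  obtain ⟨c₀, hc₀, hall⟩ := mem_nhdsGT_iff_exists_Ioc_subset.1
    (hpath.and ((hu.eventually hbd).and ((hu.eventually (h.eventually_continuousAt hμ0 ϖ₀)).and
      (him.and ((h.eventually_integrand_eq hμ0 h₀).and (hsmall.and (h.contour.eventually_ne.and
        (((h.tendsto_pUnit.comp hu).eventually_ne one_ne_zero).and
          h.contour.differentiableAt))))))))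
  have hc₀' : 0 < c₀ := hc₀
  set ξ := logPath γ a pc μ ϖ ϖ₀ with hξdef
  have hξ : IsLogPath μ c₀ c₁ c₂ 2 ξ :=
    ⟨hc₀', hc₁, fun s hs => (hall hs).1.1, fun s hs => (hall hs).1.2.1,
      fun s hs => (hall hs).1.2.2.1, fun s hs => (hall hs).1.2.2.2⟩
  have hcoord : ∀ s ∈ Ioc 0 c₀, exp (ξ s) = coordinate pc (pUnit pc) μ ϖ₀ (γ s - a) := by
    intro s hs
    obtain ⟨-, -, -, -, -, -, hne, hV, -⟩ := hall hs
    exact exp_logPath hne hV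
  have hcont : ∀ f : ℂ → ℂ, (∀ s ∈ Ioc 0 c₀, ContinuousAt f (γ s - a)) →
      ContinuousOn (fun s => f (γ s - a)) (Ioc 0 c₀) := by
    intro f hf s hs
    obtain ⟨-, -, -, -, -, -, -, -, hd⟩ := hall hs
    have h1 : ContinuousAt (fun s => γ s - a) s := hd.continuousAt.sub continuousAt_const
    exact (ContinuousAt.comp (f := fun s => γ s - a) (g := f) (hf s hs) h1).continuousWithinAt
  obtain ⟨K, hK⟩ := hξ.exists_expansion hμ (faxenArg pc rc μ ϖ₀) h.lam_re_pos hϑ0 hϑ2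
    (hcont _ fun s hs => (hall hs).2.2.1.1) (hcont _ fun s hs => (hall hs).2.2.1.2) hK₁
    (fun s hs => by
      rw [hcoord s hs]
      exact (hall hs).2.1.1)
    (fun s hs => (hall hs).2.1.2.1) hK₃ N (localCoeff pc qc rc μ lam ϖ₀)
    (fun m hm s hs => by
      rw [hcoord s hs]
      exact (hall hs).2.1.2.2 m hm)
  refine ⟨c₀, ⟨hc₀', (hall ⟨hc₀', le_rfl⟩).2.2.2.2.2.1⟩, K, fun x hx θ hθ => ?_⟩
  have hx0 : 0 < x := by linarith
  obtain ⟨hint, hle⟩ := hK (logScale μ x θ)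
    (by rw [logScale_re]; exact div_nonneg (Real.log_nonneg hx) (Nat.cast_nonneg _))
    (fun s hs => by
      have e1 := (hall hs).2.2.2.1
      have e2 := hdir θ hθ
      have e3 : μ * (ξ s + logScale μ x θ).im =
          (μ * (ξ s).im - (μ * ϖ + ϖ₀)) + (ϖ₀ + θ + μ * ϖ) := by
        rw [add_im, logScale_im]
        field_simp
        ring
      rw [e3]
      refine (abs_add_le _ _).trans ?_
      have e1' : |μ * (ξ s).im - (μ * ϖ + ϖ₀)| < ϑ' - ϑ := e1
      linarith)
  have hcongr : EqOn _ (integrand p q r γ μ x θ) (Ioc 0 c₀) := fun s hs =>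
    ((hall hs).2.2.2.2.1 x hx0 θ).symm
  refine ⟨IntegrableOn.congr_fun (hint.const_mul _) hcongr measurableSet_Ioc, ?_⟩
  rw [← setIntegral_congr_fun measurableSet_Ioc hcongr, integral_const_mul, ← mul_sub, norm_mul]
  gcongr

end FaxenExpansion

namespace FaxenExpansion

variable {p q r : ℂ → ℂ} {T : Set ℂ} {a : ℂ} {b : OnePoint ℂ} {γ : ℝ → ℂ} {pc qc rc : ℕ → ℂ}
  {μ : ℕ} {lam : ℂ} {ϖ θ₁ θ₂ Z ϖ₀ : ℝ}

/-! ### The branch of `arg p₀` -/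

theorem norm_mul_sin_le_re {w : ℂ} {δ : ℝ} (hδ : 0 < δ) (h : |arg w| ≤ Real.pi / 2 - δ) :
    ‖w‖ * Real.sin δ ≤ w.re := by
  rw [← norm_mul_cos_arg, ← Real.cos_abs (arg w), ← Real.cos_pi_div_two_sub]
  refine mul_le_mul_of_nonneg_left ?_ (norm_nonneg _)
  exact Real.cos_le_cos_of_nonneg_of_le_pi (abs_nonneg _) (by linarith [Real.pi_pos]) h

theorem Conditions.exists_re_ge (h : Conditions p q r T a b γ pc qc rc μ lam ϖ θ₁ θ₂ Z) :
    ∃ δ : ℝ, 0 < δ ∧ δ ≤ Real.pi / 2 ∧ ∀ θ ∈ Icc θ₁ θ₂, ∀ s ∈ Ioo (0 : ℝ) 1,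
      ‖p (γ s) - p a‖ * Real.sin δ ≤ (exp ((θ : ℂ) * I) * (p (γ s) - p a)).re := by
  obtain ⟨δ, hδ, hv⟩ := h.arg_le
  refine ⟨δ, hδ, ?_, fun θ hθ s hs => ?_⟩
  · have := (abs_nonneg _).trans
      (hv θ₁ ⟨le_rfl, h.sector_nonempty⟩ (1 / 2) (by norm_num)).2
    linarith
  · have := norm_mul_sin_le_re hδ (hv θ hθ s hs).2
    rwa [norm_mul, norm_exp_ofReal_mul_I, one_mul] at this

/-- Condition (v) passes to the limit along the contour and gives `cos(ϖ₀ + θ + μϖ) ≥ sin δ > 0` on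
the whole sector. Choosing `ϖ₀` through a principal argument at `θ₁` puts that angle in `(-π/2,
π/2)`; a sector of width less than `π` cannot reach the next interval where the cosine is positive.
-/
theorem Conditions.exists_branch (h : Conditions p q r T a b γ pc qc rc μ lam ϖ θ₁ θ₂ Z) :
    ∃ ϖ₀ ϑ : ℝ, pc 0 = ‖pc 0‖ * exp ((ϖ₀ : ℂ) * I) ∧ ϑ < Real.pi / 2 ∧
      ∀ θ ∈ Icc θ₁ θ₂, |ϖ₀ + θ + μ * ϖ| ≤ ϑ := by
  obtain ⟨δ, hδ, hδ2, hre⟩ := h.exists_re_ge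
  set α := arg (pc 0 * exp (((θ₁ + μ * ϖ : ℝ) : ℂ) * I)) with hα
  have hp : pc 0 = ‖pc 0‖ * exp (((α - θ₁ - μ * ϖ : ℝ) : ℂ) * I) := by
    have h1 := norm_mul_exp_arg_mul_I (pc 0 * exp (((θ₁ + μ * ϖ : ℝ) : ℂ) * I))
    rw [norm_mul, norm_exp_ofReal_mul_I, mul_one, ← hα] at h1
    have h2 : exp (((α - θ₁ - μ * ϖ : ℝ) : ℂ) * I) =
        exp (α * I) * exp (-(((θ₁ + μ * ϖ : ℝ) : ℂ) * I)) := by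
      rw [← exp_add]
      push_cast
      ring_nf
    rw [h2, ← mul_assoc, h1, mul_assoc, ← exp_add, add_neg_cancel, exp_zero, mul_one]
  have hcos : ∀ θ ∈ Icc θ₁ θ₂, Real.sin δ ≤ Real.cos (α - θ₁ - μ * ϖ + θ + μ * ϖ) := by
    intro θ hθ
    have hV := h.tendsto_pUnit.comp h.contour.tendsto_sub
    -- The inequality is homogeneous, so `p - p(a)` may be divided by `‖t - a‖^μ`, which makes its
    -- limit nonzero.
    have hlim : Tendsto (fun s => pc 0 * ((γ s - a) / (‖γ s - a‖ : ℂ)) ^ μ * pUnit pc (γ s - a))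
        (𝓝[>] 0) (𝓝 (pc 0 * exp ((ϖ : ℂ) * I) ^ μ * 1)) :=
      ((h.slope.pow μ).const_mul (pc 0)).mul hV
    have hev : ∀ᶠ s in 𝓝[>] (0 : ℝ),
        ‖pc 0 * ((γ s - a) / (‖γ s - a‖ : ℂ)) ^ μ * pUnit pc (γ s - a)‖ * Real.sin δ ≤
        (exp ((θ : ℂ) * I) *
          (pc 0 * ((γ s - a) / (‖γ s - a‖ : ℂ)) ^ μ * pUnit pc (γ s - a))).re := by
      filter_upwards [h.eventually_p_eq, h.contour.eventually_ne,
        Ioo_mem_nhdsGT (one_pos : (0 : ℝ) < 1)] with s hs hne hs1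
      have hn : 0 < ‖γ s - a‖ ^ μ := pow_pos (norm_pos_iff.2 hne) μ
      have e : pc 0 * ((γ s - a) / (‖γ s - a‖ : ℂ)) ^ μ * pUnit pc (γ s - a) =
          ((‖γ s - a‖ ^ μ)⁻¹ : ℝ) * (p (γ s) - p a) := by
        rw [hs, div_pow]
        push_cast
        ring
      rw [e, norm_mul, norm_real, Real.norm_eq_abs, abs_of_pos (inv_pos.2 hn), mul_left_comm,
        re_ofReal_mul, mul_assoc]
      exact mul_le_mul_of_nonneg_left (hre θ hθ s hs1) (inv_pos.2 hn).le
    have hle := le_of_tendsto_of_tendsto (hlim.norm.mul_const (Real.sin δ))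
      ((continuous_re.tendsto _).comp (hlim.const_mul (exp ((θ : ℂ) * I)))) hev
    rw [mul_one] at hle
    have e2 : exp ((θ : ℂ) * I) * (pc 0 * exp ((ϖ : ℂ) * I) ^ μ) =
        (‖pc 0‖ : ℝ) * exp (((α - θ₁ - μ * ϖ + θ + μ * ϖ : ℝ) : ℂ) * I) := by
      rw [← exp_nat_mul]
      conv_lhs => rw [hp]
      rw [mul_left_comm, mul_assoc, mul_left_comm, ← exp_add, mul_left_comm, ← exp_add]
      push_cast
      ring_nf
    rw [e2, re_ofReal_mul, exp_ofReal_mul_I_re, norm_mul, norm_pow, norm_exp_ofReal_mul_I, one_pow,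
      mul_one] at hle
    exact le_of_mul_le_mul_left hle (norm_pos_iff.2 h.p_zero_ne)
  have hsin : 0 < Real.sin δ := Real.sin_pos_of_pos_of_lt_pi hδ (by linarith [Real.pi_pos])
  refine ⟨α - θ₁ - μ * ϖ, Real.pi / 2 - δ, hp, by linarith, fun θ hθ => ?_⟩
  have hα1 : -(Real.pi / 2) < α := by
    by_contra hcon
    have h1 := hcos θ₁ ⟨le_rfl, h.sector_nonempty⟩
    have e : α - θ₁ - μ * ϖ + θ₁ + μ * ϖ = α := by ring
    rw [e, ← Real.cos_neg] at h1
    have := Real.cos_nonpos_of_pi_div_two_le_of_le (x := -α) (by linarith)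
      (by linarith [neg_pi_lt_arg (pc 0 * exp (((θ₁ + μ * ϖ : ℝ) : ℂ) * I)), Real.pi_pos])
    linarith
  have hα2 : α < Real.pi / 2 := by
    by_contra hcon
    have h1 := hcos θ₁ ⟨le_rfl, h.sector_nonempty⟩
    have e : α - θ₁ - μ * ϖ + θ₁ + μ * ϖ = α := by ring
    rw [e] at h1
    have := Real.cos_nonpos_of_pi_div_two_le_of_le (x := α) (by linarith)
      (by linarith [arg_le_pi (pc 0 * exp (((θ₁ + μ * ϖ : ℝ) : ℂ) * I)), Real.pi_pos])
    linarith
  have h1 := hcos θ hθ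
  set β := α - θ₁ - μ * ϖ + θ + μ * ϖ with hβ
  have hβ1 : -(Real.pi / 2) < β := by linarith [hθ.1]
  -- Otherwise `π/2 ≤ β ≤ 3π/2`, as `θ - θ₁ < π`, and the cosine would not be positive.
  have hβ2 : β < Real.pi / 2 := by
    by_contra hcon
    have := Real.cos_nonpos_of_pi_div_two_le_of_le (x := β) (by linarith)
      (by linarith [hθ.2, h.sector_lt])
    linarith
  by_contra hcon
  rw [not_le] at hcon
  have h2 := Real.cos_lt_cos_of_nonneg_of_le_pi (x := Real.pi / 2 - δ) (y := |β|) (by linarith)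
    (by
      rw [abs_le]
      constructor <;> linarith [Real.pi_pos]) hcon
  rw [Real.cos_abs, Real.cos_pi_div_two_sub] at h2
  linarith

/-! ### The contribution of the rest of the contour -/

theorem Conditions.continuousOn_comp (h : Conditions p q r T a b γ pc qc rc μ lam ϖ θ₁ θ₂ Z)
    {f : ℂ → ℂ} (hf : DifferentiableOn ℂ f T) : ContinuousOn (fun s => f (γ s)) (Ioo 0 1) :=
  hf.continuousOn.comp h.contour.continuousOn h.mem_T

theorem Conditions.continuousOn_integrand_factor
    (h : Conditions p q r T a b γ pc qc rc μ lam ϖ θ₁ θ₂ Z) (x θ : ℝ) :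
    ContinuousOn (fun s => exp (-((x : ℂ) * exp ((θ : ℂ) * I)) * p (γ s) +
      polarPow x θ (1 / (μ : ℂ)) * r (γ s)) * q (γ s)) (Ioo 0 1) := by
  have hp := h.continuousOn_comp h.analytic_p
  have hq := h.continuousOn_comp h.analytic_q
  have hr := h.continuousOn_comp h.analytic_r
  exact ((continuousOn_const.mul hp).add (continuousOn_const.mul hr)).cexp.mul hq

theorem Conditions.aestronglyMeasurable_integrand
    (h : Conditions p q r T a b γ pc qc rc μ lam ϖ θ₁ θ₂ Z) (x θ : ℝ) :
    AEStronglyMeasurable (integrand p q r γ μ x θ) (volume.restrict (Ioo 0 1)) :=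
  ((h.continuousOn_integrand_factor x θ).aestronglyMeasurable measurableSet_Ioo).mul
    (stronglyMeasurable_deriv γ).aestronglyMeasurable

theorem Conditions.integrableOn_integrand_of_mem
    (h : Conditions p q r T a b γ pc qc rc μ lam ϖ θ₁ θ₂ Z) {θ : ℝ} (hθ : θ ∈ Icc θ₁ θ₂) {c₀ : ℝ}
    (hc₀ : 0 < c₀) : IntegrableOn (integrand p q r γ μ Z θ) (Ioo c₀ 1) := by
  obtain ⟨c, hc, hint⟩ := h.abs_conv θ hθ
  have h1 : IntegrableOn (integrand p q r γ μ Z θ) (Icc c₀ c) := by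
    refine IntegrableOn.continuousOn_mul ?_ ?_ isCompact_Icc
    · exact (h.continuousOn_integrand_factor Z θ).mono fun s hs =>
        ⟨hc₀.trans_le hs.1, hs.2.trans_lt hc.2⟩
    · exact (h.contour.integrableOn_deriv hc.2).mono_set (Icc_subset_Icc_left hc₀.le)
  refine (h1.union hint).mono_set fun s hs => ?_
  rcases le_or_gt s c with hsc | hsc
  · exact Or.inl ⟨hs.1.le, hsc⟩
  · exact Or.inr ⟨hsc, hs.2⟩

/-- Near `b` these bounds are conditions (v) and (vi); on the remaining compact piece they follow
from continuity, since `p - p(a)` has no zero there. -/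
theorem Conditions.exists_far_constants
    (h : Conditions p q r T a b γ pc qc rc μ lam ϖ θ₁ θ₂ Z) {c₀ : ℝ} (hc₀ : 0 < c₀) :
    ∃ K η : ℝ, 0 ≤ K ∧ 0 < η ∧ ∀ s ∈ Ioo c₀ 1,
      ‖r (γ s)‖ ≤ K * ‖p (γ s) - p a‖ ∧ η ≤ ‖p (γ s) - p a‖ := by
  obtain ⟨δ, hδ, hv⟩ := h.arg_le
  obtain ⟨η, hη, hre⟩ := h.re_ge
  obtain ⟨K₁, hK₁, hO⟩ := h.r_isBigO.exists_nonneg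
  have hθ₁ : θ₁ ∈ Icc θ₁ θ₂ := ⟨le_rfl, h.sector_nonempty⟩
  have hP : ∀ s ∈ Ioo (0 : ℝ) 1, p (γ s) - p a ≠ 0 := fun s hs => (hv θ₁ hθ₁ s hs).1
  obtain ⟨c, hc, hsub⟩ := (mem_nhdsLT_iff_exists_Ico_subset (a := (1 : ℝ))).1 (hO.bound.and hre)
  have hc1 : c < 1 := hc
  have hmem : Icc c₀ c ⊆ Ioo 0 1 := fun s hs => ⟨hc₀.trans_le hs.1, hs.2.trans_lt hc1⟩
  have hpc : ContinuousOn (fun s => p (γ s) - p a) (Icc c₀ c) :=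
    ((h.continuousOn_comp h.analytic_p).sub continuousOn_const).mono hmem
  have hinv : ContinuousOn (fun s => (p (γ s) - p a)⁻¹) (Icc c₀ c) :=
    hpc.inv₀ fun s hs => hP s (hmem hs)
  obtain ⟨K₂, hK₂⟩ := isCompact_Icc.exists_bound_of_continuousOn hinv
  obtain ⟨K₃, hK₃⟩ := isCompact_Icc.exists_bound_of_continuousOn
    (((h.continuousOn_comp h.analytic_r).mono hmem).mul hinv)
  refine ⟨max K₁ K₃, min η (1 / max K₂ 1), le_max_of_le_left hK₁, by positivity, fun s hs => ?_⟩
  rcases lt_or_ge s c with hsc | hsc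
  · have hs' : s ∈ Icc c₀ c := ⟨hs.1.le, hsc.le⟩
    have hpos : 0 < ‖p (γ s) - p a‖ := norm_pos_iff.2 (hP s (hmem hs'))
    have e1 := hK₂ s hs'
    have e2 := hK₃ s hs'
    simp only [Pi.mul_apply, norm_mul, norm_inv] at e1 e2
    constructor
    · rw [← div_eq_mul_inv, div_le_iff₀ hpos] at e2
      refine e2.trans ?_
      gcongr
      exact le_max_right _ _
    · refine (min_le_right _ _).trans ?_
      rw [div_le_iff₀ (by positivity), ← div_le_iff₀' hpos, one_div]
      exact e1.trans (le_max_left _ _)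
  · have hs' := hsub ⟨hsc, hs.2⟩
    constructor
    · refine hs'.1.trans ?_
      gcongr
      exact le_max_left _ _
    · refine (min_le_left _ _).trans ((hs'.2 θ₁ hθ₁).trans ((re_le_norm _).trans_eq ?_))
      rw [norm_mul, norm_exp_ofReal_mul_I, one_mul]

theorem norm_polarPow_one_div (hμ : μ ≠ 0) (x θ : ℝ) :
    ‖polarPow x θ (1 / (μ : ℂ))‖ = Real.exp (Real.log x / μ) := by
  rw [polarPow_eq_exp_logScale hμ, one_div_mul_cancel (Nat.cast_ne_zero.2 hμ), one_mul, norm_exp,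
    logScale_re]

theorem exp_log_div_le_sqrt (hμ : 2 ≤ μ) {x : ℝ} (hx : 1 ≤ x) :
    Real.exp (Real.log x / μ) ≤ √x := by
  have h2 : (2 : ℝ) ≤ μ := by exact_mod_cast hμ
  rw [Real.sqrt_eq_rpow, Real.rpow_def_of_pos (by linarith)]
  refine Real.exp_le_exp.2 ?_
  rw [div_le_iff₀ (by linarith)]
  nlinarith [Real.log_nonneg hx]

/-- For every `θ` the integrand is compared pointwise with the one at the fixed point `Z e^{iθ₁}`.
With `P = p - p(a)`, all other terms in the difference of the exponents are at most `(d x / 2) |P|`,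
so half of the decay `d x |P|` survives, and `|P| ≥ η` makes it exponential in `x`. -/
theorem Conditions.exists_far_bound (h : Conditions p q r T a b γ pc qc rc μ lam ϖ θ₁ θ₂ Z)
    (hμ : 2 ≤ μ) {c₀ : ℝ} (hc₀ : 0 < c₀) (L : ℝ) :
    ∃ C : ℝ, ∀ᶠ x : ℝ in atTop, ∀ θ ∈ Icc θ₁ θ₂,
      IntegrableOn (integrand p q r γ μ x θ) (Ioo c₀ 1) ∧
      ‖∫ s in Ioo c₀ 1, integrand p q r γ μ x θ s‖ ≤
        C * ‖exp (-((x : ℂ) * exp ((θ : ℂ) * I)) * p a)‖ * x ^ (-L) := by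
  have hμ0 : μ ≠ 0 := by omega
  obtain ⟨K, η, hK, hη, hKη⟩ := h.exists_far_constants hc₀
  obtain ⟨δ, hδ, hδ2, hre⟩ := h.exists_re_ge
  have hθ₁ : θ₁ ∈ Icc θ₁ θ₂ := ⟨le_rfl, h.sector_nonempty⟩
  have hZ := h.Z_pos
  have hd : 0 < Real.sin δ := Real.sin_pos_of_pos_of_lt_pi hδ (by linarith [Real.pi_pos])
  set d := Real.sin δ with hd_def
  set X₀ := Real.exp (Real.log Z / μ) with hX₀
  set M := Real.exp ((Z : ℂ) * exp ((θ₁ : ℂ) * I) * p a).re with hM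
  have hGi := h.integrableOn_integrand_of_mem hθ₁ hc₀
  set G := ∫ s in Ioo c₀ 1, ‖integrand p q r γ μ Z θ₁ s‖ with hG
  have hG0 : 0 ≤ G := integral_nonneg fun s => norm_nonneg _
  refine ⟨M * G, ?_⟩
  have hsmall : ∀ᶠ x : ℝ in atTop, x ^ L * Real.exp (-(d * η / 2) * x) < 1 :=
    (tendsto_rpow_mul_exp_neg_mul_atTop_nhds_zero L (d * η / 2) (by positivity)).eventually
      (gt_mem_nhds one_pos)
  filter_upwards [eventually_ge_atTop 1, hsmall,
    eventually_ge_atTop (4 / d * (K ^ 2 / d + Z + X₀ * K))] with x hx hxL hxR θ hθ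
  have hx0 : 0 < x := by linarith
  set E := ‖exp (-((x : ℂ) * exp ((θ : ℂ) * I)) * p a)‖ with hE
  -- One quarter of `d x`, together with `K² / d`, bounds `√x K` by completing the square; the lower
  -- bound on `x` is chosen so that a second quarter covers all the constants.
  have hlarge : Real.exp (Real.log x / μ) * K + Z + X₀ * K ≤ d * x / 2 := by
    have h1 := exp_log_div_le_sqrt hμ hx
    have h2 : √x * K ≤ d * x / 4 + K ^ 2 / d := by
      have h3 : √x ^ 2 = x := Real.sq_sqrt hx0.le
      have h4 : d * x / 4 + K ^ 2 / d - √x * K = (d * √x / 2 - K) ^ 2 / d := by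
        field_simp
        linear_combination (-4 * d ^ 2) * h3
      have h5 : 0 ≤ (d * √x / 2 - K) ^ 2 / d := by positivity
      linarith
    have h6 : K ^ 2 / d + Z + X₀ * K ≤ d * x / 4 := by
      have := mul_le_mul_of_nonneg_left hxR (by positivity : 0 ≤ d / 4)
      have e : d / 4 * (4 / d * (K ^ 2 / d + Z + X₀ * K)) = K ^ 2 / d + Z + X₀ * K := by
        field_simp
      linarith
    have := mul_le_mul_of_nonneg_right h1 hK
    linarith
  have hpt : ∀ s ∈ Ioo c₀ 1, ‖integrand p q r γ μ x θ s‖ ≤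
      E * M * Real.exp (-(d * η / 2) * x) * ‖integrand p q r γ μ Z θ₁ s‖ := by
    intro s hs
    have hs' : s ∈ Ioo (0 : ℝ) 1 := ⟨hc₀.trans hs.1, hs.2⟩
    obtain ⟨hr, hη'⟩ := hKη s hs
    have hP := hre θ hθ s hs'
    set P := p (γ s) - p a with hP_def
    have hp : p (γ s) = p a + P := by rw [hP_def]; ring
    have b1 : (polarPow x θ (1 / (μ : ℂ)) * r (γ s)).re ≤
        Real.exp (Real.log x / μ) * (K * ‖P‖) := by
      refine (re_le_norm _).trans ?_
      rw [norm_mul, norm_polarPow_one_div hμ0]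
      gcongr
    have b2 : -(X₀ * (K * ‖P‖)) ≤ (polarPow Z θ₁ (1 / (μ : ℂ)) * r (γ s)).re := by
      refine neg_le_of_abs_le ((abs_re_le_norm _).trans ?_)
      rw [norm_mul, norm_polarPow_one_div hμ0]
      gcongr
    have b3 : ((Z : ℂ) * exp ((θ₁ : ℂ) * I) * P).re ≤ Z * ‖P‖ := by
      refine (re_le_norm _).trans_eq ?_
      rw [norm_mul, norm_mul, norm_exp_ofReal_mul_I, norm_real, Real.norm_eq_abs, abs_of_pos hZ,
        mul_one]
    have b4 : x * (‖P‖ * d) ≤ ((x : ℂ) * exp ((θ : ℂ) * I) * P).re := by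
      rw [mul_assoc, re_ofReal_mul]
      exact mul_le_mul_of_nonneg_left hP hx0.le
    have b5 : (Real.exp (Real.log x / μ) * K + Z + X₀ * K) * ‖P‖ ≤ d * x / 2 * ‖P‖ :=
      mul_le_mul_of_nonneg_right hlarge (norm_nonneg _)
    have b6 : d * x / 2 * η ≤ d * x / 2 * ‖P‖ := by gcongr
    rw [integrand, integrand, norm_mul, norm_mul, norm_mul, norm_mul, norm_exp, norm_exp, hE, hM,
      norm_exp, ← mul_assoc, ← mul_assoc, ← Real.exp_add, ← Real.exp_add, ← Real.exp_add]
    refine mul_le_mul_of_nonneg_right (mul_le_mul_of_nonneg_right (Real.exp_le_exp.2 ?_)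
      (norm_nonneg _)) (norm_nonneg _)
    rw [hp, mul_add, mul_add, add_re, add_re, add_re, add_re]
    simp only [neg_mul, neg_re]
    linarith
  have hint : IntegrableOn (integrand p q r γ μ x θ) (Ioo c₀ 1) := by
    refine (hGi.norm.const_mul (E * M * Real.exp (-(d * η / 2) * x))).mono' ?_
      ((ae_restrict_iff' measurableSet_Ioo).2 (Eventually.of_forall hpt))
    exact (h.aestronglyMeasurable_integrand x θ).mono_measure
      (Measure.restrict_mono (Ioo_subset_Ioo_left hc₀.le) le_rfl)
  refine ⟨hint, ?_⟩
  have hexp : Real.exp (-(d * η / 2) * x) ≤ x ^ (-L) := by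
    rw [Real.rpow_neg hx0.le, ← one_div, le_div_iff₀ (Real.rpow_pos_of_pos hx0 L), mul_comm]
    exact hxL.le
  calc ‖∫ s in Ioo c₀ 1, integrand p q r γ μ x θ s‖
      ≤ ∫ s in Ioo c₀ 1, E * M * Real.exp (-(d * η / 2) * x) * ‖integrand p q r γ μ Z θ₁ s‖ :=
        norm_integral_le_of_norm_le (hGi.norm.const_mul _)
          ((ae_restrict_iff' measurableSet_Ioo).2 (Eventually.of_forall hpt))
    _ = E * M * Real.exp (-(d * η / 2) * x) * G := integral_const_mul _ _
    _ ≤ E * M * x ^ (-L) * G := by gcongr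
    _ = _ := by ring

end FaxenExpansion

namespace FaxenExpansion

variable {p q r : ℂ → ℂ} {T : Set ℂ} {a : ℂ} {b : OnePoint ℂ} {γ : ℝ → ℂ} {pc qc rc : ℕ → ℂ}
  {μ : ℕ} {lam : ℂ} {ϖ θ₁ θ₂ Z ϖ₀ : ℝ}

/-! ### Regrouping -/

/-- A Cauchy product in which the terms `j < m` vanish, because the phase series has no constant
term. The factor `μ` is that of the amplitude coefficients `μ b_n`. -/
theorem localCoeff_div_factorial (m k : ℕ) :
    localCoeff pc qc rc μ lam ϖ₀ m k / (m.factorial : ℂ) =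
      μ * fCoeff pc qc rc μ lam ϖ₀ k m := by
  have hX : (PowerSeries.X : PowerSeries ℂ) ^ m ∣
      (PowerSeries.mk fun n => if n = 0 then 0 else cCoeff pc rc μ ϖ₀ n) ^ m :=
    pow_dvd_pow_of_dvd (PowerSeries.X_dvd_iff.2 (by
      rw [← PowerSeries.coeff_zero_eq_constantCoeff_apply, PowerSeries.coeff_mk, if_pos rfl])) m
  have hb : ∀ j < m, bell (cCoeff pc rc μ ϖ₀) j m = 0 := PowerSeries.X_pow_dvd_iff.1 hX
  have hsub : Finset.Icc m k ⊆ Finset.range (k + 1) := fun j hj => by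
    rw [Finset.mem_Icc] at hj
    rw [Finset.mem_range]
    omega
  rw [localCoeff, fCoeff, PowerSeries.coeff_mul, Finset.Nat.sum_antidiagonal_eq_sum_range_succ_mk,
    ← Finset.sum_subset hsub fun j hj hj' => by
      rw [Finset.mem_range] at hj
      rw [Finset.mem_Icc] at hj'
      have := hb j (by omega)
      rw [bell] at this
      rw [this, zero_mul], div_eq_inv_mul, one_div, Finset.mul_sum, Finset.mul_sum, Finset.mul_sum]
  refine Finset.sum_congr rfl fun j _ => ?_
  rw [PowerSeries.coeff_mk, bell]
  ring

theorem fCoeff_eq_zero_of_lt {k m : ℕ} (hkm : k < m) : fCoeff pc qc rc μ lam ϖ₀ k m = 0 := by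
  rw [fCoeff, Finset.Icc_eq_empty (by omega), Finset.sum_empty, mul_zero]

/-- The coefficient of `z^(-(k+λ)/μ)` times the `n`-th Faxén integral. -/
noncomputable def groupedCoeff (pc qc rc : ℕ → ℂ) (μ : ℕ) (lam : ℂ) (ϖ₀ : ℝ) (k n : ℕ) : ℂ :=
  ∑ m ∈ Finset.range (k + 1), (gPoly μ lam (k + m) n).eval (faxenArg pc rc μ ϖ₀) *
    fCoeff pc qc rc μ lam ϖ₀ k m

/-- `k < ⌈n/2⌉` means `2k < n`, so `k + m ≤ 2k < n` and every `g_{k+m,n}` in the sum is zero. -/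
theorem groupedCoeff_eq_zero {k n : ℕ} (hk : k < halfCeil n) (hn : n < μ) :
    groupedCoeff pc qc rc μ lam ϖ₀ k n = 0 := by
  refine Finset.sum_eq_zero fun m hm => ?_
  rw [Finset.mem_range] at hm
  rw [halfCeil] at hk
  rw [gPoly_eq_zero_of_lt lam (by omega) hn, Polynomial.eval_zero, zero_mul]

theorem groupedCoeff_halfCeil_add (n m : ℕ) :
    groupedCoeff pc qc rc μ lam ϖ₀ (halfCeil n + m) n = ftilde pc qc rc μ lam ϖ₀ n m := by
  have e : Finset.Icc m (halfCeil n + 2 * m) = Finset.Ico m (halfCeil n + 2 * m + 1) := by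
    ext j
    simp only [Finset.mem_Icc, Finset.mem_Ico]
    omega
  rw [ftilde, e, Finset.sum_Ico_eq_sum_range, groupedCoeff]
  refine Finset.sum_congr (by congr 1; omega) fun j _ => ?_
  rw [add_tsub_cancel_left, add_assoc (halfCeil n)]

/-- Reduces the shifted integrals at order `k` to the `μ` basic ones. The terms `k < m < N`, left
over from the square truncation, have zero coefficient. -/
theorem sum_localCoeff_eq (hμ : 2 ≤ μ) (hlam : 0 < lam.re) {k N : ℕ} (hk : k < N) :
    ∑ m ∈ Finset.range N, localCoeff pc qc rc μ lam ϖ₀ m k / (m.factorial : ℂ) *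
        kernelInt μ (faxenArg pc rc μ ϖ₀) (lam + (k + m : ℕ)) =
      ∑ n ∈ Finset.range μ, groupedCoeff pc qc rc μ lam ϖ₀ k n *
        Fi (1 / (μ : ℝ)) ((lam + n) / μ) (faxenArg pc rc μ ϖ₀) := by
  have h1 : ∀ m, localCoeff pc qc rc μ lam ϖ₀ m k / (m.factorial : ℂ) *
        kernelInt μ (faxenArg pc rc μ ϖ₀) (lam + (k + m : ℕ)) =
      ∑ n ∈ Finset.range μ, (gPoly μ lam (k + m) n).eval (faxenArg pc rc μ ϖ₀) *
        fCoeff pc qc rc μ lam ϖ₀ k m *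
          Fi (1 / (μ : ℝ)) ((lam + n) / μ) (faxenArg pc rc μ ϖ₀) := fun m => by
    rw [localCoeff_div_factorial, kernelInt_add_natCast hμ hlam, Finset.mul_sum]
    refine Finset.sum_congr rfl fun n _ => ?_
    rw [Fi_eq_kernelInt hμ]
    ring
  simp_rw [h1, groupedCoeff, Finset.sum_mul]
  rw [Finset.sum_comm]
  refine Finset.sum_congr rfl fun n _ => (Finset.sum_subset (fun j hj => ?_) fun j _ hj => ?_).symm
  · rw [Finset.mem_range] at hj ⊢
    omega
  · rw [Finset.mem_range] at hj
    rw [fCoeff_eq_zero_of_lt (by omega), mul_zero, zero_mul]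

/-! ### Assembling the expansion -/

/-- For non-real `λ` the modulus of `z^(-λ/μ)` also contains `e^{Im λ · θ/μ}`, which is bounded on
the sector. -/
theorem norm_exp_neg_mul_logScale_le {x θ : ℝ} (hx : 0 < x) (hθ : θ ∈ Icc θ₁ θ₂) :
    ‖exp (-(lam * logScale μ x θ))‖ ≤
      Real.exp (|lam.im| * (|θ₁| + |θ₂|) / μ) * x ^ (-(lam.re / μ)) := by
  rw [norm_exp, Real.rpow_def_of_pos hx, ← Real.exp_add, neg_re, mul_re, logScale_re, logScale_im]
  refine Real.exp_le_exp.2 ?_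
  have h1 : lam.im * θ ≤ |lam.im| * (|θ₁| + |θ₂|) := by
    refine (le_abs_self _).trans ?_
    rw [abs_mul]
    gcongr
    rw [abs_le]
    constructor
    · linarith [neg_abs_le θ₁, abs_nonneg θ₂, hθ.1]
    · linarith [le_abs_self θ₂, abs_nonneg θ₁, hθ.2]
  have h2 : lam.im * θ / μ ≤ |lam.im| * (|θ₁| + |θ₂|) / μ :=
    div_le_div_of_nonneg_right h1 (Nat.cast_nonneg _)
  have e : -(lam.re * (Real.log x / μ) - lam.im * (θ / μ)) =
      lam.im * θ / μ + Real.log x * -(lam.re / μ) := by ring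
  rw [e]
  linarith

theorem norm_exp_neg_natCast_mul_logScale {x : ℝ} (hx : 0 < x) (θ : ℝ) (k : ℕ) :
    ‖exp (-(k * logScale μ x θ))‖ = x ^ (-((k : ℝ) / μ)) := by
  rw [norm_exp, neg_re, ← ofReal_natCast, re_ofReal_mul, logScale_re, Real.rpow_def_of_pos hx]
  congr 1
  ring

theorem sum_ftilde_eq (hμ : μ ≠ 0) (x θ : ℝ) (F : ℕ → ℂ) (M : ℕ → ℕ) :
    ∑ n ∈ Finset.range μ, polarPow x θ (-((halfCeil n + lam) / μ)) * F n *
        ∑ m ∈ Finset.range (M n), ftilde pc qc rc μ lam ϖ₀ n m * polarPow x θ (-(m / μ)) =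
      exp (-(lam * logScale μ x θ)) * ∑ n ∈ Finset.range μ, F n *
        ∑ k ∈ Finset.range (halfCeil n + M n), exp (-(k * logScale μ x θ)) *
          groupedCoeff pc qc rc μ lam ϖ₀ k n := by
  have hμ' : (μ : ℂ) ≠ 0 := Nat.cast_ne_zero.2 hμ
  rw [Finset.mul_sum]
  refine Finset.sum_congr rfl fun n hn => ?_
  rw [Finset.sum_range_add, Finset.sum_eq_zero (s := Finset.range (halfCeil n)) fun k hk => by
    rw [groupedCoeff_eq_zero (Finset.mem_range.1 hk) (Finset.mem_range.1 hn), mul_zero], zero_add,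
    Finset.mul_sum, Finset.mul_sum, Finset.mul_sum]
  refine Finset.sum_congr rfl fun m _ => ?_
  rw [groupedCoeff_halfCeil_add, polarPow_eq_exp_logScale hμ, polarPow_eq_exp_logScale hμ]
  have e1 : -((halfCeil n + lam) / μ) * μ * logScale μ x θ =
      -(lam * logScale μ x θ) + -(halfCeil n * logScale μ x θ) := by
    field_simp
    ring
  have e2 : -((m : ℂ) / μ) * μ * logScale μ x θ = -(m * logScale μ x θ) := by
    field_simp
  have e3 : -(((halfCeil n + m : ℕ) : ℂ) * logScale μ x θ) =
      -(halfCeil n * logScale μ x θ) + -(m * logScale μ x θ) := by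
    push_cast
    ring
  rw [e1, e2, e3, exp_add, exp_add]
  ring

/-- The cut-offs `M n` may keep more than the orders below `N`; the surplus terms have index `k ≥
N`, so each is `O(x^(-N/μ))` for `x ≥ 1`. -/
theorem exists_truncation_bound (F : ℕ → ℂ) (N : ℕ) (M : ℕ → ℕ)
    (hM : ∀ n < μ, N ≤ halfCeil n + M n) :
    ∃ C : ℝ, ∀ x : ℝ, 1 ≤ x → ∀ θ : ℝ,
      ‖(∑ k ∈ Finset.range N, exp (-(k * logScale μ x θ)) *
          ∑ n ∈ Finset.range μ, groupedCoeff pc qc rc μ lam ϖ₀ k n * F n) -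
        ∑ n ∈ Finset.range μ, F n *
          ∑ k ∈ Finset.range (halfCeil n + M n), exp (-(k * logScale μ x θ)) *
            groupedCoeff pc qc rc μ lam ϖ₀ k n‖ ≤ C * x ^ (-((N : ℝ) / μ)) := by
  refine ⟨∑ n ∈ Finset.range μ, ‖F n‖ * ∑ k ∈ Finset.Ico N (halfCeil n + M n),
    ‖groupedCoeff pc qc rc μ lam ϖ₀ k n‖, fun x hx θ => ?_⟩
  have hx0 : 0 < x := by linarith
  have e : (∑ k ∈ Finset.range N, exp (-(k * logScale μ x θ)) *
          ∑ n ∈ Finset.range μ, groupedCoeff pc qc rc μ lam ϖ₀ k n * F n) =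
      ∑ n ∈ Finset.range μ, F n * ∑ k ∈ Finset.range N, exp (-(k * logScale μ x θ)) *
            groupedCoeff pc qc rc μ lam ϖ₀ k n := by
    simp_rw [Finset.mul_sum]
    rw [Finset.sum_comm]
    refine Finset.sum_congr rfl fun n _ => Finset.sum_congr rfl fun k _ => ?_
    ring
  rw [e, ← norm_neg, neg_sub, ← Finset.sum_sub_distrib, Finset.sum_mul]
  refine norm_sum_le_of_le _ fun n hn => ?_
  rw [← mul_sub, ← Finset.sum_Ico_eq_sub _ (hM n (Finset.mem_range.1 hn)), norm_mul, mul_assoc,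
    Finset.sum_mul]
  refine mul_le_mul_of_nonneg_left (norm_sum_le_of_le _ fun k hk => ?_) (norm_nonneg _)
  rw [norm_mul, norm_exp_neg_natCast_mul_logScale hx0, mul_comm]
  refine mul_le_mul_of_nonneg_left (Real.rpow_le_rpow_of_exponent_le hx ?_) (norm_nonneg _)
  have : (N : ℝ) ≤ k := by exact_mod_cast (Finset.mem_Ico.1 hk).1
  have := div_le_div_of_nonneg_right this (Nat.cast_nonneg (α := ℝ) μ)
  linarith

theorem Conditions.exists_expansion (h : Conditions p q r T a b γ pc qc rc μ lam ϖ θ₁ θ₂ Z)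
    (hμ : 2 ≤ μ) (h₀ : pc 0 = ‖pc 0‖ * exp ((ϖ₀ : ℂ) * I)) {ϑ : ℝ} (hϑ : ϑ < Real.pi / 2)
    (hdir : ∀ θ ∈ Icc θ₁ θ₂, |ϖ₀ + θ + μ * ϖ| ≤ ϑ) (N : ℕ) :
    ∃ C : ℝ, ∀ᶠ x : ℝ in atTop, ∀ θ ∈ Icc θ₁ θ₂,
      IntegrableOn (integrand p q r γ μ x θ) (Ioo 0 1) ∧
      ‖contourI p q r γ μ x θ - exp (-((x : ℂ) * exp ((θ : ℂ) * I)) * p a) *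
        (exp (-(lam * logScale μ x θ)) * ∑ k ∈ Finset.range N, exp (-(k * logScale μ x θ)) *
          ∑ n ∈ Finset.range μ, groupedCoeff pc qc rc μ lam ϖ₀ k n *
            Fi (1 / (μ : ℝ)) ((lam + n) / μ) (faxenArg pc rc μ ϖ₀))‖ ≤
        C * ‖exp (-((x : ℂ) * exp ((θ : ℂ) * I)) * p a)‖ * x ^ (-((N + lam.re) / μ)) := by
  obtain ⟨c₀, hc₀, K, hK⟩ := h.exists_near_expansion hμ h₀ hϑ hdir N
  obtain ⟨C, hC⟩ := h.exists_far_bound hμ hc₀.1 ((N + lam.re) / μ)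
  refine ⟨Real.exp (|lam.im| * (|θ₁| + |θ₂|) / μ) * |K| + C, ?_⟩
  filter_upwards [hC, eventually_ge_atTop 1] with x hfar hx θ hθ
  have hx0 : 0 < x := by linarith
  obtain ⟨hi1, hn⟩ := hK x hx θ hθ
  obtain ⟨hi2, hf⟩ := hfar θ hθ
  have hU : Ioc 0 c₀ ∪ Ioo c₀ 1 = Ioo (0 : ℝ) 1 := Ioc_union_Ioo_eq_Ioo hc₀.1.le hc₀.2
  have hdisj : Disjoint (Ioc 0 c₀) (Ioo c₀ 1) :=
    Set.disjoint_left.2 fun s hs hs' => absurd hs.2 (not_le.2 hs'.1)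
  have hI : contourI p q r γ μ x θ = (∫ s in Ioc 0 c₀, integrand p q r γ μ x θ s) +
      ∫ s in Ioo c₀ 1, integrand p q r γ μ x θ s := by
    rw [contourI, ← hU, setIntegral_union hdisj measurableSet_Ioo hi1 hi2]
  refine ⟨hU ▸ hi1.union hi2, ?_⟩
  rw [Finset.sum_congr rfl fun k hk => by
    rw [sum_localCoeff_eq hμ h.lam_re_pos (Finset.mem_range.1 hk)], mul_assoc] at hn
  set E := exp (-((x : ℂ) * exp ((θ : ℂ) * I)) * p a)
  have hpow : x ^ (-((N + lam.re) / μ)) =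
      x ^ (-(lam.re / μ)) * Real.exp (-(N * (logScale μ x θ).re)) := by
    rw [Real.rpow_def_of_pos hx0, Real.rpow_def_of_pos hx0, ← Real.exp_add, logScale_re]
    congr 1
    ring
  have hn' : ‖E * exp (-(lam * logScale μ x θ))‖ *
      (K * Real.exp (-(N * (logScale μ x θ).re))) ≤
      Real.exp (|lam.im| * (|θ₁| + |θ₂|) / μ) * |K| * ‖E‖ * x ^ (-((N + lam.re) / μ)) := by
    rw [hpow, norm_mul]
    calc ‖E‖ * ‖exp (-(lam * logScale μ x θ))‖ * (K * Real.exp (-(N * (logScale μ x θ).re)))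
        ≤ ‖E‖ * ‖exp (-(lam * logScale μ x θ))‖ *
          (|K| * Real.exp (-(N * (logScale μ x θ).re))) := by
          gcongr
          exact le_abs_self K
      _ ≤ ‖E‖ * (Real.exp (|lam.im| * (|θ₁| + |θ₂|) / μ) * x ^ (-(lam.re / μ))) *
          (|K| * Real.exp (-(N * (logScale μ x θ).re))) := by
          gcongr
          exact norm_exp_neg_mul_logScale_le hx0 hθ
      _ = _ := by ring
  rw [hI, add_sub_right_comm]
  refine (norm_add_le _ _).trans ?_
  rw [add_mul, add_mul]
  exact add_le_add (hn.trans hn') hf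

theorem Conditions.hasExpansion (h : Conditions p q r T a b γ pc qc rc μ lam ϖ θ₁ θ₂ Z)
    (hμ : 2 ≤ μ) (h₀ : pc 0 = ‖pc 0‖ * exp ((ϖ₀ : ℂ) * I)) {ϑ : ℝ} (hϑ : ϑ < Real.pi / 2)
    (hdir : ∀ θ ∈ Icc θ₁ θ₂, |ϖ₀ + θ + μ * ϖ| ≤ ϑ) :
    HasExpansion (contourI p q r γ μ) (p a) μ lam θ₁ θ₂
      (fun n => Fi (1 / (μ : ℝ)) ((lam + n) / μ) (faxenArg pc rc μ ϖ₀))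
      (ftilde pc qc rc μ lam ϖ₀) := by
  intro N M hM
  obtain ⟨C, hC⟩ := h.exists_expansion hμ h₀ hϑ hdir N
  obtain ⟨C', hC'⟩ := exists_truncation_bound (pc := pc) (qc := qc) (rc := rc) (lam := lam)
    (ϖ₀ := ϖ₀) (fun n => Fi (1 / (μ : ℝ)) ((lam + n) / μ) (faxenArg pc rc μ ϖ₀)) N M hM
  obtain ⟨R, hR⟩ := eventually_atTop.1 (hC.and (eventually_ge_atTop 1))
  refine ⟨C + Real.exp (|lam.im| * (|θ₁| + |θ₂|) / μ) * |C'|, R, fun x hx θ hθ => ?_⟩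
  obtain ⟨hx', hx1⟩ := hR x hx
  have hx0 : 0 < x := by linarith
  obtain ⟨-, hb⟩ := hx' θ hθ
  have hb' := hC' x hx1 θ
  rw [sum_ftilde_eq (by omega)]
  set E := exp (-((x : ℂ) * exp ((θ : ℂ) * I)) * p a)
  set S := ∑ k ∈ Finset.range N, exp (-(k * logScale μ x θ)) *
    ∑ n ∈ Finset.range μ, groupedCoeff pc qc rc μ lam ϖ₀ k n *
      Fi (1 / (μ : ℝ)) ((lam + n) / μ) (faxenArg pc rc μ ϖ₀)
  set S' := ∑ n ∈ Finset.range μ, Fi (1 / (μ : ℝ)) ((lam + n) / μ) (faxenArg pc rc μ ϖ₀) *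
    ∑ k ∈ Finset.range (halfCeil n + M n), exp (-(k * logScale μ x θ)) *
      groupedCoeff pc qc rc μ lam ϖ₀ k n
  have hpow : x ^ (-((N + lam.re) / μ)) = x ^ (-(lam.re / μ)) * x ^ (-((N : ℝ) / μ)) := by
    rw [← Real.rpow_add hx0]
    congr 1
    ring
  have e : contourI p q r γ μ x θ - E * (exp (-(lam * logScale μ x θ)) * S') =
      (contourI p q r γ μ x θ - E * (exp (-(lam * logScale μ x θ)) * S)) +
        E * exp (-(lam * logScale μ x θ)) * (S - S') := by ring
  rw [e]
  refine (norm_add_le _ _).trans ?_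
  rw [add_mul, add_mul]
  refine add_le_add hb ?_
  rw [norm_mul, norm_mul, hpow]
  calc ‖E‖ * ‖exp (-(lam * logScale μ x θ))‖ * ‖S - S'‖
      ≤ ‖E‖ * (Real.exp (|lam.im| * (|θ₁| + |θ₂|) / μ) * x ^ (-(lam.re / μ))) *
        (|C'| * x ^ (-((N : ℝ) / μ))) := by
        gcongr
        · exact norm_exp_neg_mul_logScale_le hx0 hθ
        · exact hb'.trans (by gcongr; exact le_abs_self C')
    _ = _ := by ring

end FaxenExpansion
theorem corollary2 (p q r : ℂ → ℂ) (T : Set ℂ) (a : ℂ) (b : OnePoint ℂ) (γ : ℝ → ℂ)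
    (pc qc rc : ℕ → ℂ) (μ : ℕ) (hμ : 2 ≤ μ) (lam : ℂ) (ϖ θ₁ θ₂ Z : ℝ)
    (h : FaxenExpansion.Conditions p q r T a b γ pc qc rc μ lam ϖ θ₁ θ₂ Z) :
    -- the branch of `arg p₀`
    ∃ ϖ₀ : ℝ, pc 0 = ‖pc 0‖ * Complex.exp ((ϖ₀ : ℂ) * Complex.I) ∧
      (∀ θ ∈ Set.Icc θ₁ θ₂, |ϖ₀ + θ + μ * ϖ| ≤ Real.pi / 2) ∧
      -- the integral converges absolutely for all large `|z|`
      (∃ R : ℝ, ∀ x ≥ R, ∀ θ ∈ Set.Icc θ₁ θ₂, MeasureTheory.IntegrableOn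
        (FaxenExpansion.integrand p q r γ μ x θ) (Set.Ioo 0 1)) ∧
      -- the expansion in terms of the derivatives of Faxén's integral
      FaxenExpansion.HasExpansion (FaxenExpansion.contourI p q r γ μ) (p a) μ lam θ₁ θ₂
        (fun n => iteratedDeriv n (FaxenExpansion.Fi (1 / (μ : ℝ)) (lam / μ))
          (FaxenExpansion.faxenArg pc rc μ ϖ₀))
        (FaxenExpansion.ftilde pc qc rc μ lam ϖ₀) ∧
      -- the equality of these derivatives with shifted Faxén integrals
      (∀ n < μ, iteratedDeriv n (FaxenExpansion.Fi (1 / (μ : ℝ)) (lam / μ))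
          (FaxenExpansion.faxenArg pc rc μ ϖ₀) =
        FaxenExpansion.Fi (1 / (μ : ℝ)) ((lam + n) / μ) (FaxenExpansion.faxenArg pc rc μ ϖ₀)) ∧
      -- the expansion in terms of the shifted Faxén integrals
      FaxenExpansion.HasExpansion (FaxenExpansion.contourI p q r γ μ) (p a) μ lam θ₁ θ₂
        (fun n => FaxenExpansion.Fi (1 / (μ : ℝ)) ((lam + n) / μ)
          (FaxenExpansion.faxenArg pc rc μ ϖ₀))
        (FaxenExpansion.ftilde pc qc rc μ lam ϖ₀) := by
  obtain ⟨ϖ₀, ϑ, h₀, hϑ, hdir⟩ := h.exists_branch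
  have hexp := h.hasExpansion hμ h₀ hϑ hdir
  have hderiv := FaxenExpansion.iteratedDeriv_Fi hμ h.lam_re_pos
  -- Only the integrability part is needed here, so the trivial order `0` is enough.
  obtain ⟨C, hC⟩ := h.exists_expansion hμ h₀ hϑ hdir 0
  obtain ⟨R, hR⟩ := Filter.eventually_atTop.1 hC
  refine ⟨ϖ₀, h₀, fun θ hθ => (hdir θ hθ).trans hϑ.le, ⟨R, fun x hx θ hθ => (hR x hx θ hθ).1⟩, ?_,
    fun n _ => hderiv n _, hexp⟩
  simp_rw [hderiv]
  exact hexp
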